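/- **Setting.** On $\mathbb R^4$ and $\mathbb C^4$ let $\langle z,w\rangle=-z_1w_1-z_2w_2+z_3w_3+z_4w_4$, and on $\mathbb C^4$ let $(z,w)=\langle z,\bar w\rangle$. Let $\mathbb H^3_1=\{p\in\mathbb R^4:\langle p,p\rangle=-1\}$ be anti-de Sitter 3-space, $T_1^-\mathbb H^3_1=\{(p,v): p\in \mathbb H^3_1,\ \langle p,v\rangle=0,\ \langle v,v\rangle=-1\}$, and let $Q_2^*$ be the connected component of $[1:i:0:0]$ in $\{[z]\in\mathbb CP^3:(z,z)<0,\ \langle z,z\rangle=0\}$, with the Kähler metric for which the Hopf fibration $\{(z,z)=-1\}\to\{[z] : (z,z)<0\}$ is a pseudo-Riemannian submersion. Let $M$ be a Riemann surface; $z$ denotes any conformal coordinate of it. Surfaces are smooth conformal immersions of $M$ or of open subsets of $M$. For a spacelike surface $F$ in $\mathbb H^3_1$ with unit normal $N$ (so $(F,N)\in T_1^-\mathbb H^3_1$) the Hopf differential is $\langle F_{zz},N\rangle\,dz^2$, and $F$ is maximal if its mean curvature vanishes. The normal is future-pointing if $F_1N_2-F_2N_1>0$. A horizontal lift of a surface $f$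 in $Q_2^*$ is a smooth map $\mathfrak f$ into $\mathbb C^4$ with $f=[\mathfrak f]$, $(\mathfrak f,\mathfrak f)=-1$, $(\mathfrak f_z,\mathfrak f)=(\mathfrak f_{\bar z},\mathfrak f)=0$; put $\alpha=\langle\mathfrak f_z,\mathfrak f_z\rangle$ and $\beta=\langle\mathfrak f_z,\mathfrak f_{\bar z}\rangle$, and call $\mathfrak f$ normalized if $\beta$ is real and $\beta\ge 0$. **Theorem.** (1) Let $f_{\max}:M\to\mathbb H^3_1$ be a spacelike maximal surface with unit normal $N$, metric $2e^{\hat u}dz\,d\bar z$ and Hopf differential $\mathcal Q\,dz^2$. If $M$ is connected, $N$ or $-N$ is future-pointing. If $N$ is future-pointing, then $f=[f_{\max}+iN]$ is a minimal Lagrangian surface in $Q_2^*$ and $\mathfrak f=\frac1{\sqrt2}(f_{\max}+iN)$ is a horizontal lift of it; its differential $\alpha\,dz^2$ is holomorphic and equals $-i\mathcal Q\,dz^2$, $\beta=\frac12(e^{\hat u}-|\mathcal Q|^2e^{-\hat u})$ is real, and the metric of $f$ is $(e^{\hat u}+|\mathcal Q|^2e^{-\hat u})\,dz\,d\bar z$.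 (2) Conversely, let $f:M\to Q_2^*$ be a minimal Lagrangian surface with metric $2e^u\,dz\,d\bar z$. (a) Let $\hat{\mathfrak f}$ be a normalized horizontal lift of $f$ on a connected open set $V\subseteq M$ with $\beta\not\equiv0$, and $\hat\alpha=\langle\hat{\mathfrak f}_z,\hat{\mathfrak f}_z\rangle$. Then $\hat\alpha\,dz^2$ is holomorphic, and there is a pair $(f_{\max},N):V\to T_1^-\mathbb H^3_1$ with $\hat{\mathfrak f}=\frac1{\sqrt2}(f_{\max}+iN)$, hence $f=[f_{\max}+iN]$, such that: $f_{\max}$ is a spacelike maximal surface with unit normal $N$; $N$ is a spacelike maximal surface with unit normal $f_{\max}$ on every open set on which $\hat\alpha$ has no zero; the Hopf differentials $\langle (f_{\max})_{zz},N\rangle dz^2$ and $\langle N_{zz},f_{\max}\rangle dz^2$ are both $i\hat\alpha\,dz^2$; and the metrics $2e^{\hat u}dz\,d\bar z$ of $f_{\max}$ and $2e^{\tilde u}dz\,d\bar z$ of $N$ (where $e^{\tilde u}$ is to be read as $0$ at the zeros of $\hat\alpha$) are given by $$e^{\hat u}=e^u+\sqrt{e^{2u}-|\hat\alpha|^2},\qquad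 e^{\tilde u}=e^u-\sqrt{e^{2u}-|\hat\alpha|^2}.$$ (b) Every $p\in M$ has an open neighbourhood $V$ with a horizontal lift $\hat{\mathfrak f}$ on $V$ for which $\beta$ is real, and with a pair $(f_{\max},N)$ as in (a), except that the metrics are given by $e^{\hat u}=e^u+\beta$ and $e^{\tilde u}=e^u-\beta$, where $\beta^2=e^{2u}-|\hat\alpha|^2$. If $\beta(p)\neq 0$, that is, if $e^u>|\hat\alpha|$ at $p$, then moreover $\beta=\sqrt{e^{2u}-|\hat\alpha|^2}>0$ on $V$. -/

import Mathlib

open scoped Manifold ContDiff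

noncomputable section

namespace MaxLag

/-! ### The pseudo-Euclidean spaces `ℝ⁴₂` and `ℂ⁴₂` -/

/-- The bilinear form `-z₁w₁ - z₂w₂ + z₃w₃ + z₄w₄` of signature `(2,2)`, over `ℝ` or over `ℂ`. -/
def bil {R : Type*} [CommRing R] (z w : Fin 4 → R) : R :=
  -(z 0 * w 0) - z 1 * w 1 + z 2 * w 2 + z 3 * w 3

/-- Coordinatewise complex conjugation on `ℂ⁴`. -/
def conj4 (z : Fin 4 → ℂ) : Fin 4 → ℂ := fun i => (starRingEnd ℂ) (z i)

/-- The Hermitian form `(z, w) = ⟨z, w̄⟩`. -/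
def herm (z w : Fin 4 → ℂ) : ℂ := bil z (conj4 w)

/-- The inclusion `ℝ⁴ ⊂ ℂ⁴`. -/
def toC (x : Fin 4 → ℝ) : Fin 4 → ℂ := fun i => (x i : ℂ)

/-- The vector `x + i y` of `ℂ⁴`. -/
def cvec (x y : Fin 4 → ℝ) : Fin 4 → ℂ := toC x + Complex.I • toC y

/-! ### Anti-de Sitter space, its timelike unit tangent bundle, and the complex quadric -/

/-- Anti-de Sitter 3-space `ℍ³₁`, of curvature `-1`, in `ℝ⁴₂`. -/
def AdS3 : Set (Fin 4 → ℝ) := {p | bil p p = -1}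

/-- The timelike unit tangent bundle `T₁⁻ℍ³₁`: the tangent space of `ℍ³₁` at `p` is the
orthogonal complement of `p` in `ℝ⁴₂`, a Lorentzian 3-space. -/
def T1minus : Set ((Fin 4 → ℝ) × (Fin 4 → ℝ)) :=
  {x | x.1 ∈ AdS3 ∧ bil x.1 x.2 = 0 ∧ bil x.2 x.2 = -1}

/-- The timelike tangent vector `v` at `p ∈ ℍ³₁` is future-pointing: `ℍ³₁` is time-oriented by
the timelike vector field `p ↦ (-p₂, p₁, 0, 0)`, and the inner product of `v` with that field
is `-(p₁ v₂ - p₂ v₁)`. -/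
def FuturePointing (p v : Fin 4 → ℝ) : Prop := 0 < p 0 * v 1 - p 1 * v 0

/-- The complex projective space `ℂP³`. -/
abbrev CP3 : Type := Projectivization ℂ (Fin 4 → ℂ)

/-- The quotient topology of `ℂP³`. -/
instance instTopologicalSpaceCP3 : TopologicalSpace CP3 :=
  TopologicalSpace.coinduced (Projectivization.mk' ℂ) inferInstance

/-- The point `q` of `ℂP³` is `[v]` (in particular `v ≠ 0`). -/
def IsClass (q : CP3) (v : Fin 4 → ℂ) : Prop := ∃ h : v ≠ 0, q = Projectivization.mk ℂ v h

/-- The negative null lines: `{[z] ∈ ℂH³₁ ∣ ⟨z, z⟩ = 0}`. -/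
def negQuadric : Set CP3 := {q | ∃ v, IsClass q v ∧ (herm v v).re < 0 ∧ bil v v = 0}

lemma base_ne_zero : (![1, Complex.I, 0, 0] : Fin 4 → ℂ) ≠ 0 := by
  intro h
  have := congrFun h 0
  simp at this

/-- The complex hyperbolic quadric `Q₂*`: the connected component of `[1 : i : 0 : 0]` in
`{[z] ∈ ℂH³₁ ∣ ⟨z, z⟩ = 0}`. -/
def Q2star : Set CP3 :=
  connectedComponentIn negQuadric (Projectivization.mk ℂ ![1, Complex.I, 0, 0] base_ne_zero)

/-! ### Calculus in a conformal coordinate `z = x + i y`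

The vectors `1, i ∈ ℂ` stand for `∂ₓ` and `∂ᵧ`. -/

/-- The Wirtinger derivative `∂_z = (∂ₓ - i ∂ᵧ) / 2`. -/
def dz (h : ℂ → Fin 4 → ℂ) (z : ℂ) : Fin 4 → ℂ :=
  (1 / 2 : ℂ) • (fderiv ℝ h z 1 - Complex.I • fderiv ℝ h z Complex.I)

/-- The Wirtinger derivative `∂_z̄ = (∂ₓ + i ∂ᵧ) / 2`. -/
def dzbar (h : ℂ → Fin 4 → ℂ) (z : ℂ) : Fin 4 → ℂ :=
  (1 / 2 : ℂ) • (fderiv ℝ h z 1 + Complex.I • fderiv ℝ h z Complex.I)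

/-- The symmetric bilinear form `g` on the tangent plane is `c dz dz̄ = c (dx² + dy²)`. -/
def IsConformalForm (g : ℂ → ℂ → ℝ) (c : ℝ) : Prop :=
  ∀ v w : ℂ, g v w = c * (v * (starRingEnd ℂ) w).re

/-! ### Surfaces in anti-de Sitter space, in a conformal coordinate -/

/-- The form induced on the surface by a map into `ℝ⁴₂`. -/
def inducedForm (F : ℂ → Fin 4 → ℝ) (z v w : ℂ) : ℝ := bil (fderiv ℝ F z v) (fderiv ℝ F z w)

/-- The second fundamental form of the surface `F` in `ℍ³₁` with respect to the unit normal
`N`: `⟨∂_v ∂_w F, N⟩`. -/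
def secondForm (F N : ℂ → Fin 4 → ℝ) (z v w : ℂ) : ℝ :=
  bil (fderiv ℝ (fun ζ => fderiv ℝ F ζ w) z v) (N z)

/-- The mean curvature in a conformal coordinate: half the trace of the second fundamental
form with respect to the induced metric. -/
def meanCurvature (F N : ℂ → Fin 4 → ℝ) (z : ℂ) : ℝ :=
  (secondForm F N z 1 1 + secondForm F N z Complex.I Complex.I) / (2 * inducedForm F z 1 1)

/-- The coefficient `⟨F_zz, N⟩` of the Hopf differential. -/
def hopf (F N : ℂ → Fin 4 → ℝ) (z : ℂ) : ℂ :=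
  bil (dz (dz (fun ζ => toC (F ζ))) z) (toC (N z))

/-- On the open set `U` of the coordinate plane, `F` is a conformally parametrized spacelike
maximal surface in `ℍ³₁` and `N` is a unit normal of it. -/
structure IsMaximalCoord (U : Set ℂ) (F N : ℂ → Fin 4 → ℝ) : Prop where
  smooth_F : ContDiffOn ℝ ∞ F U
  smooth_N : ContDiffOn ℝ ∞ N U
  mem_bundle : ∀ z ∈ U, (F z, N z) ∈ T1minus
  normal : ∀ z ∈ U, ∀ v : ℂ, bil (fderiv ℝ F z v) (N z) = 0
  spacelike : ∀ z ∈ U, ∃ c : ℝ, 0 < c ∧ IsConformalForm (inducedForm F z) c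
  maximal : ∀ z ∈ U, meanCurvature F N z = 0

/-! ### Surfaces in the complex quadric, in a conformal coordinate

The surface is described by a lift `f` into
`{z ∈ ℂ⁴₂ ∣ (z, z) = -1, ⟨z, z⟩ = 0}`, the circle bundle over the quadric given by the Hopf
fibration `ℍ⁷₃ → ℂH³₁`. The quadric carries the metric and the Kähler form that make the
Hopf fibration a pseudo-Riemannian submersion. -/

/-- For `(z, z) = -1` and `⟨z, z⟩ = 0`: the Hermitian orthogonal projection of `ℂ⁴₂` onto the
complement of `z` and `z̄`. This complement is the horizontal space at `z`, isometric and
complex isomorphic to the tangent space of the quadric at `[z]`. -/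
def horProj (z w : Fin 4 → ℂ) : Fin 4 → ℂ := w + herm w z • z + herm w (conj4 z) • conj4 z

/-- The horizontal lift at `f z` of the derivative of `[f]` in the direction `v`. -/
def horDeriv (f : ℂ → Fin 4 → ℂ) (z v : ℂ) : Fin 4 → ℂ := horProj (f z) (fderiv ℝ f z v)

/-- The metric induced by `[f]` from the quadric. -/
def lagMetric (f : ℂ → Fin 4 → ℂ) (z v w : ℂ) : ℝ := (herm (horDeriv f z v) (horDeriv f z w)).re

/-- The pull-back of the Kähler form of the quadric by `[f]`. -/
def kahlerForm (f : ℂ → Fin 4 → ℂ) (z v w : ℂ) : ℝ := -(herm (horDeriv f z v) (horDeriv f z w)).im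

/-- The Levi-Civita connection of the quadric along `[f]`: the covariant derivative in the
direction `v` of the vector field along `[f]` whose horizontal lift along `f` is `W`. The last
term corrects for the vertical component of the derivative of `f`. -/
def covDeriv (f W : ℂ → Fin 4 → ℂ) (z v : ℂ) : Fin 4 → ℂ :=
  horProj (f z) (fderiv ℝ W z v) + herm (fderiv ℝ f z v) (f z) • W z

/-- The component of the horizontal vector `W` that is orthogonal, for the real inner product
`Re (·, ·)`, to the orthogonal vectors `X` and `Y`. -/
def normalPart (X Y W : Fin 4 → ℂ) : Fin 4 → ℂ :=
  W - ((herm W X).re / (herm X X).re) • X - ((herm W Y).re / (herm Y Y).re) • Y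

/-- The second fundamental form of the conformal immersion `[f]` in the quadric (lifted
horizontally to `f z`). -/
def lagSecondForm (f : ℂ → Fin 4 → ℂ) (z v w : ℂ) : Fin 4 → ℂ :=
  normalPart (horDeriv f z 1) (horDeriv f z Complex.I) (covDeriv f (fun ζ => horDeriv f ζ w) z v)

/-- The mean curvature vector of the conformal immersion `[f]` in the quadric: half the trace
of the second fundamental form with respect to the induced metric. -/
def lagMeanCurvature (f : ℂ → Fin 4 → ℂ) (z : ℂ) : Fin 4 → ℂ :=
  (1 / (2 * lagMetric f z 1 1)) •
    (lagSecondForm f z 1 1 + lagSecondForm f z Complex.I Complex.I)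

/-- On the open set `U` of the coordinate plane, `[f]` is a conformal minimal Lagrangian
immersion into the quadric, and `f` is a lift of it. -/
structure IsMinLagCoord (U : Set ℂ) (f : ℂ → Fin 4 → ℂ) : Prop where
  smooth : ContDiffOn ℝ ∞ f U
  unit : ∀ z ∈ U, herm (f z) (f z) = -1
  null : ∀ z ∈ U, bil (f z) (f z) = 0
  immersion : ∀ z ∈ U, ∃ c : ℝ, 0 < c ∧ IsConformalForm (lagMetric f z) c
  lagrangian : ∀ z ∈ U, ∀ v w : ℂ, kahlerForm f z v w = 0
  minimal : ∀ z ∈ U, lagMeanCurvature f z = 0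

/-- The coefficient `α = ⟨f_z, f_z⟩`. -/
def alpha (f : ℂ → Fin 4 → ℂ) (z : ℂ) : ℂ := bil (dz f z) (dz f z)

/-- The coefficient `β = ⟨f_z, f_z̄⟩`. -/
def beta (f : ℂ → Fin 4 → ℂ) (z : ℂ) : ℂ := bil (dz f z) (dzbar f z)

/-! ### Surfaces parametrized by a Riemann surface -/

section RiemannSurface

variable {M : Type*} [TopologicalSpace M] [ChartedSpace ℂ M]

/-- The conformal coordinates of the Riemann surface `M`. -/
def coords (M : Type*) [TopologicalSpace M] [ChartedSpace ℂ M] :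
    Set (OpenPartialHomeomorph M ℂ) :=
  IsManifold.maximalAtlas 𝓘(ℂ) ω M

/-- The part of the range of the coordinate `φ` that corresponds to `V ⊆ M`. -/
def dom (φ : OpenPartialHomeomorph M ℂ) (V : Set M) : Set ℂ := φ.target ∩ φ.symm ⁻¹' V

/-- On the open set `V ⊆ M`, `F` is a spacelike maximal surface in `ℍ³₁` (`M` carrying the
conformal structure of the induced metric) and `N` is a unit normal of it. -/
def IsMaximalSurface (V : Set M) (F N : M → Fin 4 → ℝ) : Prop :=
  ∀ φ ∈ coords M, IsMaximalCoord (dom φ V) (F ∘ φ.symm) (N ∘ φ.symm)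

/-- `f : M → Q₂*` is a conformal minimal Lagrangian immersion. -/
structure IsMinimalLagrangian (f : M → CP3) : Prop where
  mem : ∀ p, f p ∈ Q2star
  local_lift : ∀ φ ∈ coords M, ∀ z ∈ φ.target, ∃ U : Set ℂ, IsOpen U ∧ z ∈ U ∧ U ⊆ φ.target ∧
    ∃ h : ℂ → Fin 4 → ℂ, (∀ w ∈ U, IsClass (f (φ.symm w)) (h w)) ∧ IsMinLagCoord U h

/-- `𝔣` is a smooth horizontal lift of `f` on the open set `V ⊆ M`: it takes values in
`ℍ⁷₃ = {(z, z) = -1}`, and `⟨𝔣_z, 𝔣̄⟩ = ⟨𝔣_z̄, 𝔣̄⟩ = 0` in every conformal coordinate. -/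
structure IsHorizontalLift (V : Set M) (f : M → CP3) (𝔣 : M → Fin 4 → ℂ) : Prop where
  lift : ∀ p ∈ V, IsClass (f p) (𝔣 p)
  unit : ∀ p ∈ V, herm (𝔣 p) (𝔣 p) = -1
  smooth : ∀ φ ∈ coords M, ContDiffOn ℝ ∞ (𝔣 ∘ φ.symm) (dom φ V)
  horizontal : ∀ φ ∈ coords M, ∀ z ∈ dom φ V,
    herm (dz (𝔣 ∘ φ.symm) z) (𝔣 (φ.symm z)) = 0 ∧ herm (dzbar (𝔣 ∘ φ.symm) z) (𝔣 (φ.symm z)) = 0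

/-- The pair `(F, N)` on the open set `V ⊆ M` that comes from the horizontal lift `𝔣` of the
surface `f`. With `α = ⟨𝔣_z, 𝔣_z⟩`: `(F, N)` takes values in `T₁⁻ℍ³₁`, `𝔣 = (F + iN)/√2`,
`f = [F + iN]`, `F` is a spacelike maximal surface with unit normal `N`, `N` is a spacelike
maximal surface with unit normal `F` wherever `α ≠ 0`, and both Hopf differentials are
`iα dz²`. -/
structure IsCompanionPair (V : Set M) (f : M → CP3) (𝔣 : M → Fin 4 → ℂ) (F N : M → Fin 4 → ℝ) :
    Prop where
  mem_bundle : ∀ p ∈ V, (F p, N p) ∈ T1minus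
  lift_eq : ∀ p ∈ V, 𝔣 p = ((1 / Real.sqrt 2 : ℝ) : ℂ) • cvec (F p) (N p)
  proj : ∀ p ∈ V, IsClass (f p) (cvec (F p) (N p))
  maximal : IsMaximalSurface V F N
  maximal_normal : ∀ W : Set M, IsOpen W → W ⊆ V →
    (∀ φ ∈ coords M, ∀ z ∈ dom φ W, alpha (𝔣 ∘ φ.symm) z ≠ 0) → IsMaximalSurface W N F
  hopf_F : ∀ φ ∈ coords M, ∀ z ∈ dom φ V,
    hopf (F ∘ φ.symm) (N ∘ φ.symm) z = Complex.I * alpha (𝔣 ∘ φ.symm) z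
  hopf_N : ∀ φ ∈ coords M, ∀ z ∈ dom φ V,
    hopf (N ∘ φ.symm) (F ∘ φ.symm) z = Complex.I * alpha (𝔣 ∘ φ.symm) z

end RiemannSurface

end MaxLag

end

noncomputable section

namespace MaxLag

open Filter Topology Complex

/-! ### Algebra of the bilinear and Hermitian forms -/

section Algebra

variable {R : Type*} [CommRing R]

/-! Let `f` be a horizontal lift of a minimal Lagrangian surface, with derivatives `f₁`, `f_I` in
the two coordinate directions and conformal factor `c`. The Lagrangian condition makes `f`, its
conjugate, `f₁` and `f_I` a Hermitian-orthogonal basis of `ℂ⁴` (`horizontal_frame`). Hence the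
conjugates of `f₁`, `f_I` lie in the complex span of `f₁`, `f_I`, and the symmetric matrix `T` of
the values `⟨f_v, f_w⟩` is `c` times a unitary matrix (`tform_relations`).

The heart of the proof is that the unimodular function `angle = det T / c²` is locally constant
(`hasFDerivAt_angle`): minimality makes the trace of the connection matrix in the frame `f₁, f_I`
real, so that `det T` and `c²` have the same logarithmic derivative. A constant phase `m` multiplies
the angle by `m⁴`, so locally there is a lift of angle `1`. For a normalized lift no rotation is
needed: the identity `angle * conj β = β` forces angle `1` wherever `β ≠ 0`, and connectedness
spreads this over the domain (`IsHorizontalLift.angle_eq_one`).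

At angle `1` the matrix `T` has rows `(r + is, it)` and `(it, r - is)`, with `c² = r² + s² + t²`, `β
= r/2` and `α = (t + is)/2`. The real and imaginary parts of `f`, scaled by `√2`, are unit timelike
and normal to each other's derivatives. They induce the metrics `Re((·,·) ± ⟨·,·⟩)`, which are
conformal with factors `c ± 2β`, and their second fundamental forms are both `-Im T`. That `Im T`
has trace zero is maximality; its trace-free part gives the Hopf differentials; the relation among
`c, r, s, t` says `β² = (c/2)² - |α|²`. With `c = 2eᵘ` these are the stated formulas. Holomorphy of
`α` needs only that the Laplacian of `f` is bilinearly orthogonal to the tangent vectors.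

Conversely, for a maximal surface the shape operator is symmetric and trace-free. Symmetry makes `(F
+ iN)/√2` Lagrangian, trace-freeness makes it conformal, and the Codazzi equations make it harmonic.
A future-pointing normal selects the component `Q2star`, by an explicit path to the base point
(`mem_Q2star`). -/

lemma bil_comm (x y : Fin 4 → R) : bil x y = bil y x := by simp only [bil]; ring

lemma bil_add_left (x y w : Fin 4 → R) : bil (x + y) w = bil x w + bil y w := by
  simp only [bil, Pi.add_apply]; ring

lemma bil_add_right (x y w : Fin 4 → R) : bil w (x + y) = bil w x + bil w y := by
  simp only [bil, Pi.add_apply]; ring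

lemma bil_smul_left (c : R) (x w : Fin 4 → R) : bil (c • x) w = c * bil x w := by
  simp only [bil, Pi.smul_apply, smul_eq_mul]; ring

lemma bil_smul_right (c : R) (x w : Fin 4 → R) : bil w (c • x) = c * bil w x := by
  simp only [bil, Pi.smul_apply, smul_eq_mul]; ring

lemma bil_sub_left (x y w : Fin 4 → R) : bil (x - y) w = bil x w - bil y w := by
  simp only [bil, Pi.sub_apply]; ring

lemma bil_sub_right (x y w : Fin 4 → R) : bil w (x - y) = bil w x - bil w y := by
  simp only [bil, Pi.sub_apply]; ring

@[simp] lemma bil_zero_left (w : Fin 4 → R) : bil 0 w = 0 := by simp [bil]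

end Algebra

lemma bil_real_smul_left (r : ℝ) (x w : Fin 4 → ℂ) : bil (r • x) w = r * bil x w := by
  simp only [bil, Pi.smul_apply, real_smul]; ring

lemma bil_real_smul_right (r : ℝ) (x w : Fin 4 → ℂ) : bil w (r • x) = r * bil w x := by
  simp only [bil, Pi.smul_apply, real_smul]; ring

@[simp] lemma conj4_conj4 (z : Fin 4 → ℂ) : conj4 (conj4 z) = z := by
  ext i; simp [conj4]

lemma conj4_add (z w : Fin 4 → ℂ) : conj4 (z + w) = conj4 z + conj4 w := by
  ext i; simp [conj4]

lemma conj4_smul (c : ℂ) (z : Fin 4 → ℂ) : conj4 (c • z) = (starRingEnd ℂ) c • conj4 z := by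
  ext i; simp [conj4]

lemma conj4_real_smul (c : ℝ) (z : Fin 4 → ℂ) : conj4 (c • z) = c • conj4 z := by
  ext i; simp [conj4]

lemma bil_conj4 (z w : Fin 4 → ℂ) : bil (conj4 z) (conj4 w) = (starRingEnd ℂ) (bil z w) := by
  simp [bil, conj4]

lemma herm_conj_symm (z w : Fin 4 → ℂ) : herm z w = (starRingEnd ℂ) (herm w z) := by
  simp only [herm, bil, conj4, map_add, map_sub, map_neg, map_mul, Complex.conj_conj]; ring

lemma herm_conj4_right (z w : Fin 4 → ℂ) : herm z (conj4 w) = bil z w := by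
  simp [herm]

lemma herm_conj4_left (z w : Fin 4 → ℂ) : herm (conj4 z) w = (starRingEnd ℂ) (bil z w) := by
  rw [herm, bil_conj4]

lemma herm_add_left (x y w : Fin 4 → ℂ) : herm (x + y) w = herm x w + herm y w :=
  bil_add_left _ _ _

lemma herm_sub_left (x y w : Fin 4 → ℂ) : herm (x - y) w = herm x w - herm y w :=
  bil_sub_left _ _ _

lemma herm_smul_left (c : ℂ) (x w : Fin 4 → ℂ) : herm (c • x) w = c * herm x w :=
  bil_smul_left _ _ _

lemma herm_real_smul_left (c : ℝ) (x w : Fin 4 → ℂ) : herm (c • x) w = c * herm x w :=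
  bil_real_smul_left _ _ _

lemma herm_add_right (x y w : Fin 4 → ℂ) : herm w (x + y) = herm w x + herm w y := by
  rw [herm, conj4_add, bil_add_right]; rfl

lemma herm_smul_right (c : ℂ) (x w : Fin 4 → ℂ) :
    herm w (c • x) = (starRingEnd ℂ) c * herm w x := by
  rw [herm, conj4_smul, bil_smul_right]; rfl

lemma herm_real_smul_right (c : ℝ) (x w : Fin 4 → ℂ) : herm w (c • x) = c * herm w x := by
  rw [herm, conj4_real_smul, bil_real_smul_right]; rfl

@[simp] lemma herm_zero_left (w : Fin 4 → ℂ) : herm 0 w = 0 := bil_zero_left _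

lemma bil_toC (x y : Fin 4 → ℝ) : bil (toC x) (toC y) = ((bil x y : ℝ) : ℂ) := by
  simp [bil, toC]

/-- Expansion of a vector in a basis with a dual family for the bilinear form. -/
lemma eq_sum_of_bil {K : Type*} [Field K] (e e' : Fin 4 → Fin 4 → K) (c : Fin 4 → K)
    (hc : ∀ i, c i ≠ 0) (hii : ∀ i, bil (e i) (e' i) = c i)
    (hij : ∀ i j, i ≠ j → bil (e i) (e' j) = 0) (w : Fin 4 → K) :
    w = ∑ i, (bil w (e' i) / c i) • e i := by
  -- Pairing with `e' j` reads off the coefficient of `e j`. This gives linear independence, hence a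
  -- basis by dimension, and then the formula for the coefficients.
  have key : ∀ (g : Fin 4 → K) (j : Fin 4), bil (∑ i, g i • e i) (e' j) = g j * c j := by
    intro g j
    simp only [Fin.sum_univ_four, bil_add_left, bil_smul_left]
    fin_cases j <;> simp [hii, hij]
  have li : LinearIndependent K e := by
    rw [Fintype.linearIndependent_iff]
    intro g hg j
    have := key g j
    rw [hg, bil_zero_left] at this
    simpa [hc j] using this.symm
  have hsp := li.span_eq_top_of_card_eq_finrank (by simp)
  have hw : w ∈ Submodule.span K (Set.range e) := by rw [hsp]; trivial
  obtain ⟨g, hg⟩ := (Submodule.mem_span_range_iff_exists_fun K).1 hw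
  conv_lhs => rw [← hg]
  refine Finset.sum_congr rfl fun i _ => ?_
  rw [← hg, key, mul_div_cancel_right₀ _ (hc i)]

/-! ### Differentiation of the two forms and symmetry of second derivatives -/

section Calculus

lemma HasFDerivAt.bil {R : Type*} [NormedCommRing R] [NormedAlgebra ℝ R]
    {A B : ℂ → Fin 4 → R} {A' B' : ℂ →L[ℝ] Fin 4 → R} {z : ℂ}
    (hA : HasFDerivAt A A' z) (hB : HasFDerivAt B B' z) :
    ∃ L : ℂ →L[ℝ] R, HasFDerivAt (fun ζ => MaxLag.bil (A ζ) (B ζ)) L z ∧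
      ∀ v, L v = MaxLag.bil (A' v) (B z) + MaxLag.bil (A z) (B' v) := by
  have a := fun i => hasFDerivAt_pi'.1 hA i
  have b := fun i => hasFDerivAt_pi'.1 hB i
  refine ⟨_, ((((a 0).mul (b 0)).neg.sub ((a 1).mul (b 1))).add ((a 2).mul (b 2))).add
    ((a 3).mul (b 3)), fun v => ?_⟩
  simp [MaxLag.bil]
  ring

lemma differentiableAt_bil {R : Type*} [NormedCommRing R] [NormedAlgebra ℝ R]
    {A B : ℂ → Fin 4 → R} {z : ℂ}
    (hA : DifferentiableAt ℝ A z) (hB : DifferentiableAt ℝ B z) :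
    DifferentiableAt ℝ (fun ζ => bil (A ζ) (B ζ)) z := by
  obtain ⟨L, hL, -⟩ := HasFDerivAt.bil hA.hasFDerivAt hB.hasFDerivAt
  exact hL.differentiableAt

lemma fderiv_bil {R : Type*} [NormedCommRing R] [NormedAlgebra ℝ R]
    {A B : ℂ → Fin 4 → R} {z : ℂ}
    (hA : DifferentiableAt ℝ A z) (hB : DifferentiableAt ℝ B z) (v : ℂ) :
    fderiv ℝ (fun ζ => bil (A ζ) (B ζ)) z v =
      bil (fderiv ℝ A z v) (B z) + bil (A z) (fderiv ℝ B z v) := by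
  obtain ⟨L, hL, h⟩ := HasFDerivAt.bil hA.hasFDerivAt hB.hasFDerivAt
  rw [hL.fderiv, h]

lemma ContDiffAt.bil {R : Type*} [NormedCommRing R] [NormedAlgebra ℝ R]
    {A B : ℂ → Fin 4 → R} {z : ℂ} {n : ℕ∞ω}
    (hA : ContDiffAt ℝ n A z) (hB : ContDiffAt ℝ n B z) :
    ContDiffAt ℝ n (fun ζ => MaxLag.bil (A ζ) (B ζ)) z := by
  have a := fun i => contDiffAt_pi.1 hA i
  have b := fun i => contDiffAt_pi.1 hB i
  exact ((((a 0).mul (b 0)).neg.sub ((a 1).mul (b 1))).add ((a 2).mul (b 2))).add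
    ((a 3).mul (b 3))

lemma bil_fderiv_of_eventually_const {R : Type*} [NormedCommRing R] [NormedAlgebra ℝ R]
    {A B : ℂ → Fin 4 → R} {z : ℂ} {k : R}
    (hA : DifferentiableAt ℝ A z) (hB : DifferentiableAt ℝ B z)
    (h : ∀ᶠ ζ in 𝓝 z, bil (A ζ) (B ζ) = k) (v : ℂ) :
    bil (fderiv ℝ A z v) (B z) + bil (A z) (fderiv ℝ B z v) = 0 := by
  rw [← fderiv_bil hA hB, EventuallyEq.fderiv_eq (show _ =ᶠ[𝓝 z] fun _ => k from h)]
  simp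

/-- `conj4` as a real-linear map. -/
def conjL : (Fin 4 → ℂ) →L[ℝ] (Fin 4 → ℂ) :=
  ContinuousLinearMap.pi fun i => conjCLE.toContinuousLinearMap.comp (.proj i)

@[simp] lemma conjL_apply (w : Fin 4 → ℂ) : conjL w = conj4 w := by ext i; simp [conjL, conj4]

/-- `toC` as a real-linear map. -/
def toCL : (Fin 4 → ℝ) →L[ℝ] (Fin 4 → ℂ) :=
  ContinuousLinearMap.pi fun i => ofRealCLM.comp (.proj i)

@[simp] lemma toCL_apply (w : Fin 4 → ℝ) : toCL w = toC w := by ext i; simp [toCL, toC]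

/-- The coordinatewise real part. -/
def reL : (Fin 4 → ℂ) →L[ℝ] (Fin 4 → ℝ) :=
  ContinuousLinearMap.pi fun i => reCLM.comp (.proj i)

/-- The coordinatewise imaginary part. -/
def imL : (Fin 4 → ℂ) →L[ℝ] (Fin 4 → ℝ) :=
  ContinuousLinearMap.pi fun i => imCLM.comp (.proj i)

@[simp] lemma reL_apply (w : Fin 4 → ℂ) (i : Fin 4) : reL w i = (w i).re := rfl

@[simp] lemma imL_apply (w : Fin 4 → ℂ) (i : Fin 4) : imL w i = (w i).im := rfl

lemma fderiv_clm_comp {E G : Type*} [NormedAddCommGroup E] [NormedSpace ℝ E]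
    [NormedAddCommGroup G] [NormedSpace ℝ G] (L : E →L[ℝ] G) {f : ℂ → E} {z : ℂ}
    (hf : DifferentiableAt ℝ f z) (v : ℂ) :
    fderiv ℝ (fun ζ => L (f ζ)) z v = L (fderiv ℝ f z v) := by
  have h : fderiv ℝ (fun ζ => L (f ζ)) z = L.comp (fderiv ℝ f z) :=
    (L.hasFDerivAt.comp z hf.hasFDerivAt).fderiv
  rw [h]; rfl

lemma differentiableAt_conj4 {B : ℂ → Fin 4 → ℂ} {z : ℂ} (hB : DifferentiableAt ℝ B z) :
    DifferentiableAt ℝ (fun ζ => conj4 (B ζ)) z := by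
  simpa using conjL.differentiableAt.comp z hB

lemma fderiv_conj4 {B : ℂ → Fin 4 → ℂ} {z : ℂ} (hB : DifferentiableAt ℝ B z) (v : ℂ) :
    fderiv ℝ (fun ζ => conj4 (B ζ)) z v = conj4 (fderiv ℝ B z v) := by
  simpa using fderiv_clm_comp conjL hB v

lemma differentiableAt_herm {A B : ℂ → Fin 4 → ℂ} {z : ℂ}
    (hA : DifferentiableAt ℝ A z) (hB : DifferentiableAt ℝ B z) :
    DifferentiableAt ℝ (fun ζ => herm (A ζ) (B ζ)) z :=
  differentiableAt_bil hA (differentiableAt_conj4 hB)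

lemma fderiv_herm {A B : ℂ → Fin 4 → ℂ} {z : ℂ}
    (hA : DifferentiableAt ℝ A z) (hB : DifferentiableAt ℝ B z) (v : ℂ) :
    fderiv ℝ (fun ζ => herm (A ζ) (B ζ)) z v =
      herm (fderiv ℝ A z v) (B z) + herm (A z) (fderiv ℝ B z v) := by
  have := fderiv_bil hA (differentiableAt_conj4 hB) v
  rwa [fderiv_conj4 hB] at this

lemma ContDiffAt.herm {A B : ℂ → Fin 4 → ℂ} {z : ℂ} {n : ℕ∞ω}
    (hA : ContDiffAt ℝ n A z) (hB : ContDiffAt ℝ n B z) :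
    ContDiffAt ℝ n (fun ζ => MaxLag.herm (A ζ) (B ζ)) z := by
  have h : ContDiffAt ℝ n (fun ζ => conjL (B ζ)) z := conjL.contDiff.contDiffAt.comp z hB
  simp only [conjL_apply] at h
  exact ContDiffAt.bil hA h

lemma herm_fderiv_of_eventually_const {A B : ℂ → Fin 4 → ℂ} {z k : ℂ}
    (hA : DifferentiableAt ℝ A z) (hB : DifferentiableAt ℝ B z)
    (h : ∀ᶠ ζ in 𝓝 z, herm (A ζ) (B ζ) = k) (v : ℂ) :
    herm (fderiv ℝ A z v) (B z) + herm (A z) (fderiv ℝ B z v) = 0 := by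
  rw [← fderiv_herm hA hB, EventuallyEq.fderiv_eq (show _ =ᶠ[𝓝 z] fun _ => k from h)]
  simp

/-- The iterated derivative `∂_v ∂_w f`. -/
def d2 {E : Type*} [NormedAddCommGroup E] [NormedSpace ℝ E] (f : ℂ → E) (z v w : ℂ) : E :=
  fderiv ℝ (fun ζ => fderiv ℝ f ζ w) z v

variable {E : Type*} [NormedAddCommGroup E] [NormedSpace ℝ E] {f : ℂ → E} {z : ℂ}

lemma contDiffAt_fderiv_apply (hf : ContDiffAt ℝ ∞ f z) (w : ℂ) :
    ContDiffAt ℝ ∞ (fun ζ => fderiv ℝ f ζ w) z :=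
  (hf.fderiv_right (m := ∞) (by simp)).clm_apply contDiffAt_const

lemma differentiableAt_fderiv_apply (hf : ContDiffAt ℝ ∞ f z) (w : ℂ) :
    DifferentiableAt ℝ (fun ζ => fderiv ℝ f ζ w) z :=
  (contDiffAt_fderiv_apply hf w).differentiableAt (by simp)

lemma d2_symm (hf : ContDiffAt ℝ ∞ f z) (v w : ℂ) : d2 f z v w = d2 f z w v := by
  have h1 : DifferentiableAt ℝ (fderiv ℝ f) z :=
    (hf.fderiv_right (m := ∞) (by simp)).differentiableAt (by simp)
  have h2 : IsSymmSndFDerivAt ℝ f z := hf.isSymmSndFDerivAt (by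
    simp only [minSmoothness_of_isRCLikeNormedField]
    exact WithTop.coe_le_coe.2 (le_top : (2 : ℕ∞) ≤ ⊤))
  have key : ∀ v w : ℂ, d2 f z v w = fderiv ℝ (fderiv ℝ f) z v w := fun v w => by
    rw [d2, fderiv_clm_apply h1 (differentiableAt_const w)]
    simp
  rw [key, key, h2.eq]

lemma fderiv_eq_re_im (L : ℂ →L[ℝ] E) (v : ℂ) : L v = v.re • L 1 + v.im • L I := by
  rw [← map_smul, ← map_smul, ← map_add]
  congr 1
  apply Complex.ext <;> simp

end Calculus

/-! ### Horizontal lifts: the unitary matrix `T`, the constant angle, holomorphy of `α` -/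

/-- The equations of a horizontal lift of a conformal minimal Lagrangian immersion. -/
structure IsHorizontalMinLag (U : Set ℂ) (f : ℂ → Fin 4 → ℂ) : Prop where
  smooth : ∀ z ∈ U, ContDiffAt ℝ ∞ f z
  unit : ∀ z ∈ U, herm (f z) (f z) = -1
  null : ∀ z ∈ U, bil (f z) (f z) = 0
  horizontal : ∀ z ∈ U, ∀ v, herm (fderiv ℝ f z v) (f z) = 0
  conformal : ∀ z ∈ U, ∃ c : ℝ, 0 < c ∧ ∀ v w,
    herm (fderiv ℝ f z v) (fderiv ℝ f z w) = ((c * (v * (starRingEnd ℂ) w).re : ℝ) : ℂ)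
  harmonic : ∀ z ∈ U, ∀ v, herm (d2 f z 1 1 + d2 f z I I) (fderiv ℝ f z v) = 0

/-- The complex bilinear form evaluated on two derivatives of `f`. -/
def tform (f : ℂ → Fin 4 → ℂ) (z v w : ℂ) : ℂ := bil (fderiv ℝ f z v) (fderiv ℝ f z w)

/-- The determinant of `tform`, relative to the induced metric. -/
def angle (f : ℂ → Fin 4 → ℂ) (z : ℂ) : ℂ :=
  (tform f z 1 1 * tform f z I I - tform f z 1 I ^ 2) /
    herm (fderiv ℝ f z 1) (fderiv ℝ f z 1) ^ 2

lemma alpha_eq_tform (f : ℂ → Fin 4 → ℂ) (z : ℂ) :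
    alpha f z = (tform f z 1 1 - tform f z I I - 2 * I * tform f z 1 I) / 4 := by
  simp only [alpha, dz, tform, bil_smul_left, bil_smul_right, bil_sub_left, bil_sub_right]
  rw [bil_comm (fderiv ℝ f z I) (fderiv ℝ f z 1)]
  linear_combination (bil (fderiv ℝ f z I) (fderiv ℝ f z I)) / 4 * I_sq

lemma beta_eq_tform (f : ℂ → Fin 4 → ℂ) (z : ℂ) :
    beta f z = (tform f z 1 1 + tform f z I I) / 4 := by
  simp only [beta, dz, dzbar, tform, bil_smul_left, bil_smul_right, bil_sub_left, bil_add_right]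
  rw [bil_comm (fderiv ℝ f z I) (fderiv ℝ f z 1)]
  linear_combination -(bil (fderiv ℝ f z I) (fderiv ℝ f z I)) / 4 * I_sq

lemma bil_fderiv_self_of_null {f : ℂ → Fin 4 → ℂ} {z : ℂ} (hf : DifferentiableAt ℝ f z)
    {k : ℂ} (h : ∀ᶠ ζ in 𝓝 z, bil (f ζ) (f ζ) = k) (v : ℂ) : bil (fderiv ℝ f z v) (f z) = 0 := by
  have := bil_fderiv_of_eventually_const hf hf h v
  rw [bil_comm (f z)] at this
  linear_combination this / 2

/-- Expansion in the frame formed by a horizontal lift, its conjugate and its derivatives. -/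
lemma horizontal_frame {p X Y W : Fin 4 → ℂ} {c : ℝ} (hc : c ≠ 0)
    (hpp : herm p p = -1) (hp : bil p p = 0)
    (hXp : herm X p = 0) (hYp : herm Y p = 0) (hXp' : bil X p = 0) (hYp' : bil Y p = 0)
    (hXX : herm X X = c) (hYY : herm Y Y = c) (hXY : herm X Y = 0)
    (hWp : herm W p = 0) (hWp' : bil W p = 0) :
    W = (herm W X / c) • X + (herm W Y / c) • Y := by
  have hYX : herm Y X = 0 := by rw [herm_conj_symm, hXY, map_zero]
  have hpX : herm p X = 0 := by rw [herm_conj_symm, hXp, map_zero]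
  have hpY : herm p Y = 0 := by rw [herm_conj_symm, hYp, map_zero]
  -- Orthogonality is Hermitian, so the dual family for the bilinear form consists of the
  -- conjugates; this exchanges `p` and `conj4 p`.
  have h := eq_sum_of_bil ![p, conj4 p, X, Y] ![conj4 p, p, conj4 X, conj4 Y]
    ![-1, -1, (c : ℂ), c] ?_ ?_ ?_ W
  · simp only [Fin.sum_univ_four, Matrix.cons_val_zero, Matrix.cons_val_one, Matrix.cons_val] at h
    change W = (herm W p / -1) • p + (bil W p / -1) • conj4 p + (herm W X / c) • X +
      (herm W Y / c) • Y at h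
    rw [hWp, hWp'] at h
    simpa using h
  · intro i; fin_cases i <;> simp [hc]
  · intro i
    fin_cases i
    · exact hpp
    · exact (bil_comm _ _).trans hpp
    · exact hXX
    · exact hYY
  · have e1 : bil p X = 0 := (bil_comm _ _).trans hXp'
    have e2 : bil p Y = 0 := (bil_comm _ _).trans hYp'
    have e3 : bil (conj4 p) (conj4 p) = 0 := by rw [bil_conj4, hp, map_zero]
    have e4 : bil (conj4 p) (conj4 X) = 0 := by rw [bil_conj4, e1, map_zero]
    have e5 : bil (conj4 p) (conj4 Y) = 0 := by rw [bil_conj4, e2, map_zero]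
    change bil _ (conj4 _) = _ at hXp hYp hpX hpY hXY hYX
    intro i j hij
    fin_cases i <;> fin_cases j <;> first | exact absurd rfl hij | assumption

/-- Real and imaginary parts of a symmetric unitary matrix, up to scale. -/
lemma symm_unitary_solve {a b d c : ℂ} (hc : c ≠ 0)
    (h1 : a * (starRingEnd ℂ) a + b * (starRingEnd ℂ) b = c ^ 2)
    (h2 : b * (starRingEnd ℂ) a + d * (starRingEnd ℂ) b = 0) :
    d = (a * d - b ^ 2) / c ^ 2 * (starRingEnd ℂ) a ∧
      b = -((a * d - b ^ 2) / c ^ 2 * (starRingEnd ℂ) b) := by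
  -- The inverse of the matrix with rows `(a, b)`, `(b, d)` is both its conjugate transpose over
  -- `c²` and its adjugate over the determinant; the two claims compare entries.
  constructor
  · field_simp
    linear_combination (-d) * h1 + b * h2
  · field_simp
    linear_combination (-b) * h1 + a * h2

namespace IsHorizontalMinLag

variable {U : Set ℂ} {f : ℂ → Fin 4 → ℂ} {z : ℂ}

lemma differentiableAt (h : IsHorizontalMinLag U f) (hz : z ∈ U) : DifferentiableAt ℝ f z :=
  (h.smooth z hz).differentiableAt (by simp)

lemma bil_fderiv_self (h : IsHorizontalMinLag U f) (hU : IsOpen U) (hz : z ∈ U) (v : ℂ) :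
    bil (fderiv ℝ f z v) (f z) = 0 :=
  bil_fderiv_self_of_null (h.differentiableAt hz)
    (Filter.mem_of_superset (hU.mem_nhds hz) h.null) v

/-- The scale factor of the induced metric. -/
lemma exists_scale (h : IsHorizontalMinLag U f) (hz : z ∈ U) : ∃ c : ℝ, 0 < c ∧
    herm (fderiv ℝ f z 1) (fderiv ℝ f z 1) = c ∧ herm (fderiv ℝ f z I) (fderiv ℝ f z I) = c ∧
    herm (fderiv ℝ f z 1) (fderiv ℝ f z I) = 0 ∧ herm (fderiv ℝ f z I) (fderiv ℝ f z 1) = 0 := by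
  obtain ⟨c, hc, H⟩ := h.conformal z hz
  exact ⟨c, hc, by simp [H], by simp [H], by simp [H], by simp [H]⟩

lemma frame (h : IsHorizontalMinLag U f) (hU : IsOpen U) (hz : z ∈ U) {W : Fin 4 → ℂ}
    (hWp : herm W (f z) = 0) (hWp' : bil W (f z) = 0) :
    W = (herm W (fderiv ℝ f z 1) / herm (fderiv ℝ f z 1) (fderiv ℝ f z 1)) • fderiv ℝ f z 1 +
      (herm W (fderiv ℝ f z I) / herm (fderiv ℝ f z 1) (fderiv ℝ f z 1)) • fderiv ℝ f z I := by
  obtain ⟨c, hc, h1, h2, h3, -⟩ := h.exists_scale hz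
  rw [h1]
  exact horizontal_frame hc.ne' (h.unit z hz) (h.null z hz) (h.horizontal z hz _)
    (h.horizontal z hz _) (h.bil_fderiv_self hU hz _) (h.bil_fderiv_self hU hz _) h1 h2 h3 hWp hWp'

/-- The bilinear form is the Hermitian form against a conjugate, and the conjugate of a tangent
vector is orthogonal to `f` and its conjugate. Expanding it in the tangent frame, with coefficients
the conjugates of the entries of `T` over `c`, turns every bilinear product with a tangent vector
into Hermitian ones. -/
lemma bil_fderiv (h : IsHorizontalMinLag U f) (hU : IsOpen U) (hz : z ∈ U) (W : Fin 4 → ℂ)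
    (v : ℂ) :
    bil W (fderiv ℝ f z v) = (tform f z v 1 * herm W (fderiv ℝ f z 1) +
      tform f z v I * herm W (fderiv ℝ f z I)) / herm (fderiv ℝ f z 1) (fderiv ℝ f z 1) := by
  obtain ⟨c, hc, h1, -⟩ := h.exists_scale hz
  have key := h.frame hU hz (W := conj4 (fderiv ℝ f z v))
    (by rw [herm_conj4_left, h.bil_fderiv_self hU hz, map_zero])
    (by rw [bil_comm]; change herm _ _ = 0; rw [herm_conj_symm, h.horizontal z hz, map_zero])
  rw [herm_conj4_left, herm_conj4_left, h1] at key
  rw [← herm_conj4_right, key, herm_add_right, herm_smul_right, herm_smul_right, h1]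
  simp only [map_div₀, Complex.conj_conj, conj_ofReal, tform]
  ring

/-- `T / c` is the change of basis between the tangent frame and its conjugate. Both frames are
Hermitian-orthogonal with squared length `c`, so this matrix is unitary. -/
lemma tform_relations (h : IsHorizontalMinLag U f) (hU : IsOpen U) (hz : z ∈ U) :
    tform f z 1 1 * (starRingEnd ℂ) (tform f z 1 1) +
      tform f z 1 I * (starRingEnd ℂ) (tform f z 1 I) =
        herm (fderiv ℝ f z 1) (fderiv ℝ f z 1) ^ 2 ∧
    tform f z 1 I * (starRingEnd ℂ) (tform f z 1 1) +
      tform f z I I * (starRingEnd ℂ) (tform f z 1 I) = 0 ∧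
    tform f z 1 I * (starRingEnd ℂ) (tform f z 1 I) +
      tform f z I I * (starRingEnd ℂ) (tform f z I I) =
        herm (fderiv ℝ f z 1) (fderiv ℝ f z 1) ^ 2 := by
  obtain ⟨c, hc, h1, h2, h3, h4⟩ := h.exists_scale hz
  have hc' : (c : ℂ) ≠ 0 := by exact_mod_cast hc.ne'
  have key := fun v w => h.bil_fderiv hU hz (conj4 (fderiv ℝ f z v)) w
  simp only [herm_conj4_left, bil_comm (conj4 _)] at key
  change ∀ v w : ℂ, herm (fderiv ℝ f z w) (fderiv ℝ f z v) = (tform f z w 1 *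
    (starRingEnd ℂ) (tform f z v 1) + tform f z w I * (starRingEnd ℂ) (tform f z v I)) / _ at key
  have hs : tform f z I 1 = tform f z 1 I := bil_comm _ _
  have k1 := key 1 1
  have k2 := key 1 I
  have k3 := key I I
  rw [h1] at k1 k2 k3 ⊢
  rw [h4] at k2
  rw [h2] at k3
  rw [hs] at k2 k3
  field_simp at k1 k2 k3
  refine ⟨k1.symm, ?_, k3.symm⟩
  linear_combination -k2

lemma scale_ne_zero (h : IsHorizontalMinLag U f) (hz : z ∈ U) :
    herm (fderiv ℝ f z 1) (fderiv ℝ f z 1) ≠ 0 := by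
  obtain ⟨c, hc, h1, -⟩ := h.exists_scale hz
  rw [h1]
  exact_mod_cast hc.ne'

lemma tform_eq_angle (h : IsHorizontalMinLag U f) (hU : IsOpen U) (hz : z ∈ U) :
    tform f z I I = angle f z * (starRingEnd ℂ) (tform f z 1 1) ∧
      tform f z 1 I = -(angle f z * (starRingEnd ℂ) (tform f z 1 I)) := by
  obtain ⟨h1, h2, -⟩ := h.tform_relations hU hz
  exact symm_unitary_solve (h.scale_ne_zero hz) h1 h2

lemma angle_mul_conj (h : IsHorizontalMinLag U f) (hU : IsOpen U) (hz : z ∈ U) :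
    angle f z * (starRingEnd ℂ) (angle f z) = 1 := by
  obtain ⟨c, hc, h0, -⟩ := h.exists_scale hz
  obtain ⟨h1, h2, h3⟩ := h.tform_relations hU hz
  have hc' : (c : ℂ) ≠ 0 := by exact_mod_cast hc.ne'
  rw [angle]
  rw [h0] at h1 h3 ⊢
  have h2' := congrArg (starRingEnd ℂ) h2
  simp only [map_add, map_mul, Complex.conj_conj, map_zero] at h2'
  simp only [map_div₀, map_pow, conj_ofReal, map_sub, map_mul]
  field_simp
  linear_combination (tform f z 1 I * (starRingEnd ℂ) (tform f z 1 I) +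
      tform f z I I * (starRingEnd ℂ) (tform f z I I)) * h1 + c ^ 2 * h3 -
      ((starRingEnd ℂ) (tform f z 1 I) * tform f z 1 1 +
        (starRingEnd ℂ) (tform f z I I) * tform f z 1 I) * h2

lemma differentiableAt_tform (h : IsHorizontalMinLag U f) (hz : z ∈ U) (v w : ℂ) :
    DifferentiableAt ℝ (fun ζ => tform f ζ v w) z :=
  differentiableAt_bil (differentiableAt_fderiv_apply (h.smooth z hz) v)
    (differentiableAt_fderiv_apply (h.smooth z hz) w)

lemma fderiv_tform (h : IsHorizontalMinLag U f) (hz : z ∈ U) (u v w : ℂ) :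
    fderiv ℝ (fun ζ => tform f ζ v w) z u =
      bil (d2 f z u v) (fderiv ℝ f z w) + bil (d2 f z u w) (fderiv ℝ f z v) := by
  rw [bil_comm (d2 f z u w)]
  exact fderiv_bil (differentiableAt_fderiv_apply (h.smooth z hz) v)
    (differentiableAt_fderiv_apply (h.smooth z hz) w) u

/-- The Codazzi-type symmetries of the second derivatives. -/
lemma second_derivatives (h : IsHorizontalMinLag U f) (hU : IsOpen U) (hz : z ∈ U) :
    herm (d2 f z 1 I) (fderiv ℝ f z I) =
      (starRingEnd ℂ) (herm (d2 f z 1 1) (fderiv ℝ f z 1)) ∧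
    herm (d2 f z I I) (fderiv ℝ f z I) =
      (starRingEnd ℂ) (herm (d2 f z I 1) (fderiv ℝ f z 1)) := by
  have hs := d2_symm (h.smooth z hz) 1 I
  have hd := differentiableAt_fderiv_apply (h.smooth z hz)
  -- Differentiating the orthogonality of the two tangent vectors in direction `I`, and below in
  -- direction `1`, trades one entry of the second derivatives for another; harmonicity then
  -- exchanges `d2 f z I I` with `-d2 f z 1 1`.
  have e1 := herm_fderiv_of_eventually_const (hd I) (hd 1) (k := 0)
    (Filter.mem_of_superset (hU.mem_nhds hz) fun ζ hζ => (h.exists_scale hζ).choose_spec.2.2.2.2) I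
  have e2 := herm_fderiv_of_eventually_const (hd 1) (hd I) (k := 0)
    (Filter.mem_of_superset (hU.mem_nhds hz) fun ζ hζ => (h.exists_scale hζ).choose_spec.2.2.2.1) 1
  change herm (d2 f z I I) _ + herm _ (d2 f z I 1) = 0 at e1
  change herm (d2 f z 1 1) _ + herm _ (d2 f z 1 I) = 0 at e2
  have k1 := h.harmonic z hz 1
  have k2 := h.harmonic z hz I
  rw [herm_add_left] at k1 k2
  constructor
  · rw [hs, herm_conj_symm]
    congr 1
    linear_combination e1 - k1
  · rw [← hs, ← herm_conj_symm]
    linear_combination k2 - e2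

/-- Since `dT = A T + T Aᵀ` with `A` the connection matrix, the logarithmic derivative of `det T` is
twice the trace of `A`. By `second_derivatives` the two diagonal entries of `A` are conjugate, so
this is four times the real part of one of them, which is the logarithmic derivative of `c²`. -/
lemma hasFDerivAt_angle (h : IsHorizontalMinLag U f) (hU : IsOpen U) (hz : z ∈ U) :
    HasFDerivAt (angle f) (0 : ℂ →L[ℝ] ℂ) z := by
  obtain ⟨s1, s2⟩ := h.second_derivatives hU hz
  have hc := h.scale_ne_zero hz
  have hd := differentiableAt_fderiv_apply (h.smooth z hz)
  have da := h.differentiableAt_tform hz 1 1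
  have db := h.differentiableAt_tform hz 1 I
  have dd := h.differentiableAt_tform hz I I
  have dc : DifferentiableAt ℝ (fun ζ => herm (fderiv ℝ f ζ 1) (fderiv ℝ f ζ 1)) z :=
    differentiableAt_herm (hd 1) (hd 1)
  have hs : tform f z I 1 = tform f z 1 I := bil_comm _ _
  have kc := fun u => fderiv_herm (hd 1) (hd 1) u
  have key : ∀ u : ℂ, herm (d2 f z u I) (fderiv ℝ f z I) =
      (starRingEnd ℂ) (herm (d2 f z u 1) (fderiv ℝ f z 1)) →
      fderiv ℝ (fun ζ => tform f ζ 1 1 * tform f ζ I I - tform f ζ 1 I * tform f ζ 1 I) z u =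
      2 * fderiv ℝ (fun ζ => herm (fderiv ℝ f ζ 1) (fderiv ℝ f ζ 1)) z u *
        (tform f z 1 1 * tform f z I I - tform f z 1 I * tform f z 1 I) /
          herm (fderiv ℝ f z 1) (fderiv ℝ f z 1) := by
    intro u hu
    rw [((da.hasFDerivAt.fun_mul dd.hasFDerivAt).fun_sub (db.hasFDerivAt.fun_mul db.hasFDerivAt)).fderiv]
    simp only [sub_apply, add_apply,
      smul_apply, smul_eq_mul, h.fderiv_tform hz, h.bil_fderiv hU hz, kc]
    change _ = 2 * (herm (d2 f z u 1) _ + herm _ (d2 f z u 1)) * _ / _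
    rw [herm_conj_symm (fderiv ℝ f z 1) (d2 f z u 1), ← hu, hs]
    field_simp
    ring
  have dn := (da.fun_mul dd).fun_sub (db.fun_mul db)
  have heq : ∀ ζ ∈ U, tform f ζ 1 1 * tform f ζ I I - tform f ζ 1 I * tform f ζ 1 I =
      angle f ζ * (herm (fderiv ℝ f ζ 1) (fderiv ℝ f ζ 1) *
        herm (fderiv ℝ f ζ 1) (fderiv ℝ f ζ 1)) := by
    intro ζ hζ
    have := h.scale_ne_zero hζ
    rw [angle]
    field_simp
  have dq : DifferentiableAt ℝ (angle f) z := by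
    refine (dn.fun_mul ((dc.fun_mul dc).fun_inv (mul_ne_zero hc hc))).congr_of_eventuallyEq ?_
    refine Filter.Eventually.of_forall fun ζ => ?_
    simp only [angle]
    ring
  have hn : HasFDerivAt (fun ζ => tform f ζ 1 1 * tform f ζ I I - tform f ζ 1 I * tform f ζ 1 I)
      _ z := (dq.hasFDerivAt.fun_mul (dc.hasFDerivAt.fun_mul dc.hasFDerivAt)).congr_of_eventuallyEq
    (Filter.mem_of_superset (hU.mem_nhds hz) heq)
  have key2 : ∀ u : ℂ, herm (d2 f z u I) (fderiv ℝ f z I) =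
      (starRingEnd ℂ) (herm (d2 f z u 1) (fderiv ℝ f z 1)) → fderiv ℝ (angle f) z u = 0 := by
    intro u hu
    have k := key u hu
    rw [hn.fderiv, heq z hz] at k
    simp only [add_apply, smul_apply, smul_eq_mul] at k
    field_simp at k
    have : herm (fderiv ℝ f z 1) (fderiv ℝ f z 1) * fderiv ℝ (angle f) z u = 0 := by
      linear_combination k
    exact (mul_eq_zero.1 this).resolve_left hc
  convert dq.hasFDerivAt using 1
  ext u
  rw [fderiv_eq_re_im (fderiv ℝ (angle f) z) u, key2 1 s1, key2 I s2]
  simp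

end IsHorizontalMinLag

namespace IsHorizontalMinLag

variable {U : Set ℂ} {f : ℂ → Fin 4 → ℂ} {z : ℂ}

/-- By `bil_fderiv` a vector Hermitian-orthogonal to both tangent vectors is also bilinearly
orthogonal to them. -/
lemma bil_laplacian (h : IsHorizontalMinLag U f) (hU : IsOpen U) (hz : z ∈ U) (v : ℂ) :
    bil (d2 f z 1 1) (fderiv ℝ f z v) + bil (d2 f z I I) (fderiv ℝ f z v) = 0 := by
  rw [← bil_add_left, h.bil_fderiv hU hz, h.harmonic z hz, h.harmonic z hz]
  simp

/-- The `z̄`-derivative of `⟨f_z, f_z⟩` is `2⟨f_zz̄, f_z⟩`, and `f_zz̄` is a quarter of the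
Laplacian; its vanishing is the Cauchy–Riemann equation. No condition on the angle enters. -/
lemma differentiableAt_alpha (h : IsHorizontalMinLag U f) (hU : IsOpen U) (hz : z ∈ U) :
    DifferentiableAt ℂ (alpha f) z := by
  have da := (h.differentiableAt_tform hz 1 1).hasFDerivAt
  have db := (h.differentiableAt_tform hz 1 I).hasFDerivAt
  have dd := (h.differentiableAt_tform hz I I).hasFDerivAt
  have hα : alpha f = fun ζ => (1 / 4 : ℂ) *
      (tform f ζ 1 1 - tform f ζ I I - 2 * I * tform f ζ 1 I) := by
    funext ζ
    rw [alpha_eq_tform]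
    ring
  have hd := ((da.fun_sub dd).fun_sub (db.const_mul (2 * I))).const_mul (1 / 4 : ℂ)
  rw [← hα] at hd
  refine differentiableAt_complex_iff_differentiableAt_real.2 ⟨hd.differentiableAt, ?_⟩
  rw [hd.fderiv]
  simp only [sub_apply, smul_apply, smul_eq_mul, h.fderiv_tform hz]
  have e1 := h.bil_laplacian hU hz 1
  have e2 := h.bil_laplacian hU hz I
  rw [d2_symm (h.smooth z hz) I 1]
  linear_combination (-(1 / 2 : ℂ)) * e2 + (1 / 2 : ℂ) * (I * e1) * (-1) +
    (1 / 2 : ℂ) * (bil (d2 f z 1 1) (fderiv ℝ f z I) + bil (d2 f z 1 I) (fderiv ℝ f z 1)) * I_sq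

lemma horDeriv_eq (h : IsHorizontalMinLag U f) (hU : IsOpen U) (hz : z ∈ U) (v : ℂ) :
    horDeriv f z v = fderiv ℝ f z v := by
  rw [horDeriv, horProj, herm_conj4_right, h.horizontal z hz, h.bil_fderiv_self hU hz]
  simp

lemma scale_eq_of_lagMetric (h : IsHorizontalMinLag U f) (hU : IsOpen U) (hz : z ∈ U) {k : ℝ}
    (hk : IsConformalForm (lagMetric f z) k) :
    herm (fderiv ℝ f z 1) (fderiv ℝ f z 1) = k := by
  obtain ⟨c, -, hc, -⟩ := h.exists_scale hz
  have := hk 1 1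
  rw [lagMetric, h.horDeriv_eq hU hz, hc] at this
  rw [hc]
  simpa using this

end IsHorizontalMinLag

/-! ### Surfaces in anti-de Sitter space with a unit normal -/

section RealSurfaces

lemma isConformalForm_inducedForm {F : ℂ → Fin 4 → ℝ} {z : ℂ} {k : ℝ}
    (h1 : bil (fderiv ℝ F z 1) (fderiv ℝ F z 1) = k)
    (h2 : bil (fderiv ℝ F z I) (fderiv ℝ F z I) = k)
    (h3 : bil (fderiv ℝ F z 1) (fderiv ℝ F z I) = 0) :
    IsConformalForm (inducedForm F z) k := by
  intro v w
  have h3' := (bil_comm _ _).trans h3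
  rw [inducedForm, fderiv_eq_re_im (fderiv ℝ F z) v, fderiv_eq_re_im (fderiv ℝ F z) w]
  simp only [bil_add_left, bil_add_right, bil_smul_left, bil_smul_right, h1, h2, h3, h3']
  simp
  ring

lemma IsConformalForm.values {F : ℂ → Fin 4 → ℝ} {z : ℂ} {k : ℝ}
    (h : IsConformalForm (inducedForm F z) k) :
    bil (fderiv ℝ F z 1) (fderiv ℝ F z 1) = k ∧ bil (fderiv ℝ F z I) (fderiv ℝ F z I) = k ∧
    bil (fderiv ℝ F z 1) (fderiv ℝ F z I) = 0 := by
  have a := h 1 1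
  have b := h I I
  have c := h 1 I
  simp only [inducedForm] at a b c
  exact ⟨by simpa using a, by simpa using b, by simpa using c⟩

/-- `F` is a smooth map into anti-de Sitter space with unit timelike normal field `N`. -/
structure IsNormalPair (U : Set ℂ) (F N : ℂ → Fin 4 → ℝ) : Prop where
  smooth_F : ∀ z ∈ U, ContDiffAt ℝ ∞ F z
  smooth_N : ∀ z ∈ U, ContDiffAt ℝ ∞ N z
  mem_bundle : ∀ z ∈ U, (F z, N z) ∈ T1minus
  normal : ∀ z ∈ U, ∀ v : ℂ, bil (fderiv ℝ F z v) (N z) = 0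

namespace IsNormalPair

variable {U : Set ℂ} {F N : ℂ → Fin 4 → ℝ} {z : ℂ}

lemma bil_d2 (h : IsNormalPair U F N) (hU : IsOpen U) (hz : z ∈ U) (v w : ℂ) :
    bil (d2 F z v w) (N z) = -bil (fderiv ℝ F z w) (fderiv ℝ N z v) := by
  have := bil_fderiv_of_eventually_const (differentiableAt_fderiv_apply (h.smooth_F z hz) w)
    ((h.smooth_N z hz).differentiableAt (by simp)) (k := 0)
    (Filter.mem_of_superset (hU.mem_nhds hz) fun ζ hζ => h.normal ζ hζ w) v
  exact eq_neg_of_add_eq_zero_left this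

/-- Moving a derivative from `F` to `N` costs a sign, since `F_w` is normal to `N`; the Hopf
differential then needs only first derivatives. -/
lemma hopf_eq (h : IsNormalPair U F N) (hU : IsOpen U) (hz : z ∈ U) :
    hopf F N z = -((bil (fderiv ℝ F z 1) (fderiv ℝ N z 1) : ℝ) -
      (bil (fderiv ℝ F z I) (fderiv ℝ N z I) : ℝ) - I *
      ((bil (fderiv ℝ F z 1) (fderiv ℝ N z I) : ℝ) +
        (bil (fderiv ℝ F z I) (fderiv ℝ N z 1) : ℝ))) / 4 := by
  have hF := fun ζ hζ => (h.smooth_F ζ hζ).differentiableAt (n := ∞) (by simp)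
  have hdz : dz (fun ζ => toC (F ζ)) =ᶠ[𝓝 z] fun ζ =>
      (1 / 2 : ℂ) • (toCL (fderiv ℝ F ζ 1) - I • toCL (fderiv ℝ F ζ I)) := by
    filter_upwards [hU.mem_nhds hz] with ζ hζ
    have := fun v => fderiv_clm_comp toCL (hF ζ hζ) v
    simp only [toCL_apply] at this
    simp only [dz, this, toCL_apply]
  have hd := differentiableAt_fderiv_apply (h.smooth_F z hz)
  have hd' := fun w => toCL.differentiableAt.comp z (hd w)
  have key := fun w v => fderiv_clm_comp toCL (hd w) v
  have hD := (((hd' 1).hasFDerivAt.fun_sub ((hd' I).hasFDerivAt.fun_const_smul I)).fun_const_smul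
    (1 / 2 : ℂ)).fderiv
  have e : ∀ v, fderiv ℝ (dz fun ζ => toC (F ζ)) z v =
      (1 / 2 : ℂ) • (toC (d2 F z v 1) - I • toC (d2 F z v I)) := by
    intro v
    rw [hdz.fderiv_eq]
    refine (congrArg (fun L => L v) hD).trans ?_
    change (1 / 2 : ℂ) • (fderiv ℝ (fun ζ => toCL (fderiv ℝ F ζ 1)) z v -
      I • fderiv ℝ (fun ζ => toCL (fderiv ℝ F ζ I)) z v) = _
    rw [key, key, toCL_apply, toCL_apply, d2, d2]
  rw [hopf, dz, e, e]
  simp only [bil_smul_left, bil_sub_left, bil_toC, h.bil_d2 hU hz]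
  push_cast
  linear_combination (-((bil (fderiv ℝ F z I) (fderiv ℝ N z I) : ℝ) : ℂ)) / 4 * I_sq

lemma isMaximalCoord (h : IsNormalPair U F N) (hU : IsOpen U)
    (hc : ∀ z ∈ U, ∃ c : ℝ, 0 < c ∧ IsConformalForm (inducedForm F z) c)
    (ht : ∀ z ∈ U, bil (fderiv ℝ F z 1) (fderiv ℝ N z 1) +
      bil (fderiv ℝ F z I) (fderiv ℝ N z I) = 0) :
    IsMaximalCoord U F N where
  smooth_F := fun z hz => (h.smooth_F z hz).contDiffWithinAt
  smooth_N := fun z hz => (h.smooth_N z hz).contDiffWithinAt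
  mem_bundle := h.mem_bundle
  normal := h.normal
  spacelike := hc
  maximal := by
    intro z hz
    have h1 : secondForm F N z 1 1 = _ := h.bil_d2 hU hz 1 1
    have h2 : secondForm F N z I I = _ := h.bil_d2 hU hz I I
    rw [meanCurvature, h1, h2, ← neg_add, ht z hz]
    simp

end IsNormalPair

end RealSurfaces

/-! ### The pair of maximal surfaces of a lift of angle one -/

section Companion

/-- The normalized real part of a map into `ℂ⁴`. -/
def realPart {X : Type*} (f : X → Fin 4 → ℂ) : X → Fin 4 → ℝ := fun x => √2 • reL (f x)

/-- The normalized imaginary part of a map into `ℂ⁴`. -/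
def imagPart {X : Type*} (f : X → Fin 4 → ℂ) : X → Fin 4 → ℝ := fun x => √2 • imL (f x)

/-- The factor `√2` is chosen so that this and the next three polarization identities carry no
constant. They express all products of real and imaginary parts by the real or imaginary parts of
`herm ± bil`. -/
lemma bil_re_re (u w : Fin 4 → ℂ) :
    bil (√2 • reL u) (√2 • reL w) = (bil u w + herm u w).re := by
  have h2 : √2 * √2 = 2 := Real.mul_self_sqrt (by norm_num)
  rw [bil_smul_left, bil_smul_right, ← mul_assoc, h2]
  simp [bil, herm, conj4]
  ring

lemma bil_im_im (u w : Fin 4 → ℂ) :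
    bil (√2 • imL u) (√2 • imL w) = (herm u w - bil u w).re := by
  have h2 : √2 * √2 = 2 := Real.mul_self_sqrt (by norm_num)
  rw [bil_smul_left, bil_smul_right, ← mul_assoc, h2]
  simp [bil, herm, conj4]
  ring

lemma bil_re_im (u w : Fin 4 → ℂ) :
    bil (√2 • reL u) (√2 • imL w) = (bil u w - herm u w).im := by
  have h2 : √2 * √2 = 2 := Real.mul_self_sqrt (by norm_num)
  rw [bil_smul_left, bil_smul_right, ← mul_assoc, h2]
  simp [bil, herm, conj4]
  ring

lemma bil_im_re (u w : Fin 4 → ℂ) :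
    bil (√2 • imL u) (√2 • reL w) = (bil u w + herm u w).im := by
  have h2 : √2 * √2 = 2 := Real.mul_self_sqrt (by norm_num)
  rw [bil_smul_left, bil_smul_right, ← mul_assoc, h2]
  simp [bil, herm, conj4]
  ring

lemma fderiv_realPart {f : ℂ → Fin 4 → ℂ} {z : ℂ} (hf : DifferentiableAt ℝ f z) (v : ℂ) :
    fderiv ℝ (realPart f) z v = √2 • reL (fderiv ℝ f z v) :=
  fderiv_clm_comp (√2 • reL) hf v

lemma fderiv_imagPart {f : ℂ → Fin 4 → ℂ} {z : ℂ} (hf : DifferentiableAt ℝ f z) (v : ℂ) :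
    fderiv ℝ (imagPart f) z v = √2 • imL (fderiv ℝ f z v) :=
  fderiv_clm_comp (√2 • imL) hf v

lemma cvec_realPart_imagPart {X : Type*} (f : X → Fin 4 → ℂ) (x : X) :
    cvec (realPart f x) (imagPart f x) = ((√2 : ℝ) : ℂ) • f x := by
  ext i
  apply Complex.ext <;> simp [cvec, realPart, imagPart, toC]

lemma mem_T1minus_of_null {X : Type*} {f : X → Fin 4 → ℂ} {x : X} (h1 : herm (f x) (f x) = -1)
    (h2 : bil (f x) (f x) = 0) : (realPart f x, imagPart f x) ∈ T1minus := by
  refine ⟨?_, ?_, ?_⟩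
  · change bil _ _ = _
    rw [realPart, bil_re_re, h1, h2]; simp
  · rw [realPart, imagPart, bil_re_im, h1, h2]; simp
  · rw [imagPart, bil_im_im, h1, h2]; simp

namespace IsHorizontalMinLag

variable {U : Set ℂ} {f : ℂ → Fin 4 → ℂ} {z : ℂ}

lemma isNormalPair (h : IsHorizontalMinLag U f) (hU : IsOpen U) :
    IsNormalPair U (realPart f) (imagPart f) where
  smooth_F := fun z hz => (√2 • reL).contDiff.contDiffAt.comp z (h.smooth z hz)
  smooth_N := fun z hz => (√2 • imL).contDiff.contDiffAt.comp z (h.smooth z hz)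
  mem_bundle := fun z hz => mem_T1minus_of_null (h.unit z hz) (h.null z hz)
  normal := by
    intro z hz v
    rw [fderiv_realPart (h.differentiableAt hz), imagPart, bil_re_im, h.bil_fderiv_self hU hz,
      h.horizontal z hz]
    simp

lemma isNormalPair' (h : IsHorizontalMinLag U f) (hU : IsOpen U) :
    IsNormalPair U (imagPart f) (realPart f) where
  smooth_F := (h.isNormalPair hU).smooth_N
  smooth_N := (h.isNormalPair hU).smooth_F
  mem_bundle := fun z hz => by
    obtain ⟨h1, h2, h3⟩ := (h.isNormalPair hU).mem_bundle z hz
    exact ⟨h3, (bil_comm _ _).trans h2, h1⟩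
  normal := by
    intro z hz v
    rw [fderiv_imagPart (h.differentiableAt hz), realPart, bil_im_re, h.bil_fderiv_self hU hz,
      h.horizontal z hz]
    simp

/-- A lift whose angle is `1` has real `β` and opposite `α` and conjugate of `⟨f_z̄, f_z̄⟩`. -/
lemma exists_real_coefficients (h : IsHorizontalMinLag U f) (hU : IsOpen U) (hz : z ∈ U)
    (ha : angle f z = 1) : ∃ c r s t : ℝ, 0 < c ∧
      herm (fderiv ℝ f z 1) (fderiv ℝ f z 1) = c ∧ herm (fderiv ℝ f z I) (fderiv ℝ f z I) = c ∧
      herm (fderiv ℝ f z 1) (fderiv ℝ f z I) = 0 ∧ herm (fderiv ℝ f z I) (fderiv ℝ f z 1) = 0 ∧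
      tform f z 1 1 = ⟨r, s⟩ ∧ tform f z I I = ⟨r, -s⟩ ∧ tform f z 1 I = ⟨0, t⟩ ∧
      c ^ 2 = r ^ 2 + s ^ 2 + t ^ 2 ∧ alpha f z = ⟨t / 2, s / 2⟩ ∧ beta f z = (r / 2 : ℝ) := by
  obtain ⟨c, hc, h1, h2, h3, h4⟩ := h.exists_scale hz
  obtain ⟨e1, e2⟩ := h.tform_eq_angle hU hz
  obtain ⟨e3, -⟩ := h.tform_relations hU hz
  -- With determinant `c²`, the diagonal entries of `T` are conjugate to each other and the
  -- off-diagonal entry is purely imaginary.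
  rw [ha, one_mul] at e1 e2
  rw [h1] at e3
  have e4 : tform f z I I = ⟨(tform f z 1 1).re, -(tform f z 1 1).im⟩ := e1
  have e5 : tform f z 1 I = ⟨0, (tform f z 1 I).im⟩ := by
    have := congrArg Complex.re e2
    simp only [neg_re, conj_re] at this
    exact Complex.ext (by change _ = (0 : ℝ); linarith) rfl
  refine ⟨c, (tform f z 1 1).re, (tform f z 1 1).im, (tform f z 1 I).im, hc, h1, h2, h3, h4, rfl,
    e4, e5, ?_, ?_, ?_⟩
  · have h5 := congrArg Complex.re e3
    rw [e5] at h5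
    rw [← ofReal_pow, ofReal_re] at h5
    rw [← h5]
    simp
    ring
  · rw [alpha_eq_tform, e4, e5]
    apply Complex.ext
    · simp; ring
    · simp; ring
  · rw [beta_eq_tform, e4]
    apply Complex.ext
    · simp; ring
    · simp

/-- The diagonal entries of `T` share their real part `2β` and the off-diagonal one has real part
zero, so the real part of `T` is `2β` times the identity. The last equation is `c² = r² + s² + t²`
divided by four. -/
lemma isConformalForm_parts (h : IsHorizontalMinLag U f) (hU : IsOpen U) (hz : z ∈ U)
    (ha : angle f z = 1) {c b : ℝ} (hc : herm (fderiv ℝ f z 1) (fderiv ℝ f z 1) = c)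
    (hb : beta f z = b) :
    IsConformalForm (inducedForm (realPart f) z) (c + 2 * b) ∧
      IsConformalForm (inducedForm (imagPart f) z) (c - 2 * b) ∧
      b ^ 2 = (c / 2) ^ 2 - ‖alpha f z‖ ^ 2 := by
  obtain ⟨c', r, s, t, -, h1, h2, h3, h4, t1, t2, t3, hcr, hα, hβ⟩ :=
    h.exists_real_coefficients hU hz ha
  obtain rfl : c' = c := by rw [h1] at hc; exact_mod_cast hc
  obtain rfl : r / 2 = b := by rw [hβ] at hb; exact_mod_cast hb
  simp only [tform] at t1 t2 t3
  have d := h.differentiableAt hz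
  refine ⟨isConformalForm_inducedForm ?_ ?_ ?_, isConformalForm_inducedForm ?_ ?_ ?_, ?_⟩
  · rw [fderiv_realPart d, bil_re_re, h1, t1]; simp; ring
  · rw [fderiv_realPart d, bil_re_re, h2, t2]; simp; ring
  · rw [fderiv_realPart d, fderiv_realPart d, bil_re_re, h3, t3]; simp
  · rw [fderiv_imagPart d, bil_im_im, h1, t1]; simp; ring
  · rw [fderiv_imagPart d, bil_im_im, h2, t2]; simp; ring
  · rw [fderiv_imagPart d, fderiv_imagPart d, bil_im_im, h3, t3]; simp
  · rw [hα, ← normSq_eq_norm_sq, normSq_mk]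
    linarith

/-- These numbers are the entries of `Im T`, because the Hermitian products of tangent vectors are
real. Up to sign they are the second fundamental form of either part, with trace zero. -/
lemma mixed_values (h : IsHorizontalMinLag U f) (hU : IsOpen U) (hz : z ∈ U)
    (ha : angle f z = 1) :
    bil (fderiv ℝ (realPart f) z 1) (fderiv ℝ (imagPart f) z 1) = 2 * (alpha f z).im ∧
    bil (fderiv ℝ (realPart f) z I) (fderiv ℝ (imagPart f) z I) = -(2 * (alpha f z).im) ∧
    bil (fderiv ℝ (realPart f) z 1) (fderiv ℝ (imagPart f) z I) = 2 * (alpha f z).re ∧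
    bil (fderiv ℝ (realPart f) z I) (fderiv ℝ (imagPart f) z 1) = 2 * (alpha f z).re := by
  obtain ⟨c, r, s, t, -, h1, h2, h3, h4, t1, t2, t3, hcr, hα, hβ⟩ :=
    h.exists_real_coefficients hU hz ha
  simp only [tform] at t1 t2 t3
  have d := h.differentiableAt hz
  have t4 := (bil_comm _ _).trans t3
  simp only [fderiv_realPart d, fderiv_imagPart d, bil_re_im, h1, h2, h3, h4, t1, t2, t3, t4, hα]
  refine ⟨?_, ?_, ?_, ?_⟩ <;> simp <;> ring

lemma hopf_realPart (h : IsHorizontalMinLag U f) (hU : IsOpen U) (hz : z ∈ U)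
    (ha : angle f z = 1) : hopf (realPart f) (imagPart f) z = I * alpha f z := by
  obtain ⟨m1, m2, m3, m4⟩ := h.mixed_values hU hz ha
  rw [(h.isNormalPair hU).hopf_eq hU hz, m1, m2, m3, m4]
  apply Complex.ext <;> simp <;> ring

lemma hopf_imagPart (h : IsHorizontalMinLag U f) (hU : IsOpen U) (hz : z ∈ U)
    (ha : angle f z = 1) : hopf (imagPart f) (realPart f) z = I * alpha f z := by
  obtain ⟨m1, m2, m3, m4⟩ := h.mixed_values hU hz ha
  rw [(h.isNormalPair' hU).hopf_eq hU hz, bil_comm, m1, bil_comm, m2, bil_comm, m4, bil_comm, m3]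
  apply Complex.ext <;> simp <;> ring

lemma isMaximalCoord_realPart (h : IsHorizontalMinLag U f) (hU : IsOpen U)
    (ha : ∀ z ∈ U, angle f z = 1)
    (hpos : ∀ z ∈ U, 0 < (herm (fderiv ℝ f z 1) (fderiv ℝ f z 1)).re + 2 * (beta f z).re) :
    IsMaximalCoord U (realPart f) (imagPart f) := by
  refine (h.isNormalPair hU).isMaximalCoord hU (fun z hz => ?_) (fun z hz => ?_)
  · obtain ⟨c, r, s, t, -, h1, -, -, -, -, -, -, -, -, hβ⟩ :=
      h.exists_real_coefficients hU hz (ha z hz)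
    have := hpos z hz
    rw [h1, hβ, ofReal_re, ofReal_re] at this
    exact ⟨_, this, (h.isConformalForm_parts hU hz (ha z hz) h1 hβ).1⟩
  · obtain ⟨m1, m2, -⟩ := h.mixed_values hU hz (ha z hz)
    rw [m1, m2, add_neg_cancel]

/-- The conformal factor `c - 2b` is positive where `α ≠ 0`, because `(c/2)² - b² = |α|² > 0` and `c
> 0` force `|b| < c/2`. -/
lemma isMaximalCoord_imagPart (h : IsHorizontalMinLag U f) (hU : IsOpen U)
    (ha : ∀ z ∈ U, angle f z = 1) (hα : ∀ z ∈ U, alpha f z ≠ 0) :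
    IsMaximalCoord U (imagPart f) (realPart f) := by
  refine (h.isNormalPair' hU).isMaximalCoord hU (fun z hz => ?_) (fun z hz => ?_)
  · obtain ⟨c, r, s, t, hc, h1, -, -, -, -, -, -, -, -, hβ⟩ :=
      h.exists_real_coefficients hU hz (ha z hz)
    obtain ⟨-, h2, h3⟩ := h.isConformalForm_parts hU hz (ha z hz) h1 hβ
    refine ⟨_, ?_, h2⟩
    have := norm_pos_iff.2 (hα z hz)
    nlinarith
  · obtain ⟨m1, m2, -⟩ := h.mixed_values hU hz (ha z hz)
    rw [bil_comm, m1, bil_comm, m2, add_neg_cancel]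

end IsHorizontalMinLag

end Companion

/-! ### From arbitrary lifts to horizontal lifts -/

lemma herm_horProj_left {p w u : Fin 4 → ℂ} (h1 : herm u p = 0) (h2 : bil u p = 0) :
    herm (horProj p w) u = herm w u := by
  have h3 : herm p u = 0 := by rw [herm_conj_symm, h1, map_zero]
  rw [horProj, herm_add_left, herm_add_left, herm_smul_left, herm_smul_left, herm_conj4_left,
    bil_comm p u, h2, h3]
  simp

/-- The tangential part of the Laplacian of a conformal map vanishes. -/
lemma re_herm_laplacian {U : Set ℂ} {g : ℂ → Fin 4 → ℂ} {z : ℂ} (hU : IsOpen U) (hz : z ∈ U)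
    (hg : ContDiffAt ℝ ∞ g z)
    (h1 : ∀ ζ ∈ U, herm (fderiv ℝ g ζ 1) (fderiv ℝ g ζ 1) =
      herm (fderiv ℝ g ζ I) (fderiv ℝ g ζ I))
    (h2 : ∀ ζ ∈ U, herm (fderiv ℝ g ζ 1) (fderiv ℝ g ζ I) = 0) :
    (herm (d2 g z 1 1 + d2 g z I I) (fderiv ℝ g z 1)).re = 0 ∧
      (herm (d2 g z 1 1 + d2 g z I I) (fderiv ℝ g z I)).re = 0 := by
  have hd := differentiableAt_fderiv_apply hg
  have hs := d2_symm hg 1 I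
  have a : ∀ v : ℂ, herm (d2 g z v 1) (fderiv ℝ g z 1) + herm (fderiv ℝ g z 1) (d2 g z v 1) =
      herm (d2 g z v I) (fderiv ℝ g z I) + herm (fderiv ℝ g z I) (d2 g z v I) := by
    intro v
    have e : (fun ζ => herm (fderiv ℝ g ζ 1) (fderiv ℝ g ζ 1)) =ᶠ[𝓝 z]
        fun ζ => herm (fderiv ℝ g ζ I) (fderiv ℝ g ζ I) :=
      Filter.mem_of_superset (hU.mem_nhds hz) h1
    have := DFunLike.congr_fun (e.fderiv_eq (𝕜 := ℝ)) v
    rw [fderiv_herm (hd _) (hd _), fderiv_herm (hd _) (hd _)] at this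
    exact this
  have b : ∀ v : ℂ, herm (d2 g z v 1) (fderiv ℝ g z I) +
      herm (fderiv ℝ g z 1) (d2 g z v I) = 0 := by
    intro v
    exact herm_fderiv_of_eventually_const (hd 1) (hd I)
      (Filter.mem_of_superset (hU.mem_nhds hz) h2) v
  -- Conformality is differentiated in both directions; the real parts of the four resulting
  -- identities cancel in pairs.
  have a1 := congrArg re (a 1)
  have a2 := congrArg re (a I)
  have b1 := congrArg re (b 1)
  have b2 := congrArg re (b I)
  rw [herm_conj_symm (fderiv ℝ g z 1) _, herm_conj_symm (fderiv ℝ g z I) _] at a1 a2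
  rw [herm_conj_symm (fderiv ℝ g z 1) _] at b1 b2
  rw [hs] at a1 b1
  simp only [add_re, conj_re, zero_re] at a1 a2 b1 b2
  rw [herm_add_left, herm_add_left, add_re, add_re]
  constructor <;> linarith

lemma fderiv_smul_fun {l : ℂ → ℂ} {W : ℂ → Fin 4 → ℂ} {z : ℂ} (hl : DifferentiableAt ℝ l z)
    (hW : DifferentiableAt ℝ W z) (v : ℂ) :
    fderiv ℝ (fun ζ => l ζ • W ζ) z v = l z • fderiv ℝ W z v + fderiv ℝ l z v • W z := by
  rw [(hl.hasFDerivAt.fun_smul hW.hasFDerivAt).fderiv]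
  simp

namespace IsMinLagCoord

variable {U : Set ℂ} {h g : ℂ → Fin 4 → ℂ} {l : ℂ → ℂ}

lemma contDiffAt (hh : IsMinLagCoord U h) (hU : IsOpen U) {z : ℂ} (hz : z ∈ U) :
    ContDiffAt ℝ ∞ h z :=
  hh.smooth.contDiffAt (hU.mem_nhds hz)

lemma mono (hh : IsMinLagCoord U h) {V : Set ℂ} (hr : V ⊆ U) : IsMinLagCoord V h :=
  ⟨hh.smooth.mono hr, fun z hz => hh.unit z (hr hz), fun z hz => hh.null z (hr hz),
    fun z hz => hh.immersion z (hr hz), fun z hz => hh.lagrangian z (hr hz),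
    fun z hz => hh.minimal z (hr hz)⟩

lemma bil_fderiv_self (hh : IsMinLagCoord U h) (hU : IsOpen U) {z : ℂ} (hz : z ∈ U) (v : ℂ) :
    bil (fderiv ℝ h z v) (h z) = 0 :=
  bil_fderiv_self_of_null ((hh.contDiffAt hU hz).differentiableAt (by simp))
    (Filter.mem_of_superset (hU.mem_nhds hz) hh.null) v

lemma horDeriv_eq (hh : IsMinLagCoord U h) (hU : IsOpen U) {z : ℂ} (hz : z ∈ U) (v : ℂ) :
    horDeriv h z v = fderiv ℝ h z v + herm (fderiv ℝ h z v) (h z) • h z := by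
  rw [horDeriv, horProj, herm_conj4_right, hh.bil_fderiv_self hU hz]
  simp

/-- A horizontal lift that differs by a phase from a lift of a minimal Lagrangian surface. -/
lemma isHorizontalMinLag (hh : IsMinLagCoord U h) (hU : IsOpen U)
    (hl : ∀ z ∈ U, ContDiffAt ℝ ∞ l z) (hn : ∀ z ∈ U, l z * (starRingEnd ℂ) (l z) = 1)
    (hgl : ∀ z ∈ U, g z = l z • h z)
    (hor : ∀ z ∈ U, ∀ v, herm (fderiv ℝ g z v) (g z) = 0) : IsHorizontalMinLag U g := by
  have hgs : ∀ z ∈ U, ContDiffAt ℝ ∞ g z := fun z hz =>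
    ((hl z hz).smul (hh.contDiffAt hU hz)).congr_of_eventuallyEq
      (Filter.mem_of_superset (hU.mem_nhds hz) hgl)
  have dl : ∀ z ∈ U, DifferentiableAt ℝ l z := fun z hz => (hl z hz).differentiableAt (by simp)
  have dh : ∀ z ∈ U, DifferentiableAt ℝ h z := fun z hz =>
    (hh.contDiffAt hU hz).differentiableAt (by simp)
  have hl0 : ∀ z ∈ U, l z ≠ 0 := fun z hz => left_ne_zero_of_mul_eq_one (hn z hz)
  have hcl0 : ∀ z ∈ U, (starRingEnd ℂ) (l z) ≠ 0 := fun z hz =>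
    right_ne_zero_of_mul_eq_one (hn z hz)
  have hg' : ∀ z ∈ U, ∀ v, fderiv ℝ g z v = l z • fderiv ℝ h z v + fderiv ℝ l z v • h z := by
    intro z hz v
    have e : g =ᶠ[𝓝 z] fun ζ => l ζ • h ζ := Filter.mem_of_superset (hU.mem_nhds hz) hgl
    rw [e.fderiv_eq, fderiv_smul_fun (dl z hz) (dh z hz)]
  -- Horizontality of `l • h` prescribes the derivative of the phase: it must cancel the vertical
  -- component of the derivative of `h`. The derivative of `g` is then exactly `l` times the
  -- horizontal derivative of `h`.
  have hl' : ∀ z ∈ U, ∀ v, fderiv ℝ l z v = l z * herm (fderiv ℝ h z v) (h z) := by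
    intro z hz v
    have := hor z hz v
    rw [hg' z hz, hgl z hz, herm_smul_right, herm_add_left, herm_smul_left, herm_smul_left,
      hh.unit z hz] at this
    have := (mul_eq_zero.1 this).resolve_left (hcl0 z hz)
    linear_combination -this
  have hD : ∀ z ∈ U, ∀ v, fderiv ℝ g z v = l z • horDeriv h z v := by
    intro z hz v
    rw [hg' z hz, hl' z hz, hh.horDeriv_eq hU hz, smul_add, mul_smul]
  have hH : ∀ z ∈ U, ∀ v, horDeriv h z v = (starRingEnd ℂ) (l z) • fderiv ℝ g z v := by
    intro z hz v
    rw [hD z hz, smul_smul, mul_comm, hn z hz, one_smul]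
  have hherm : ∀ z ∈ U, ∀ v w, herm (fderiv ℝ g z v) (fderiv ℝ g z w) =
      herm (horDeriv h z v) (horDeriv h z w) := by
    intro z hz v w
    rw [hD z hz, hD z hz, herm_smul_left, herm_smul_right, ← mul_assoc, hn z hz, one_mul]
  have hconf : ∀ z ∈ U, ∃ c : ℝ, 0 < c ∧ ∀ v w,
      herm (fderiv ℝ g z v) (fderiv ℝ g z w) = ((c * (v * (starRingEnd ℂ) w).re : ℝ) : ℂ) := by
    intro z hz
    obtain ⟨c, hc, H⟩ := hh.immersion z hz
    refine ⟨c, hc, fun v w => ?_⟩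
    rw [hherm z hz]
    apply Complex.ext
    · exact H v w
    · have := hh.lagrangian z hz v w
      rw [kahlerForm, neg_eq_zero] at this
      rw [this, ofReal_im]
  have hnull : ∀ z ∈ U, bil (g z) (g z) = 0 := by
    intro z hz
    rw [hgl z hz, bil_smul_left, bil_smul_right, hh.null z hz]
    simp
  have hbil : ∀ z ∈ U, ∀ v, bil (fderiv ℝ g z v) (g z) = 0 := fun z hz =>
    bil_fderiv_self_of_null ((hgs z hz).differentiableAt (by simp))
      (Filter.mem_of_superset (hU.mem_nhds hz) hnull)
  refine ⟨hgs, fun z hz => ?_, hnull, hor, hconf, ?_⟩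
  · rw [hgl z hz, herm_smul_left, herm_smul_right, ← mul_assoc, hn z hz, hh.unit z hz, one_mul]
  intro z hz
  -- The derivative of the phase reproduces the correction term in `covDeriv`, so second derivatives
  -- of `g` are `l` times covariant derivatives, up to components orthogonal to the tangent vectors.
  have hd2 : ∀ u v w, herm (d2 g z v w) (fderiv ℝ g z u) =
      herm (covDeriv h (fun ζ => horDeriv h ζ w) z v) (horDeriv h z u) := by
    intro u v w
    have dW : DifferentiableAt ℝ (fun ζ => horDeriv h ζ w) z := by
      have e : (fun ζ => horDeriv h ζ w) =ᶠ[𝓝 z]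
          fun ζ => conjCLE (l ζ) • fderiv ℝ g ζ w :=
        Filter.mem_of_superset (hU.mem_nhds hz) fun ζ hζ => hH ζ hζ w
      refine DifferentiableAt.congr_of_eventuallyEq ?_ e
      exact (conjCLE.differentiableAt.comp z (dl z hz)).smul
        (differentiableAt_fderiv_apply (hgs z hz) w)
    have e : (fun ζ => fderiv ℝ g ζ w) =ᶠ[𝓝 z] fun ζ => l ζ • horDeriv h ζ w :=
      Filter.mem_of_superset (hU.mem_nhds hz) fun ζ hζ => hD ζ hζ w
    have o1 : herm (horDeriv h z u) (h z) = 0 := by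
      have := hor z hz u
      rw [hD z hz, hgl z hz, herm_smul_left, herm_smul_right] at this
      simpa [hl0 z hz, hcl0 z hz] using this
    have o2 : bil (horDeriv h z u) (h z) = 0 := by
      have := hbil z hz u
      rw [hD z hz, hgl z hz, bil_smul_left, bil_smul_right] at this
      simpa [hl0 z hz] using this
    rw [d2, e.fderiv_eq, fderiv_smul_fun (dl z hz) dW, hl' z hz, hD z hz, covDeriv, herm_add_left,
      herm_add_left, herm_smul_right, herm_smul_right, herm_smul_left, herm_smul_left,
      herm_smul_left, herm_horProj_left o1 o2]
    linear_combination (herm (fderiv ℝ (fun ζ => horDeriv h ζ w) z v) (horDeriv h z u) +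
      herm (fderiv ℝ h z v) (h z) * herm (horDeriv h z w) (horDeriv h z u)) * hn z hz
  obtain ⟨c, hc, H⟩ := hconf z hz
  have hX : herm (horDeriv h z 1) (horDeriv h z 1) = c := by rw [← hherm z hz, H]; simp
  have hY : herm (horDeriv h z I) (horDeriv h z I) = c := by rw [← hherm z hz, H]; simp
  have hXY : herm (horDeriv h z 1) (horDeriv h z I) = 0 := by rw [← hherm z hz, H]; simp
  have hYX : herm (horDeriv h z I) (horDeriv h z 1) = 0 := by rw [← hherm z hz, H]; simp
  have hc' : (c : ℂ) ≠ 0 := by exact_mod_cast hc.ne'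
  have hmin : lagSecondForm h z 1 1 + lagSecondForm h z I I = 0 := by
    have := hh.minimal z hz
    rw [lagMeanCurvature, lagMetric, hX, ofReal_re] at this
    exact (smul_eq_zero.1 this).resolve_left (by positivity)
  have hre := re_herm_laplacian hU hz (hgs z hz)
    (fun ζ hζ => by obtain ⟨c, -, H⟩ := hconf ζ hζ; simp [H])
    (fun ζ hζ => by obtain ⟨c, -, H⟩ := hconf ζ hζ; simp [H])
  simp only [herm_add_left, hd2] at hre
  -- `normalPart` removes real multiples of the tangent vectors, so vanishing mean curvature gives
  -- only the imaginary part; the real part vanishes by conformality (`re_herm_laplacian`). The same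
  -- holds for `key2`.
  have key1 : herm (d2 g z 1 1 + d2 g z I I) (fderiv ℝ g z 1) = 0 := by
    have := congrArg (fun w => herm w (horDeriv h z 1)) hmin
    simp only [lagSecondForm, normalPart, herm_add_left, herm_sub_left, herm_real_smul_left, hX, hY,
      hYX, herm_zero_left, ofReal_re, ofReal_div] at this
    rw [herm_add_left, hd2, hd2]
    apply Complex.ext
    · exact hre.1
    · field_simp at this
      have := congrArg im this
      rw [zero_im]
      refine (mul_eq_zero.1 (?_ : c * _ = 0)).resolve_left hc.ne'
      simpa [mul_add, mul_comm] using this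
  have key2 : herm (d2 g z 1 1 + d2 g z I I) (fderiv ℝ g z I) = 0 := by
    have := congrArg (fun w => herm w (horDeriv h z I)) hmin
    simp only [lagSecondForm, normalPart, herm_add_left, herm_sub_left, herm_real_smul_left, hX, hY,
      hXY, herm_zero_left, ofReal_re, ofReal_div] at this
    rw [herm_add_left, hd2, hd2]
    apply Complex.ext
    · exact hre.2
    · field_simp at this
      have := congrArg im this
      rw [zero_im]
      refine (mul_eq_zero.1 (?_ : c * _ = 0)).resolve_left hc.ne'
      simpa [mul_add, mul_comm] using this
  intro v
  rw [fderiv_eq_re_im (fderiv ℝ g z) v, herm_add_right, herm_real_smul_right, herm_real_smul_right,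
    key1, key2]
  simp

lemma re_herm_fderiv_self (hh : IsMinLagCoord U h) (hU : IsOpen U) {z : ℂ} (hz : z ∈ U) (v : ℂ) :
    (herm (fderiv ℝ h z v) (h z)).re = 0 := by
  have d := (hh.contDiffAt hU hz).differentiableAt (n := ∞) (by simp)
  have := congrArg re (herm_fderiv_of_eventually_const d d
    (Filter.mem_of_superset (hU.mem_nhds hz) hh.unit) v)
  rw [herm_conj_symm (h z), add_re, conj_re, zero_re] at this
  linarith

/-- The vertical components of the derivatives are imaginary multiples of `h`, so they change the
Hermitian product only by a real number; its imaginary part is governed by the Kähler form. -/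
lemma im_herm_fderiv_fderiv (hh : IsMinLagCoord U h) (hU : IsOpen U) {z : ℂ} (hz : z ∈ U)
    (v w : ℂ) : (herm (fderiv ℝ h z v) (fderiv ℝ h z w)).im = 0 := by
  have := hh.lagrangian z hz v w
  have a := hh.re_herm_fderiv_self hU hz v
  have b := hh.re_herm_fderiv_self hU hz w
  rw [kahlerForm, hh.horDeriv_eq hU hz, hh.horDeriv_eq hU hz] at this
  simp only [herm_add_left, herm_add_right, herm_smul_left, herm_smul_right, hh.unit z hz] at this
  rw [herm_conj_symm (h z)] at this
  simp [a, b] at this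
  linarith

/-- Existence of a horizontal lift on a ball. -/
lemma exists_horizontal (hh : IsMinLagCoord U h) {z₀ : ℂ} {r : ℝ} (hU : IsOpen U)
    (hr : Metric.ball z₀ r ⊆ U) : ∃ l : ℂ → ℂ,
      (∀ z ∈ Metric.ball z₀ r, l z * (starRingEnd ℂ) (l z) = 1) ∧
      IsHorizontalMinLag (Metric.ball z₀ r) fun z => l z • h z := by
  set B := Metric.ball z₀ r with hB
  have hBo : IsOpen B := Metric.isOpen_ball
  have dh : ∀ z ∈ U, DifferentiableAt ℝ h z := fun z hz =>
    (hh.contDiffAt hU hz).differentiableAt (by simp)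
  -- The connection form of the circle bundle along `h`; a primitive `θ` of it gives the phase
  -- `exp(iθ)` that makes the lift horizontal.
  let s : ℂ → ℂ → ℝ := fun v z => (herm (fderiv ℝ h z v) (h z)).im
  have hs : ∀ v, ∀ z ∈ B, ContDiffAt ℝ ∞ (s v) z := fun v z hz =>
    imCLM.contDiff.contDiffAt.comp z (ContDiffAt.herm
      (contDiffAt_fderiv_apply (hh.contDiffAt hU (hr hz)) v) (hh.contDiffAt hU (hr hz)))
  have ds : ∀ v, ∀ z ∈ B, DifferentiableAt ℝ (s v) z := fun v z hz =>
    (hs v z hz).differentiableAt (by simp)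
  -- By the Lagrangian condition only the second-derivative term survives. It is symmetric in `u`
  -- and `v`, so the connection form is closed and has a primitive on the ball.
  have hs' : ∀ v u, ∀ z ∈ B, fderiv ℝ (s v) z u = (herm (d2 h z u v) (h z)).im := by
    intro v u z hz
    have d1 := differentiableAt_fderiv_apply (hh.contDiffAt hU (hr hz)) v
    have := fderiv_clm_comp imCLM (differentiableAt_herm d1 (dh z (hr hz))) u
    rw [fderiv_herm d1 (dh z (hr hz))] at this
    refine this.trans ?_
    rw [imCLM_apply, add_im, hh.im_herm_fderiv_fderiv hU (hr hz), add_zero]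
    rfl
  let η : ℂ → ℂ →L[ℝ] ℝ := fun z => s 1 z • reCLM + s I z • imCLM
  have hηs : ∀ z ∈ B, ContDiffAt ℝ ∞ η z := fun z hz =>
    ((hs 1 z hz).smul contDiffAt_const).add ((hs I z hz).smul contDiffAt_const)
  obtain ⟨θ, hθ⟩ := (convex_ball z₀ r).exists_forall_hasFDerivAt_of_fderiv_symmetric hBo
    (show DifferentiableOn ℝ η B from
      fun z hz => ((hηs z hz).differentiableAt (by simp)).differentiableWithinAt) (by
      intro z hz x y
      have : HasFDerivAt η _ z := ((ds 1 z hz).hasFDerivAt.smul_const reCLM).fun_add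
        ((ds I z hz).hasFDerivAt.smul_const imCLM)
      rw [this.fderiv]
      have e : fderiv ℝ (s 1) z I = fderiv ℝ (s I) z 1 := by
        rw [hs' _ _ z hz, hs' _ _ z hz, d2_symm (hh.contDiffAt hU (hr hz))]
      rw [add_apply, add_apply, add_apply, add_apply]
      simp only [ContinuousLinearMap.smulRight_apply, smul_apply, smul_eq_mul, reCLM_apply,
        imCLM_apply]
      rw [fderiv_eq_re_im (fderiv ℝ (s 1) z) x, fderiv_eq_re_im (fderiv ℝ (s 1) z) y,
        fderiv_eq_re_im (fderiv ℝ (s I) z) x, fderiv_eq_re_im (fderiv ℝ (s I) z) y, e]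
      simp only [smul_eq_mul]
      ring)
  have hθs : ∀ z ∈ B, ContDiffAt ℝ ∞ θ z := by
    have : ContDiffOn ℝ ∞ θ B := by
      rw [contDiffOn_infty_iff_fderiv_of_isOpen hBo]
      refine ⟨fun z hz => (hθ z hz).differentiableAt.differentiableWithinAt, ?_⟩
      intro z hz
      exact (hηs z hz).contDiffWithinAt.congr (fun ζ hζ => (hθ ζ hζ).fderiv) (hθ z hz).fderiv
    exact fun z hz => this.contDiffAt (hBo.mem_nhds hz)
  let l : ℂ → ℂ := fun z => cexp (θ z * I)
  have hls : ∀ z ∈ B, ContDiffAt ℝ ∞ l z := fun z hz =>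
    ((ofRealCLM.contDiff.contDiffAt.comp z (hθs z hz)).mul contDiffAt_const).cexp
  have hn : ∀ z, l z * (starRingEnd ℂ) (l z) = 1 := by
    intro z
    rw [mul_conj, normSq_eq_norm_sq, norm_exp_ofReal_mul_I]
    simp
  have hl' : ∀ z ∈ B, ∀ v, fderiv ℝ l z v = l z * herm (fderiv ℝ h z v) (h z) := by
    intro z hz v
    have e1 : HasFDerivAt (fun ζ => (θ ζ : ℂ)) (ofRealCLM.comp (η z)) z :=
      ofRealCLM.hasFDerivAt.comp z (hθ z hz)
    rw [((e1.mul_const I).cexp).fderiv]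
    have : herm (fderiv ℝ h z v) (h z) = ((η z v : ℝ) : ℂ) * I := by
      have e2 : η z v = (herm (fderiv ℝ h z v) (h z)).im := by
        rw [fderiv_eq_re_im (fderiv ℝ h z) v, herm_add_left, herm_real_smul_left,
          herm_real_smul_left]
        simp [η, s]
        ring
      rw [e2]
      apply Complex.ext
      · simp [hh.re_herm_fderiv_self hU (hr hz)]
      · simp
    rw [this]
    simp [l]
    ring
  refine ⟨l, fun z _ => hn z, ?_⟩
  have hhB : IsMinLagCoord B h := hh.mono hr
  refine hhB.isHorizontalMinLag hBo hls (fun z _ => hn z) (fun z _ => rfl) ?_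
  intro z hz v
  rw [fderiv_smul_fun ((hls z hz).differentiableAt (by simp)) (dh z (hr hz)), hl' z hz,
    herm_smul_right, herm_add_left, herm_smul_left, herm_smul_left, hh.unit z (hr hz)]
  ring

end IsMinLagCoord

/-! ### Changes of coordinate and of phase; normalization -/

namespace IsHorizontalMinLag

variable {U : Set ℂ} {f g : ℂ → Fin 4 → ℂ} {z : ℂ}

lemma of_local (H : ∀ z ∈ U, ∃ V : Set ℂ, z ∈ V ∧ IsHorizontalMinLag V f) :
    IsHorizontalMinLag U f := by
  refine ⟨fun z hz => ?_, fun z hz => ?_, fun z hz => ?_, fun z hz => ?_, fun z hz => ?_,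
    fun z hz => ?_⟩ <;> obtain ⟨V, hV, h⟩ := H z hz
  exacts [h.smooth z hV, h.unit z hV, h.null z hV, h.horizontal z hV, h.conformal z hV,
    h.harmonic z hV]

lemma mono {V : Set ℂ} (h : IsHorizontalMinLag U f) (hV : V ⊆ U) : IsHorizontalMinLag V f :=
  of_local fun _ hz => ⟨U, hV hz, h⟩

/-- Behaviour of the invariants under a conformal change of coordinates. -/
lemma change_coordinates (h : IsHorizontalMinLag U f) (hz : z ∈ U) {z' t : ℂ} (ht : t ≠ 0)
    (hg : ∀ v, fderiv ℝ g z' v = fderiv ℝ f z (t * v)) :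
    herm (fderiv ℝ g z' 1) (fderiv ℝ g z' 1) =
      (normSq t : ℝ) * herm (fderiv ℝ f z 1) (fderiv ℝ f z 1) ∧
    beta g z' = (normSq t : ℝ) * beta f z ∧ angle g z' = angle f z := by
  obtain ⟨c, hc, h1, h2, h3, h4⟩ := h.exists_scale hz
  have hc' : (c : ℂ) ≠ 0 := by exact_mod_cast hc.ne'
  have ht' : ((normSq t : ℝ) : ℂ) ≠ 0 := by
    exact_mod_cast fun h0 => ht (normSq_eq_zero.1 h0)
  have hs := bil_comm (fderiv ℝ f z I) (fderiv ℝ f z 1)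
  -- Multiplication by `t` acts on `1, I` by a matrix of determinant `normSq t`, so `det T` and `c²`
  -- both scale by `(normSq t)²`.
  have hX : fderiv ℝ g z' 1 = t.re • fderiv ℝ f z 1 + t.im • fderiv ℝ f z I := by
    rw [hg, mul_one, fderiv_eq_re_im]
  have hY : fderiv ℝ g z' I = (-t.im) • fderiv ℝ f z 1 + t.re • fderiv ℝ f z I := by
    rw [hg, fderiv_eq_re_im]
    simp
  have hn : ((normSq t : ℝ) : ℂ) = t.re ^ 2 + t.im ^ 2 := by
    rw [normSq_apply]; push_cast; ring
  have e : herm (fderiv ℝ g z' 1) (fderiv ℝ g z' 1) =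
      (normSq t : ℝ) * herm (fderiv ℝ f z 1) (fderiv ℝ f z 1) := by
    rw [hX, hn]
    simp only [herm_add_left, herm_add_right, herm_real_smul_left, herm_real_smul_right, h1, h2,
      h3, h4]
    ring
  refine ⟨e, ?_, ?_⟩
  · rw [beta_eq_tform, beta_eq_tform, hn]
    simp only [tform, hX, hY, bil_add_left, bil_add_right, bil_real_smul_left,
      bil_real_smul_right, hs]
    push_cast
    ring
  · rw [angle, e, h1, angle, h1]
    rw [div_eq_div_iff (pow_ne_zero 2 (mul_ne_zero ht' hc')) (pow_ne_zero 2 hc'), hn]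
    simp only [tform, hX, hY, bil_add_left, bil_add_right, bil_real_smul_left,
      bil_real_smul_right, hs]
    push_cast
    ring

/-- `T` is complex bilinear in the lift, hence scales by `m²`, while the metric is unchanged. In
particular `m = I` flips the sign of `β` and keeps the angle. -/
lemma const_smul (h : IsHorizontalMinLag U f) (hU : IsOpen U) {m : ℂ}
    (hm : m * (starRingEnd ℂ) m = 1) : IsHorizontalMinLag U (fun ζ => m • f ζ) ∧
      ∀ z ∈ U, beta (fun ζ => m • f ζ) z = m ^ 2 * beta f z ∧
        angle (fun ζ => m • f ζ) z = m ^ 4 * angle f z := by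
  have hd : ∀ z ∈ U, ∀ v, fderiv ℝ (fun ζ => m • f ζ) z v = m • fderiv ℝ f z v := by
    intro z hz v
    rw [fderiv_smul_fun (differentiableAt_const m) (h.differentiableAt hz)]
    simp
  have hd2 : ∀ z ∈ U, ∀ v w, d2 (fun ζ => m • f ζ) z v w = m • d2 f z v w := by
    intro z hz v w
    have e : (fun ζ => fderiv ℝ (fun ζ => m • f ζ) ζ w) =ᶠ[𝓝 z] fun ζ => m • fderiv ℝ f ζ w :=
      Filter.mem_of_superset (hU.mem_nhds hz) fun ζ hζ => hd ζ hζ w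
    rw [d2, e.fderiv_eq, fderiv_smul_fun (differentiableAt_const m)
      (differentiableAt_fderiv_apply (h.smooth z hz) w)]
    simp [d2]
  have hh : ∀ u w : Fin 4 → ℂ, herm (m • u) (m • w) = herm u w := by
    intro u w
    rw [herm_smul_left, herm_smul_right, ← mul_assoc, hm, one_mul]
  refine ⟨⟨fun z hz => contDiffAt_const.fun_smul (h.smooth z hz), fun z hz => ?_, fun z hz => ?_,
    fun z hz v => ?_, fun z hz => ?_, fun z hz v => ?_⟩, fun z hz => ⟨?_, ?_⟩⟩
  · rw [hh, h.unit z hz]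
  · rw [bil_smul_left, bil_smul_right, h.null z hz, mul_zero, mul_zero]
  · rw [hd z hz, hh, h.horizontal z hz]
  · obtain ⟨c, hc, H⟩ := h.conformal z hz
    exact ⟨c, hc, fun v w => by rw [hd z hz, hd z hz, hh, H]⟩
  · rw [hd2 z hz, hd2 z hz, hd z hz, ← smul_add, hh, h.harmonic z hz]
  · rw [beta_eq_tform, beta_eq_tform]
    simp only [tform, hd z hz, bil_smul_left, bil_smul_right]
    ring
  · rw [angle, angle]
    simp only [tform, hd z hz, bil_smul_left, bil_smul_right, hh]
    ring

/-- The relation `T_II = angle * conj T_11` and unimodularity give `angle * conj β = β` for every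
horizontal lift; a real nonzero `β` can be cancelled. -/
lemma angle_eq_one (h : IsHorizontalMinLag U f) (hU : IsOpen U) (hz : z ∈ U)
    (hb : (beta f z).im = 0) (hb0 : beta f z ≠ 0) : angle f z = 1 := by
  obtain ⟨e, -⟩ := h.tform_eq_angle hU hz
  have e1 := h.angle_mul_conj hU hz
  have hb' : (starRingEnd ℂ) (beta f z) = beta f z := conj_eq_iff_im.2 hb
  have key : angle f z * (starRingEnd ℂ) (beta f z) = beta f z := by
    rw [beta_eq_tform, e]
    simp only [map_div₀, map_add, map_mul, Complex.conj_conj]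
    rw [show (starRingEnd ℂ) 4 = (4 : ℂ) from conj_ofNat 4]
    linear_combination tform f z 1 1 / 4 * e1
  rw [hb'] at key
  exact mul_right_cancel₀ hb0 (by rw [key, one_mul])

/-- Local constancy of the angle, phrased for arbitrary subsets of values so that it can be
transported to the Riemann surface for a connectedness argument. -/
lemma isOpen_inter_angle (h : IsHorizontalMinLag U f) (hU : IsOpen U) (T : Set ℂ) :
    IsOpen (U ∩ angle f ⁻¹' T) :=
  hU.isOpen_inter_preimage_of_fderiv_eq_zero
    (fun _ hz => (h.hasFDerivAt_angle hU hz).differentiableAt.differentiableWithinAt)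
    (fun _ hz => (h.hasFDerivAt_angle hU hz).fderiv) T

lemma continuousAt_beta (h : IsHorizontalMinLag U f) (hz : z ∈ U) :
    ContinuousAt (beta f) z := by
  have : beta f = fun ζ => (tform f ζ 1 1 + tform f ζ I I) / 4 := funext (beta_eq_tform f)
  rw [this]
  exact ((h.differentiableAt_tform hz 1 1).continuousAt.add
    (h.differentiableAt_tform hz I I).continuousAt).div_const 4

lemma continuousAt_scale (h : IsHorizontalMinLag U f) (hz : z ∈ U) :
    ContinuousAt (fun ζ => herm (fderiv ℝ f ζ 1) (fderiv ℝ f ζ 1)) z :=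
  (differentiableAt_herm (differentiableAt_fderiv_apply (h.smooth z hz) 1)
    (differentiableAt_fderiv_apply (h.smooth z hz) 1)).continuousAt

end IsHorizontalMinLag

/-- A fourth root of the inverse is taken because `det T` has degree four in the lift. -/
lemma exists_phase {k : ℂ} (hk : k * (starRingEnd ℂ) k = 1) :
    ∃ m : ℂ, m * (starRingEnd ℂ) m = 1 ∧ m ^ 4 * k = 1 := by
  have hn : ‖k‖ = 1 := by
    rw [mul_conj, normSq_eq_norm_sq] at hk
    have : ‖k‖ ^ 2 = 1 := by exact_mod_cast hk
    nlinarith [norm_nonneg k]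
  obtain ⟨θ, rfl⟩ : ∃ θ : ℝ, k = cexp (θ * I) := by
    refine ⟨k.arg, ?_⟩
    conv_lhs => rw [← norm_mul_exp_arg_mul_I k, hn]
    simp
  refine ⟨cexp ((-θ / 4 : ℝ) * I), ?_, ?_⟩
  · rw [mul_conj, normSq_eq_norm_sq, norm_exp_ofReal_mul_I]; simp
  · rw [← Complex.exp_nat_mul, ← Complex.exp_add, ← Complex.exp_zero]
    congr 1
    push_cast
    ring

/-- A normalized horizontal lift in a coordinate ball. -/
lemma IsMinLagCoord.exists_normalized {U : Set ℂ} {h : ℂ → Fin 4 → ℂ} (hh : IsMinLagCoord U h)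
    (hU : IsOpen U) {z₀ : ℂ} (hz₀ : z₀ ∈ U) : ∃ B : Set ℂ, IsOpen B ∧ z₀ ∈ B ∧ B ⊆ U ∧
      ∃ g : ℂ → Fin 4 → ℂ, IsHorizontalMinLag B g ∧
        (∀ z ∈ B, ∃ a : ℂ, a ≠ 0 ∧ g z = a • h z) ∧ (∀ z ∈ B, angle g z = 1) ∧
        (∀ z ∈ B, 0 < (herm (fderiv ℝ g z 1) (fderiv ℝ g z 1)).re + 2 * (beta g z).re) ∧
        ((∀ z ∈ B, 0 < (beta g z).re) ∨ beta g z₀ = 0) := by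
  obtain ⟨r, hr, hrU⟩ := Metric.isOpen_iff.1 hU z₀ hz₀
  set B := Metric.ball z₀ r
  have hB : IsOpen B := Metric.isOpen_ball
  have hzB : z₀ ∈ B := Metric.mem_ball_self hr
  obtain ⟨l, hl, H⟩ := hh.exists_horizontal hU hrU
  set g₀ := fun z => l z • h z with hg₀
  obtain ⟨m, hm, hmk⟩ := exists_phase (H.angle_mul_conj hB hzB)
  have hconst : ∀ z ∈ B, angle g₀ z = angle g₀ z₀ := fun z hz =>
    hB.is_const_of_fderiv_eq_zero (convex_ball z₀ r).isPreconnected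
      (fun z hz => (H.hasFDerivAt_angle hB hz).differentiableAt.differentiableWithinAt)
      (fun z hz => (H.hasFDerivAt_angle hB hz).fderiv) hz hzB
  obtain ⟨H1, H2⟩ := H.const_smul hB hm
  set g₁ := fun z => m • g₀ z with hg₁
  have ha1 : ∀ z ∈ B, angle g₁ z = 1 := fun z hz => by rw [(H2 z hz).2, hconst z hz, hmk]
  have hm0 : m ≠ 0 := left_ne_zero_of_mul_eq_one hm
  have hlift1 : ∀ z ∈ B, ∃ a : ℂ, a ≠ 0 ∧ g₁ z = a • h z := fun z hz =>
    ⟨m * l z, mul_ne_zero hm0 (left_ne_zero_of_mul_eq_one (hl z hz)), by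
      rw [hg₁, hg₀, mul_smul]⟩
  obtain ⟨g, Hg, hlift, ha, hsign⟩ : ∃ g : ℂ → Fin 4 → ℂ, IsHorizontalMinLag B g ∧
      (∀ z ∈ B, ∃ a : ℂ, a ≠ 0 ∧ g z = a • h z) ∧ (∀ z ∈ B, angle g z = 1) ∧
      (0 < (beta g z₀).re ∨ beta g z₀ = 0) := by
    obtain ⟨c, x, s, t, -, -, -, -, -, -, -, -, -, -, hβ⟩ :=
      H1.exists_real_coefficients hB hzB (ha1 z₀ hzB)
    -- If `β` is negative at the centre, the lift is multiplied by `I`, which is the remaining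
    -- freedom at angle `1` that changes the sign of `β`.
    rcases lt_trichotomy x 0 with hx | hx | hx
    · obtain ⟨H3, H4⟩ := H1.const_smul hB (m := I) (by simp)
      refine ⟨_, H3, fun z hz => ?_, fun z hz => ?_, Or.inl ?_⟩
      · obtain ⟨a, ha, h'⟩ := hlift1 z hz
        exact ⟨I * a, mul_ne_zero I_ne_zero ha, by rw [h', mul_smul]⟩
      · rw [(H4 z hz).2, ha1 z hz, I_pow_four, one_mul]
      · rw [(H4 z₀ hzB).1, hβ, I_sq, ← ofReal_one, ← ofReal_neg, ← ofReal_mul, ofReal_re]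
        linarith
    · exact ⟨g₁, H1, hlift1, ha1, Or.inr (by rw [hβ, hx]; simp)⟩
    · exact ⟨g₁, H1, hlift1, ha1, Or.inl (by rw [hβ, ofReal_re]; linarith)⟩
  have hβc := continuous_re.continuousAt.comp (Hg.continuousAt_beta hzB)
  have hsc := continuous_re.continuousAt.comp (Hg.continuousAt_scale hzB)
  have hpos : ∀ z ∈ B, 0 < (herm (fderiv ℝ g z 1) (fderiv ℝ g z 1)).re := by
    intro z hz
    obtain ⟨c, hc, h1, -⟩ := Hg.exists_scale hz
    rw [h1]
    exact hc
  -- Even when `β` vanishes at the centre, the factor `c + 2β` is positive there, hence nearby; the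
  -- sign of `β` is preserved nearby only when it is nonzero at the centre.
  have hp0 : 0 < (herm (fderiv ℝ g z₀ 1) (fderiv ℝ g z₀ 1)).re + 2 * (beta g z₀).re := by
    have := hpos z₀ hzB
    rcases hsign with h0 | h0
    · linarith
    · rw [h0]; simpa using this
  have ev1 : ∀ᶠ z in 𝓝 z₀,
      0 < (herm (fderiv ℝ g z 1) (fderiv ℝ g z 1)).re + 2 * (beta g z).re :=
    (hsc.add (hβc.const_mul 2)).eventually (lt_mem_nhds hp0)
  have ev2 : ∀ᶠ z in 𝓝 z₀, (0 < (beta g z₀).re → 0 < (beta g z).re) := by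
    rcases hsign with h0 | h0
    · filter_upwards [hβc.eventually (lt_mem_nhds h0)] with z hz _ using hz
    · exact Filter.Eventually.of_forall fun z hz => by rw [h0] at hz; simp at hz
  obtain ⟨W, hW, hWo, hzW⟩ := eventually_nhds_iff.1 (ev1.and ev2)
  refine ⟨B ∩ W, hB.inter hWo, ⟨hzB, hzW⟩, fun z hz => hrU hz.1, g, Hg.mono fun z hz => hz.1,
    fun z hz => hlift z hz.1, fun z hz => ha z hz.1, fun z hz => (hW z hz.2).1, ?_⟩
  rcases hsign with h0 | h0
  · exact Or.inl fun z hz => (hW z hz.2).2 h0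
  · exact Or.inr h0

lemma fderiv_eq_dz (h : ℂ → Fin 4 → ℂ) (z v : ℂ) :
    fderiv ℝ h z v = v • dz h z + (starRingEnd ℂ) v • dzbar h z := by
  rw [fderiv_eq_re_im (fderiv ℝ h z) v]
  ext i
  simp only [dz, dzbar, Pi.add_apply, Pi.smul_apply, Pi.sub_apply, smul_eq_mul, real_smul]
  have e : v = v.re + v.im * I := (re_add_im v).symm
  have e' : (starRingEnd ℂ) v = v.re - v.im * I := by
    apply Complex.ext <;> simp
  rw [e']
  linear_combination (v.im * fderiv ℝ h z I i) * I_sq -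
    (1 / 2 * (fderiv ℝ h z 1 i - I * fderiv ℝ h z I i)) * e

lemma herm_dz_eq_zero {h : ℂ → Fin 4 → ℂ} {z : ℂ} {p : Fin 4 → ℂ}
    (H : ∀ v, herm (fderiv ℝ h z v) p = 0) : herm (dz h z) p = 0 ∧ herm (dzbar h z) p = 0 := by
  simp [dz, dzbar, herm_smul_left, herm_sub_left, herm_add_left, H]

lemma IsClass.smul {q : CP3} {v : Fin 4 → ℂ} (h : IsClass q v) {a : ℂ} (ha : a ≠ 0) :
    IsClass q (a • v) := by
  obtain ⟨hv, rfl⟩ := h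
  refine ⟨smul_ne_zero ha hv, ?_⟩
  rw [Projectivization.mk_eq_mk_iff']
  exact ⟨a⁻¹, by rw [smul_smul, inv_mul_cancel₀ ha, one_smul]⟩

lemma IsClass.exists_smul {q : CP3} {v w : Fin 4 → ℂ} (h : IsClass q v) (h' : IsClass q w) :
    ∃ a : ℂ, v = a • w := by
  obtain ⟨hv, rfl⟩ := h
  obtain ⟨hw, e⟩ := h'
  obtain ⟨a, ha⟩ := (Projectivization.mk_eq_mk_iff' ℂ _ _ hv hw).1 e
  exact ⟨a, ha.symm⟩

lemma isOpen_dom {M : Type*} [TopologicalSpace M] (φ : OpenPartialHomeomorph M ℂ) {V : Set M}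
    (hV : IsOpen V) : IsOpen (dom φ V) :=
  φ.isOpen_inter_preimage_symm hV

/-! ### Minimal Lagrangian surfaces parametrized by a Riemann surface -/

section RiemannSurface

variable {M : Type*} [TopologicalSpace M] [ChartedSpace ℂ M]

/-- A coordinate change is smooth and conformal. -/
lemma chart_change {φ ψ : OpenPartialHomeomorph M ℂ} (hφ : φ ∈ coords M) (hψ : ψ ∈ coords M)
    {p : M} (hp : p ∈ φ.source) (hp' : p ∈ ψ.source) : ∃ t : ℂ, t ≠ 0 ∧
      ∀ 𝔣 : M → Fin 4 → ℂ, ContDiffAt ℝ ∞ (𝔣 ∘ ψ.symm) (ψ p) →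
        ContDiffAt ℝ ∞ (𝔣 ∘ φ.symm) (φ p) ∧
        ∀ v, fderiv ℝ (𝔣 ∘ φ.symm) (φ p) v = fderiv ℝ (𝔣 ∘ ψ.symm) (ψ p) (t * v) := by
  have smooth : ∀ {φ ψ : OpenPartialHomeomorph M ℂ}, φ ∈ coords M → ψ ∈ coords M →
      p ∈ φ.source → p ∈ ψ.source → ContDiffAt ℂ ω (ψ ∘ φ.symm) (φ p) := by
    intro φ ψ hφ hψ hp hp'
    have h1 := IsManifold.compatible_of_mem_maximalAtlas hφ hψ
    rw [contDiffGroupoid, mem_groupoid_of_pregroupoid] at h1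
    have h2 : ContDiffOn ℂ ω (ψ ∘ φ.symm) (φ.symm.trans ψ).source := by
      simpa [contDiffPregroupoid] using h1.1
    refine h2.contDiffAt ((φ.symm.trans ψ).open_source.mem_nhds ?_)
    simp [hp, hp']
  have s1 := smooth hφ hψ hp hp'
  have s2 := smooth hψ hφ hp' hp
  have d1 := s1.differentiableAt (by simp)
  have d2 := s2.differentiableAt (by simp)
  have ev : ∀ᶠ z in 𝓝 (φ p), z ∈ φ.target ∧ φ.symm z ∈ ψ.source := by
    have := (φ.isOpen_inter_preimage_symm ψ.open_source).mem_nhds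
      (show φ p ∈ φ.target ∩ φ.symm ⁻¹' ψ.source from ⟨φ.map_source hp, by simp [hp, hp']⟩)
    exact this
  have hval : (ψ ∘ φ.symm) (φ p) = ψ p := by simp [hp]
  -- The factor `t` is the complex derivative of the coordinate change; it is nonzero because the
  -- inverse coordinate change is differentiable too.
  refine ⟨deriv (ψ ∘ φ.symm) (φ p), ?_, fun 𝔣 h𝔣 => ?_⟩
  · have hd : HasDerivAt ((φ ∘ ψ.symm) ∘ (ψ ∘ φ.symm)) _ (φ p) :=
      HasDerivAt.comp (φ p) (by rw [hval]; exact d2.hasDerivAt) d1.hasDerivAt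
    have hid : (φ ∘ ψ.symm) ∘ (ψ ∘ φ.symm) =ᶠ[𝓝 (φ p)] id := by
      filter_upwards [ev] with z hz
      simp [hz.1, hz.2]
    have := (hd.congr_of_eventuallyEq hid.symm).unique (hasDerivAt_id (φ p))
    exact right_ne_zero_of_mul_eq_one this
  · have e : 𝔣 ∘ φ.symm =ᶠ[𝓝 (φ p)] (𝔣 ∘ ψ.symm) ∘ (ψ ∘ φ.symm) := by
      filter_upwards [ev] with z hz
      simp [hz.2]
    have s3 : ContDiffAt ℝ ∞ (ψ ∘ φ.symm) (φ p) := (s1.of_le (by simp)).restrict_scalars ℝ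
    rw [← hval] at h𝔣
    refine ⟨(h𝔣.comp (φ p) s3).congr_of_eventuallyEq e, fun v => ?_⟩
    have hd : HasFDerivAt ((𝔣 ∘ ψ.symm) ∘ (ψ ∘ φ.symm)) _ (φ p) :=
      (h𝔣.differentiableAt (by simp)).hasFDerivAt.comp (φ p)
        (d1.hasDerivAt.hasFDerivAt.restrictScalars ℝ)
    rw [e.fderiv_eq, hd.fderiv, hval]
    simp [mul_comm]

variable {f : M → CP3} {𝔣 : M → Fin 4 → ℂ} {V : Set M}

lemma bil_eq_zero_of_mem_Q2star {q : CP3} (hq : q ∈ Q2star) {v : Fin 4 → ℂ} (hv : IsClass q v) :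
    bil v v = 0 := by
  obtain ⟨w, hw, -, h0⟩ := connectedComponentIn_subset _ _ hq
  obtain ⟨a, rfl⟩ := hv.exists_smul hw
  rw [bil_smul_left, bil_smul_right, h0, mul_zero, mul_zero]

lemma IsHorizontalLift.mono (h : IsHorizontalLift V f 𝔣) {W : Set M} (hW : W ⊆ V) :
    IsHorizontalLift W f 𝔣 where
  lift := fun p hp => h.lift p (hW hp)
  unit := fun p hp => h.unit p (hW hp)
  smooth := fun φ hφ => (h.smooth φ hφ).mono fun _ hz => ⟨hz.1, hW hz.2⟩
  horizontal := fun φ hφ _ hz => h.horizontal φ hφ _ ⟨hz.1, hW hz.2⟩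

/-- In a coordinate, a horizontal lift satisfies the equations of `IsHorizontalMinLag`. -/
lemma IsHorizontalLift.isHorizontalMinLag (h : IsHorizontalLift V f 𝔣)
    (hf : IsMinimalLagrangian f) (hV : IsOpen V) {φ : OpenPartialHomeomorph M ℂ}
    (hφ : φ ∈ coords M) : IsHorizontalMinLag (dom φ V) (𝔣 ∘ φ.symm) := by
  have hD := isOpen_dom φ hV
  refine .of_local fun z hz => ?_
  obtain ⟨U, hU, hzU, -, k, hk, hm⟩ := hf.local_lift φ hφ z hz.1
  refine ⟨U ∩ dom φ V, ⟨hzU, hz⟩, ?_⟩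
  have hUD := hU.inter hD
  have hg : ∀ ζ ∈ U ∩ dom φ V, ∃ a : ℂ, 𝔣 (φ.symm ζ) = a • k ζ := fun ζ hζ =>
    (h.lift _ hζ.2.2).exists_smul (hk ζ hζ.1)
  -- The two lifts differ by a scalar, recovered as `-herm 𝔣 k` because `k` has Hermitian square
  -- `-1`. This formula shows that the phase is smooth.
  have hgl : ∀ ζ ∈ U ∩ dom φ V, 𝔣 (φ.symm ζ) = (-herm (𝔣 (φ.symm ζ)) (k ζ)) • k ζ := by
    intro ζ hζ
    obtain ⟨a, ha⟩ := hg ζ hζ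
    rw [ha, herm_smul_left, hm.unit ζ hζ.1]
    simp
  refine (hm.mono Set.inter_subset_left).isHorizontalMinLag hUD
    (l := fun ζ => -herm (𝔣 (φ.symm ζ)) (k ζ)) (fun ζ hζ => ?_) (fun ζ hζ => ?_) hgl ?_
  · exact (ContDiffAt.herm ((h.smooth φ hφ).contDiffAt (hD.mem_nhds hζ.2))
      (hm.contDiffAt hU hζ.1)).neg
  · have h1 := h.unit _ hζ.2.2
    rw [hgl ζ hζ, herm_smul_left, herm_smul_right, hm.unit ζ hζ.1] at h1
    linear_combination -h1
  · intro ζ hζ v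
    obtain ⟨h1, h2⟩ := h.horizontal φ hφ ζ hζ.2
    rw [fderiv_eq_dz, herm_add_left, herm_smul_left, herm_smul_left]
    change v * herm _ (𝔣 (φ.symm ζ)) + _ * herm _ (𝔣 (φ.symm ζ)) = 0
    rw [h1, h2, mul_zero, mul_zero, add_zero]

/-- A horizontal lift of angle `1` gives a pair of maximal surfaces. -/
lemma IsHorizontalLift.isCompanionPair (h : IsHorizontalLift V f 𝔣)
    (hf : IsMinimalLagrangian f) (hV : IsOpen V)
    (ha : ∀ φ ∈ coords M, ∀ z ∈ dom φ V, angle (𝔣 ∘ φ.symm) z = 1)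
    (hpos : ∀ φ ∈ coords M, ∀ z ∈ dom φ V,
      0 < (herm (fderiv ℝ (𝔣 ∘ φ.symm) z 1) (fderiv ℝ (𝔣 ∘ φ.symm) z 1)).re +
        2 * (beta (𝔣 ∘ φ.symm) z).re) :
    IsCompanionPair V f 𝔣 (realPart 𝔣) (imagPart 𝔣) := by
  have s2 : ((√2 : ℝ) : ℂ) ≠ 0 := by
    exact_mod_cast Real.sqrt_ne_zero'.2 (by norm_num : (0 : ℝ) < 2)
  refine ⟨fun p hp => ?_, fun p hp => ?_, fun p hp => ?_, fun φ hφ => ?_, fun W hW hWV hα φ hφ => ?_,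
    fun φ hφ z hz => ?_, fun φ hφ z hz => ?_⟩
  · exact mem_T1minus_of_null (h.unit p hp) (bil_eq_zero_of_mem_Q2star (hf.mem p) (h.lift p hp))
  · rw [cvec_realPart_imagPart, smul_smul, ← ofReal_mul, one_div,
      inv_mul_cancel₀ (by exact_mod_cast s2), ofReal_one, one_smul]
  · rw [cvec_realPart_imagPart]
    exact (h.lift p hp).smul s2
  · exact (h.isHorizontalMinLag hf hV hφ).isMaximalCoord_realPart (isOpen_dom φ hV) (ha φ hφ)
      (hpos φ hφ)
  · exact ((h.mono hWV).isHorizontalMinLag hf hW hφ).isMaximalCoord_imagPart (isOpen_dom φ hW)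
      (fun z hz => ha φ hφ z ⟨hz.1, hWV hz.2⟩) (hα φ hφ)
  · exact (h.isHorizontalMinLag hf hV hφ).hopf_realPart (isOpen_dom φ hV) hz (ha φ hφ z hz)
  · exact (h.isHorizontalMinLag hf hV hφ).hopf_imagPart (isOpen_dom φ hV) hz (ha φ hφ z hz)

lemma IsHorizontalLift.companion_metrics (h : IsHorizontalLift V f 𝔣)
    (hf : IsMinimalLagrangian f) (hV : IsOpen V)
    {φ : OpenPartialHomeomorph M ℂ} (hφ : φ ∈ coords M) {z : ℂ} (hz : z ∈ dom φ V)
    (ha : angle (𝔣 ∘ φ.symm) z = 1) {b : ℝ} (hb : beta (𝔣 ∘ φ.symm) z = b) {u : ℝ}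
    (hu : IsConformalForm (lagMetric (𝔣 ∘ φ.symm) z) (2 * Real.exp u)) :
    b ^ 2 = Real.exp (2 * u) - ‖alpha (𝔣 ∘ φ.symm) z‖ ^ 2 ∧
      IsConformalForm (inducedForm (realPart 𝔣 ∘ φ.symm) z) (2 * (Real.exp u + b)) ∧
      IsConformalForm (inducedForm (imagPart 𝔣 ∘ φ.symm) z) (2 * (Real.exp u - b)) := by
  have H := h.isHorizontalMinLag hf hV hφ
  obtain ⟨h1, h2, h3⟩ := H.isConformalForm_parts (isOpen_dom φ hV) hz ha
    (H.scale_eq_of_lagMetric (isOpen_dom φ hV) hz hu) hb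
  rw [mul_add, mul_sub]
  refine ⟨?_, h1, h2⟩
  rw [h3, two_mul u, Real.exp_add]
  ring

lemma IsHorizontalLift.change_coordinates (h : IsHorizontalLift V f 𝔣)
    (hf : IsMinimalLagrangian f) (hV : IsOpen V) {φ ψ : OpenPartialHomeomorph M ℂ}
    (hφ : φ ∈ coords M) (hψ : ψ ∈ coords M) {p : M} (hpV : p ∈ V) (hp : p ∈ φ.source)
    (hp' : p ∈ ψ.source) : angle (𝔣 ∘ φ.symm) (φ p) = angle (𝔣 ∘ ψ.symm) (ψ p) := by
  obtain ⟨t, ht, H⟩ := chart_change hφ hψ hp hp'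
  have hz : ψ p ∈ dom ψ V := ⟨ψ.map_source hp', by simpa [hp'] using hpV⟩
  have Hψ := h.isHorizontalMinLag hf hV hψ
  exact (Hψ.change_coordinates hz ht (H 𝔣 (Hψ.smooth _ hz)).2).2.2

/-- A horizontal lift over a connected set whose angle is `1` at one point has angle `1`. -/
lemma IsHorizontalLift.angle_eq_one [IsManifold 𝓘(ℂ) ω M] (h : IsHorizontalLift V f 𝔣)
    (hf : IsMinimalLagrangian f) (hV : IsOpen V) (hc : IsPreconnected V)
    {φ₀ : OpenPartialHomeomorph M ℂ} (hφ₀ : φ₀ ∈ coords M) {z₀ : ℂ} (hz₀ : z₀ ∈ dom φ₀ V)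
    (h0 : angle (𝔣 ∘ φ₀.symm) z₀ = 1) {φ : OpenPartialHomeomorph M ℂ} (hφ : φ ∈ coords M)
    {z : ℂ} (hz : z ∈ dom φ V) : angle (𝔣 ∘ φ.symm) z = 1 := by
  -- The angle does not depend on the coordinate, so it is a function on `V`. It is locally
  -- constant, and the sets where it is and is not `1` separate `V`.
  let Θ : M → ℂ := fun p => angle (𝔣 ∘ (chartAt ℂ p).symm) (chartAt ℂ p p)
  have hΘ : ∀ φ ∈ coords M, ∀ p ∈ V, p ∈ φ.source → angle (𝔣 ∘ φ.symm) (φ p) = Θ p :=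
    fun φ hφ p hp hpφ => h.change_coordinates hf hV hφ
      (IsManifold.chart_mem_maximalAtlas p) hp hpφ (mem_chart_source ℂ p)
  have hopen : ∀ T : Set ℂ, IsOpen (V ∩ Θ ⁻¹' T) := by
    intro T
    rw [isOpen_iff_mem_nhds]
    intro p hp
    have hψ : chartAt ℂ p ∈ coords M := IsManifold.chart_mem_maximalAtlas p
    set ψ := chartAt ℂ p
    have ho := ψ.isOpen_inter_preimage
      ((h.isHorizontalMinLag hf hV hψ).isOpen_inter_angle (isOpen_dom ψ hV) T)
    have hpψ : p ∈ ψ.source := mem_chart_source ℂ p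
    refine Filter.mem_of_superset (ho.mem_nhds ⟨hpψ, ⟨ψ.map_source hpψ, ?_⟩, hp.2⟩) ?_
    · simpa [hpψ] using hp.1
    · rintro q ⟨hq, ⟨-, hq2⟩, hq3⟩
      have hqV : q ∈ V := by simpa [hq] using hq2
      refine ⟨hqV, ?_⟩
      change Θ q ∈ T
      rw [← hΘ ψ hψ q hqV hq]
      exact hq3
  have hp0 : φ₀.symm z₀ ∈ φ₀.source := φ₀.map_target hz₀.1
  have hsub := IsPreconnected.subset_left_of_subset_union (hopen {1}) (hopen {1}ᶜ)
    (Set.disjoint_left.2 fun x hx hx' => hx'.2 hx.2)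
    (fun x hx => by
      by_cases hx1 : Θ x = 1
      · exact Or.inl ⟨hx, hx1⟩
      · exact Or.inr ⟨hx, hx1⟩)
    ⟨φ₀.symm z₀, hz₀.2, hz₀.2, by
      change Θ _ = 1
      rw [← hΘ φ₀ hφ₀ _ hz₀.2 hp0, φ₀.right_inv hz₀.1, h0]⟩ hc
  have := hΘ φ hφ _ hz.2 (φ.map_target hz.1)
  rw [φ.right_inv hz.1] at this
  rw [this]
  exact (hsub hz.2).2

/-- The pair of maximal surfaces of a normalized horizontal lift. -/
theorem IsMinimalLagrangian.companion_of_normalized [IsManifold 𝓘(ℂ) ω M]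
    (hf : IsMinimalLagrangian f) (hV : IsOpen V) (hc : IsPreconnected V)
    (h : IsHorizontalLift V f 𝔣)
    (hβ : ∀ φ ∈ coords M, ∀ z ∈ dom φ V,
      (beta (𝔣 ∘ φ.symm) z).im = 0 ∧ 0 ≤ (beta (𝔣 ∘ φ.symm) z).re)
    (hne : ∃ φ ∈ coords M, ∃ z ∈ dom φ V, beta (𝔣 ∘ φ.symm) z ≠ 0) :
    ∃ F N : M → Fin 4 → ℝ, IsCompanionPair V f 𝔣 F N ∧
      ∀ φ ∈ coords M, DifferentiableOn ℂ (alpha (𝔣 ∘ φ.symm)) (dom φ V) ∧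
        ∀ z ∈ dom φ V, ∀ u : ℝ,
          IsConformalForm (lagMetric (𝔣 ∘ φ.symm) z) (2 * Real.exp u) →
          IsConformalForm (inducedForm (F ∘ φ.symm) z)
            (2 * (Real.exp u + Real.sqrt (Real.exp (2 * u) - ‖alpha (𝔣 ∘ φ.symm) z‖ ^ 2))) ∧
          IsConformalForm (inducedForm (N ∘ φ.symm) z)
            (2 * (Real.exp u - Real.sqrt (Real.exp (2 * u) - ‖alpha (𝔣 ∘ φ.symm) z‖ ^ 2))) := by
  obtain ⟨φ₀, hφ₀, z₀, hz₀, hne⟩ := hne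
  have H := fun φ hφ => h.isHorizontalMinLag hf hV (φ := φ) hφ
  have h0 := (H φ₀ hφ₀).angle_eq_one (isOpen_dom φ₀ hV) hz₀ (hβ φ₀ hφ₀ z₀ hz₀).1 hne
  have ha : ∀ φ ∈ coords M, ∀ z ∈ dom φ V, angle (𝔣 ∘ φ.symm) z = 1 := fun φ hφ z hz =>
    h.angle_eq_one hf hV hc hφ₀ hz₀ h0 hφ hz
  refine ⟨realPart 𝔣, imagPart 𝔣, h.isCompanionPair hf hV ha fun φ hφ z hz => ?_,
    fun φ hφ => ⟨fun z hz => ?_, fun z hz u hu => ?_⟩⟩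
  -- Here `c > 0` and `β ≥ 0`, so `c + 2β > 0` even at the zeros of `β`.
  · obtain ⟨c, hc, h1, -⟩ := (H φ hφ).exists_scale hz
    rw [h1, ofReal_re]
    linarith [(hβ φ hφ z hz).2]
  · exact ((H φ hφ).differentiableAt_alpha (isOpen_dom φ hV) hz).differentiableWithinAt
  · obtain ⟨b1, b2⟩ := hβ φ hφ z hz
    have hb : beta (𝔣 ∘ φ.symm) z = ((beta (𝔣 ∘ φ.symm) z).re : ℝ) :=
      Complex.ext rfl (by rw [b1, ofReal_im])
    obtain ⟨h1, h2⟩ := h.companion_metrics hf hV hφ hz (ha φ hφ z hz) hb hu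
    rw [← h1, Real.sqrt_sq b2]
    exact h2

/-- Locally, a minimal Lagrangian surface has a pair of companion maximal surfaces. -/
theorem IsMinimalLagrangian.exists_local_companion [IsManifold 𝓘(ℂ) ω M]
    (hf : IsMinimalLagrangian f) (p : M) :
    ∃ (V : Set M) (𝔣 : M → Fin 4 → ℂ), IsOpen V ∧ p ∈ V ∧ IsHorizontalLift V f 𝔣 ∧
      ((∀ φ ∈ coords M, ∀ z ∈ dom φ V, 0 < (beta (𝔣 ∘ φ.symm) z).re) ∨
        (∀ φ ∈ coords M, p ∈ φ.source → beta (𝔣 ∘ φ.symm) (φ p) = 0)) ∧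
      ∃ F N : M → Fin 4 → ℝ, IsCompanionPair V f 𝔣 F N ∧
        ∀ φ ∈ coords M, DifferentiableOn ℂ (alpha (𝔣 ∘ φ.symm)) (dom φ V) ∧
          ∀ z ∈ dom φ V, ∃ b : ℝ, beta (𝔣 ∘ φ.symm) z = (b : ℂ) ∧ ∀ u : ℝ,
            IsConformalForm (lagMetric (𝔣 ∘ φ.symm) z) (2 * Real.exp u) →
            b ^ 2 = Real.exp (2 * u) - ‖alpha (𝔣 ∘ φ.symm) z‖ ^ 2 ∧
            IsConformalForm (inducedForm (F ∘ φ.symm) z) (2 * (Real.exp u + b)) ∧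
            IsConformalForm (inducedForm (N ∘ φ.symm) z) (2 * (Real.exp u - b)) := by
  have hψ : chartAt ℂ p ∈ coords M := IsManifold.chart_mem_maximalAtlas p
  have hpψ : p ∈ (chartAt ℂ p).source := mem_chart_source ℂ p
  set ψ := chartAt ℂ p with hψd
  obtain ⟨U, hU, hzU, hUψ, k, hk, hm⟩ := hf.local_lift ψ hψ (ψ p) (ψ.map_source hpψ)
  obtain ⟨B, hB, hpB, hBU, g, Hg, hlift, hang, hpos, hsign⟩ := hm.exists_normalized hU hzU
  have e𝔣 : ∀ z ∈ B, (g ∘ ψ) ∘ ψ.symm =ᶠ[𝓝 z] g := fun z hz =>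
    Filter.mem_of_superset (hB.mem_nhds hz) fun ζ hζ => by
      simp [ψ.right_inv (hUψ (hBU hζ))]
  have hVo : IsOpen (ψ.source ∩ ψ ⁻¹' B) := ψ.isOpen_inter_preimage hB
  set V := ψ.source ∩ ψ ⁻¹' B with hVd
  -- The lift is built in the single chart `ψ`; every other coordinate sees it through a conformal
  -- change, which rescales `c` and `β` by one positive factor and fixes the angle.
  have key : ∀ φ ∈ coords M, ∀ z ∈ dom φ V, ∃ t : ℂ, t ≠ 0 ∧
      ContDiffAt ℝ ∞ ((g ∘ ψ) ∘ φ.symm) z ∧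
      ∀ v, fderiv ℝ ((g ∘ ψ) ∘ φ.symm) z v = fderiv ℝ g (ψ (φ.symm z)) (t * v) := by
    intro φ hφ z hz
    obtain ⟨t, ht, H⟩ := chart_change hφ hψ (φ.map_target hz.1) hz.2.1
    have e := e𝔣 _ hz.2.2
    obtain ⟨H1, H2⟩ := H (g ∘ ψ) ((Hg.smooth _ hz.2.2).congr_of_eventuallyEq e)
    rw [φ.right_inv hz.1] at H1 H2
    exact ⟨t, ht, H1, fun v => by rw [H2, e.fderiv_eq]⟩
  have hinv : ∀ φ ∈ coords M, ∀ z ∈ dom φ V, ∃ s : ℝ, 0 < s ∧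
      herm (fderiv ℝ ((g ∘ ψ) ∘ φ.symm) z 1) (fderiv ℝ ((g ∘ ψ) ∘ φ.symm) z 1) =
        s * herm (fderiv ℝ g (ψ (φ.symm z)) 1) (fderiv ℝ g (ψ (φ.symm z)) 1) ∧
      beta ((g ∘ ψ) ∘ φ.symm) z = s * beta g (ψ (φ.symm z)) ∧
      angle ((g ∘ ψ) ∘ φ.symm) z = 1 := by
    intro φ hφ z hz
    obtain ⟨t, ht, -, H⟩ := key φ hφ z hz
    obtain ⟨h1, h2, h3⟩ := Hg.change_coordinates hz.2.2 ht H
    exact ⟨_, normSq_pos.2 ht, h1, h2, h3.trans (hang _ hz.2.2)⟩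
  have hL : IsHorizontalLift V f (g ∘ ψ) := by
    refine ⟨fun q hq => ?_, fun q hq => Hg.unit _ hq.2, fun φ hφ z hz => ?_,
      fun φ hφ z hz => herm_dz_eq_zero fun v => ?_⟩
    · obtain ⟨a, ha, e⟩ := hlift _ hq.2
      have := hk _ (hBU hq.2)
      rw [ψ.left_inv hq.1] at this
      change IsClass _ (g (ψ q))
      rw [e]
      exact this.smul ha
    · obtain ⟨t, -, H, -⟩ := key φ hφ z hz
      exact H.contDiffWithinAt
    · obtain ⟨t, -, -, H⟩ := key φ hφ z hz
      rw [H]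
      exact Hg.horizontal _ hz.2.2 _
  have ha : ∀ φ ∈ coords M, ∀ z ∈ dom φ V, angle ((g ∘ ψ) ∘ φ.symm) z = 1 := fun φ hφ z hz => by
    obtain ⟨s, -, -, -, h⟩ := hinv φ hφ z hz
    exact h
  refine ⟨V, g ∘ ψ, hVo, ⟨hpψ, hpB⟩, hL, ?_, realPart (g ∘ ψ), imagPart (g ∘ ψ),
    hL.isCompanionPair hf hVo ha fun φ hφ z hz => ?_, fun φ hφ => ⟨fun z hz => ?_, fun z hz => ?_⟩⟩
  · refine hsign.imp (fun hs φ hφ z hz => ?_) fun hs φ hφ hpφ => ?_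
    · obtain ⟨s, hs0, -, h, -⟩ := hinv φ hφ z hz
      rw [h, re_ofReal_mul]
      exact mul_pos hs0 (hs _ hz.2.2)
    · have hz : φ p ∈ dom φ V := ⟨φ.map_source hpφ, by
        rw [Set.mem_preimage, φ.left_inv hpφ]; exact ⟨hpψ, hpB⟩⟩
      obtain ⟨s, -, -, h, -⟩ := hinv φ hφ _ hz
      rw [h, φ.left_inv hpφ, hs, mul_zero]
  · obtain ⟨s, hs0, h1, h2, -⟩ := hinv φ hφ z hz
    rw [h1, h2, re_ofReal_mul, re_ofReal_mul]
    nlinarith [mul_pos hs0 (hpos _ hz.2.2)]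
  · exact ((hL.isHorizontalMinLag hf hVo hφ).differentiableAt_alpha
      (isOpen_dom φ hVo) hz).differentiableWithinAt
  · obtain ⟨c, r, s, t, -, -, -, -, -, -, -, -, -, -, hb⟩ :=
      (hL.isHorizontalMinLag hf hVo hφ).exists_real_coefficients (isOpen_dom φ hVo) hz
        (ha φ hφ z hz)
    exact ⟨r / 2, hb, fun u hu => hL.companion_metrics hf hVo hφ hz (ha φ hφ z hz) hb hu⟩

end RiemannSurface

/-! ### Time orientation and the component `Q2star` -/

section Orientation

/-- Lagrange's identity in the negative and in the positive coordinate plane shows that the square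
of this determinant is at least `1`. -/
lemma orientation_ne_zero {p v : Fin 4 → ℝ} (h : (p, v) ∈ T1minus) :
    p 0 * v 1 - p 1 * v 0 ≠ 0 := by
  obtain ⟨h1, h2, h3⟩ := h
  change bil p p = -1 at h1
  simp only [bil] at h1 h2 h3
  have key : (p 0 * v 1 - p 1 * v 0) ^ 2 = 1 + (p 2 ^ 2 + p 3 ^ 2) + (v 2 ^ 2 + v 3 ^ 2) +
      (p 2 * v 3 - p 3 * v 2) ^ 2 := by
    have e1 : p 0 ^ 2 + p 1 ^ 2 = 1 + (p 2 ^ 2 + p 3 ^ 2) := by linarith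
    have e2 : v 0 ^ 2 + v 1 ^ 2 = 1 + (v 2 ^ 2 + v 3 ^ 2) := by linarith
    have e3 : p 0 * v 0 + p 1 * v 1 = p 2 * v 2 + p 3 * v 3 := by linarith
    calc (p 0 * v 1 - p 1 * v 0) ^ 2 = (p 0 ^ 2 + p 1 ^ 2) * (v 0 ^ 2 + v 1 ^ 2) -
          (p 0 * v 0 + p 1 * v 1) ^ 2 := by ring
      _ = _ := by rw [e1, e2, e3]; ring
  intro h0
  rw [h0] at key
  nlinarith [sq_nonneg (p 2), sq_nonneg (p 3), sq_nonneg (v 2), sq_nonneg (v 3),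
    sq_nonneg (p 2 * v 3 - p 3 * v 2)]

lemma herm_self_re (w : Fin 4 → ℂ) :
    (herm w w).re = -‖w 0‖ ^ 2 - ‖w 1‖ ^ 2 + ‖w 2‖ ^ 2 + ‖w 3‖ ^ 2 := by
  simp only [← normSq_eq_norm_sq, normSq_apply]
  simp [herm, bil, conj4]

/-- A null vector of negative type that is positively oriented lies over `Q2star`. -/
lemma mem_Q2star {q : CP3} {v : Fin 4 → ℂ} (hq : IsClass q v) (h0 : bil v v = 0)
    (hneg : (herm v v).re < 0) (hor : ‖v 0 + I * v 1‖ < ‖v 0 - I * v 1‖) : q ∈ Q2star := by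
  set P := v 0 + I * v 1 with hP
  set Q := v 0 - I * v 1 with hQ
  have hQ0 : Q ≠ 0 := norm_pos_iff.1 ((norm_nonneg P).trans_lt hor)
  have hPQ : P * Q = v 2 ^ 2 + v 3 ^ 2 := by
    simp only [bil] at h0
    rw [hP, hQ]
    linear_combination -h0 - v 1 ^ 2 * I_sq
  -- In the coordinates `P, Q` nullity reads `P Q = v₂² + v₃²`. Scaling `P` by `s²` and `v₂, v₃` by
  -- `s` preserves it, and at `s = 0` only `Q` remains, which gives a multiple of the base vector.
  let γ : ℝ → Fin 4 → ℂ := fun s =>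
    ![((s : ℂ) ^ 2 * P + Q) / 2, -I * ((s : ℂ) ^ 2 * P - Q) / 2, s * v 2, s * v 3]
  have hγ0 : ∀ s, γ s ≠ 0 := by
    intro s hs
    have e0 := congrFun hs 0
    have e1 := congrFun hs 1
    simp only [γ, Matrix.cons_val_zero, Matrix.cons_val_one, Pi.zero_apply] at e0 e1
    apply hQ0
    linear_combination e0 - I * e1 + ((s : ℂ) ^ 2 * P - Q) / 2 * (-I_sq)
  have hγbil : ∀ s, bil (γ s) (γ s) = 0 := by
    intro s
    simp only [γ, bil, Matrix.cons_val_zero, Matrix.cons_val_one, Matrix.cons_val]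
    linear_combination (-(s : ℂ) ^ 2) * hPQ - ((s : ℂ) ^ 2 * P - Q) ^ 2 / 4 * I_sq
  have hE : ‖P‖ * ‖Q‖ ≤ ‖v 2‖ ^ 2 + ‖v 3‖ ^ 2 := by
    rw [← norm_mul, hPQ, ← norm_pow, ← norm_pow]
    exact norm_add_le _ _
  have hherm : ∀ s : ℝ, (herm (γ s) (γ s)).re = -(s ^ 4 * ‖P‖ ^ 2 + ‖Q‖ ^ 2) / 2 +
      s ^ 2 * (‖v 2‖ ^ 2 + ‖v 3‖ ^ 2) := by
    intro s
    rw [herm_self_re]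
    simp only [γ, Matrix.cons_val_zero, Matrix.cons_val_one, Matrix.cons_val,
      ← normSq_eq_norm_sq, normSq_div, normSq_mul, normSq_neg, normSq_I, normSq_add, normSq_sub,
      normSq_ofReal, map_pow, normSq_ofNat]
    ring
  have hherm1 : (herm v v).re = -(‖P‖ ^ 2 + ‖Q‖ ^ 2) / 2 + (‖v 2‖ ^ 2 + ‖v 3‖ ^ 2) := by
    simp only [← normSq_eq_norm_sq, normSq_apply]
    simp only [herm, bil, conj4, hP, hQ]
    simp
    ring
  have hγneg : ∀ s ∈ Set.Icc (0 : ℝ) 1, (herm (γ s) (γ s)).re < 0 := by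
    rintro s ⟨hs0, hs1⟩
    rw [hherm]
    rw [hherm1] at hneg
    have hs2 : s ^ 2 ≤ 1 := pow_le_one₀ hs0 hs1
    -- With `E = ‖v₂‖² + ‖v₃‖²`, the inequality `‖P‖ < ‖Q‖` gives `‖P‖² ≤ ‖P‖‖Q‖ ≤ E`. The Hermitian
    -- square at `s` is that of `v` minus `(1 - s²)(E - ‖P‖²) + (1 - s²)²‖P‖²/2`, hence negative.
    have hPE : ‖P‖ ^ 2 ≤ ‖v 2‖ ^ 2 + ‖v 3‖ ^ 2 := by
      nlinarith [norm_nonneg P]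
    nlinarith [mul_nonneg (sub_nonneg.2 hs2) (sub_nonneg.2 hPE),
      mul_nonneg (mul_nonneg (sub_nonneg.2 hs2) (sub_nonneg.2 hs2)) (sq_nonneg ‖P‖)]
  have hγc : Continuous fun s => Projectivization.mk ℂ (γ s) (hγ0 s) := by
    have hc : Continuous γ := by
      refine continuous_pi fun i => ?_
      fin_cases i <;> simp only [γ] <;> simp <;> fun_prop
    have h1 : Continuous (Projectivization.mk' ℂ : {w : Fin 4 → ℂ // w ≠ 0} → CP3) :=
      continuous_coinduced_rng
    exact h1.comp (hc.subtype_mk hγ0)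
  have hbase : Projectivization.mk ℂ (γ 0) (hγ0 0) =
      Projectivization.mk ℂ ![1, Complex.I, 0, 0] base_ne_zero := by
    rw [Projectivization.mk_eq_mk_iff']
    refine ⟨Q / 2, ?_⟩
    ext i
    fin_cases i <;> simp [γ] <;> ring
  have hend : Projectivization.mk ℂ (γ 1) (hγ0 1) = q := by
    obtain ⟨hv, rfl⟩ := hq
    rw [Projectivization.mk_eq_mk_iff']
    refine ⟨1, ?_⟩
    ext i
    fin_cases i
    · simp [γ, hP, hQ]
    · simp only [γ, hP, hQ]
      simp
      linear_combination v 1 * I_sq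
    · simp [γ]
    · simp [γ]
  have hpre := isPreconnected_Icc (a := (0 : ℝ)) (b := 1) |>.image _ hγc.continuousOn
  refine hpre.subset_connectedComponentIn ⟨0, by simp, hbase⟩ ?_ ⟨1, by simp, hend⟩
  rintro _ ⟨s, hs, rfl⟩
  exact ⟨γ s, ⟨hγ0 s, rfl⟩, hγneg s hs, hγbil s⟩

end Orientation

/-! ### The lift `(F + iN)/√2` and the converse for horizontal lifts -/

section Lift

/-- The vector `(x + i y) / √2`, as a real-linear map. -/
def liftL : (Fin 4 → ℝ) × (Fin 4 → ℝ) →L[ℝ] (Fin 4 → ℂ) :=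
  (1 / √2 : ℝ) • (toCL.comp (.fst ℝ _ _) + I • toCL.comp (.snd ℝ _ _))

lemma liftL_apply (x y : Fin 4 → ℝ) : liftL (x, y) = ((1 / √2 : ℝ) : ℂ) • cvec x y := by
  rw [coe_smul]
  simp [liftL, cvec]

lemma inv_sqrt_two_sq : ((1 / √2 : ℝ) : ℂ) * ((1 / √2 : ℝ) : ℂ) = 1 / 2 := by
  have : (1 / √2) * (1 / √2) = 1 / 2 := by
    rw [div_mul_div_comm, Real.mul_self_sqrt (by norm_num), one_mul]
  rw [← ofReal_mul, this]
  norm_num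

lemma herm_liftL (a b c d : Fin 4 → ℝ) : herm (liftL (a, b)) (liftL (c, d)) =
    ((bil a c + bil b d : ℝ) + I * (bil b c - bil a d : ℝ)) / 2 := by
  rw [liftL_apply, liftL_apply, herm_smul_left, herm_smul_right, conj_ofReal, ← mul_assoc,
    inv_sqrt_two_sq]
  apply Complex.ext
  · simp [herm, bil, conj4, cvec, toC]
    ring
  · simp [herm, bil, conj4, cvec, toC]
    ring

lemma bil_liftL (a b c d : Fin 4 → ℝ) : bil (liftL (a, b)) (liftL (c, d)) =
    ((bil a c - bil b d : ℝ) + I * (bil a d + bil b c : ℝ)) / 2 := by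
  rw [liftL_apply, liftL_apply, bil_smul_left, bil_smul_right, ← mul_assoc, inv_sqrt_two_sq]
  apply Complex.ext
  · simp [bil, cvec, toC]
    ring
  · simp [bil, cvec, toC]
    ring

lemma fderiv_liftL {F N : ℂ → Fin 4 → ℝ} {z : ℂ} (hF : DifferentiableAt ℝ F z)
    (hN : DifferentiableAt ℝ N z) (v : ℂ) :
    fderiv ℝ (fun ζ => liftL (F ζ, N ζ)) z v = liftL (fderiv ℝ F z v, fderiv ℝ N z v) := by
  rw [fderiv_clm_comp liftL (hF.prodMk hN), (hF.hasFDerivAt.prodMk hN.hasFDerivAt).fderiv]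
  rfl

end Lift

namespace IsHorizontalMinLag

variable {U : Set ℂ} {f : ℂ → Fin 4 → ℂ} {z : ℂ}

/-- The projected Laplacian lies in the complex span of the two tangent vectors and is
Hermitian-orthogonal to both. -/
lemma horProj_laplacian (h : IsHorizontalMinLag U f) (hU : IsOpen U) (hz : z ∈ U) :
    horProj (f z) (d2 f z 1 1) + horProj (f z) (d2 f z I I) = 0 := by
  have e : horProj (f z) (d2 f z 1 1) + horProj (f z) (d2 f z I I) =
      horProj (f z) (d2 f z 1 1 + d2 f z I I) := by
    simp only [horProj, herm_add_left, add_smul]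
    abel
  have h1 := h.unit z hz
  have h2 := h.null z hz
  have key := h.frame hU hz (W := horProj (f z) (d2 f z 1 1 + d2 f z I I))
    (by
      rw [horProj, herm_add_left, herm_add_left, herm_smul_left, herm_smul_left, herm_conj4_left,
        h1, h2, map_zero]
      ring)
    (by
      have h3 : bil (conj4 (f z)) (f z) = -1 := (bil_comm _ _).trans h1
      rw [horProj, bil_add_left, bil_add_left, bil_smul_left, bil_smul_left, h2, h3,
        herm_conj4_right]
      ring)
  have h3 := fun v => herm_horProj_left (w := d2 f z 1 1 + d2 f z I I)
    (h.horizontal z hz v) (h.bil_fderiv_self hU hz v)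
  rw [h3, h3, h.harmonic z hz, h.harmonic z hz] at key
  rw [e, key]
  simp

lemma isMinLagCoord (h : IsHorizontalMinLag U f) (hU : IsOpen U) : IsMinLagCoord U f where
  smooth := fun z hz => (h.smooth z hz).contDiffWithinAt
  unit := h.unit
  null := h.null
  immersion := by
    intro z hz
    obtain ⟨c, hc, H⟩ := h.conformal z hz
    refine ⟨c, hc, fun v w => ?_⟩
    rw [lagMetric, h.horDeriv_eq hU hz, h.horDeriv_eq hU hz, H, ofReal_re]
  lagrangian := by
    intro z hz v w
    obtain ⟨c, hc, H⟩ := h.conformal z hz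
    rw [kahlerForm, h.horDeriv_eq hU hz, h.horDeriv_eq hU hz, H, ofReal_im, neg_zero]
  minimal := by
    intro z hz
    have e : ∀ v w, covDeriv f (fun ζ => horDeriv f ζ w) z v = horProj (f z) (d2 f z v w) := by
      intro v w
      have : (fun ζ => horDeriv f ζ w) =ᶠ[𝓝 z] fun ζ => fderiv ℝ f ζ w :=
        Filter.mem_of_superset (hU.mem_nhds hz) fun ζ hζ => h.horDeriv_eq hU hζ w
      rw [covDeriv, this.fderiv_eq, h.horizontal z hz, zero_smul, add_zero]
      rfl
    have hadd : ∀ X Y W W' : Fin 4 → ℂ,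
        normalPart X Y W + normalPart X Y W' = normalPart X Y (W + W') := by
      intro X Y W W'
      simp only [normalPart, herm_add_left, add_re, add_div, add_smul]
      abel
    rw [lagMeanCurvature, lagSecondForm, lagSecondForm, e, e, hadd, h.horProj_laplacian hU hz]
    simp [normalPart]

end IsHorizontalMinLag

/-! ### Structure equations of maximal surfaces and their lifts -/

namespace IsMaximalCoord

variable {U : Set ℂ} {F N : ℂ → Fin 4 → ℝ} {z : ℂ}

lemma isNormalPair (h : IsMaximalCoord U F N) (hU : IsOpen U) : IsNormalPair U F N :=
  ⟨fun _ hz => h.smooth_F.contDiffAt (hU.mem_nhds hz),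
    fun _ hz => h.smooth_N.contDiffAt (hU.mem_nhds hz), h.mem_bundle, h.normal⟩

lemma trace_eq_zero (h : IsMaximalCoord U F N) (hU : IsOpen U) (hz : z ∈ U) :
    bil (fderiv ℝ F z 1) (fderiv ℝ N z 1) + bil (fderiv ℝ F z I) (fderiv ℝ N z I) = 0 := by
  obtain ⟨k, hk, hc⟩ := h.spacelike z hz
  have h1 : secondForm F N z 1 1 = _ := (h.isNormalPair hU).bil_d2 hU hz 1 1
  have h2 : secondForm F N z I I = _ := (h.isNormalPair hU).bil_d2 hU hz I I
  have := h.maximal z hz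
  rw [meanCurvature, h1, h2, inducedForm, hc.values.1, div_eq_zero_iff] at this
  rcases this with this | this
  · linarith
  · linarith

lemma mixed_symm (h : IsMaximalCoord U F N) (hU : IsOpen U) (hz : z ∈ U) :
    bil (fderiv ℝ F z I) (fderiv ℝ N z 1) = bil (fderiv ℝ F z 1) (fderiv ℝ N z I) := by
  have h1 := (h.isNormalPair hU).bil_d2 hU hz 1 I
  have h2 := (h.isNormalPair hU).bil_d2 hU hz I 1
  rw [d2_symm ((h.isNormalPair hU).smooth_F z hz)] at h1
  linarith

lemma fderiv_bil_eq_zero (h : IsMaximalCoord U F N) (hU : IsOpen U) (hz : z ∈ U) (v : ℂ) :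
    bil (fderiv ℝ F z v) (F z) = 0 ∧ bil (fderiv ℝ N z v) (N z) = 0 ∧
      bil (fderiv ℝ N z v) (F z) = 0 := by
  have hp := h.isNormalPair hU
  have dF := (hp.smooth_F z hz).differentiableAt (n := ∞) (by simp)
  have dN := (hp.smooth_N z hz).differentiableAt (n := ∞) (by simp)
  have e1 := bil_fderiv_of_eventually_const dF dF (k := -1)
    (Filter.mem_of_superset (hU.mem_nhds hz) fun ζ hζ => (h.mem_bundle ζ hζ).1) v
  have e2 := bil_fderiv_of_eventually_const dN dN (k := -1)
    (Filter.mem_of_superset (hU.mem_nhds hz) fun ζ hζ => (h.mem_bundle ζ hζ).2.2) v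
  have e3 := bil_fderiv_of_eventually_const dF dN (k := 0)
    (Filter.mem_of_superset (hU.mem_nhds hz) fun ζ hζ => (h.mem_bundle ζ hζ).2.1) v
  rw [bil_comm (F z)] at e1
  rw [bil_comm (N z)] at e2
  rw [bil_comm (F z), h.normal z hz] at e3
  refine ⟨by linarith, by linarith, by linarith⟩

/-- The Weingarten equation. -/
lemma weingarten (h : IsMaximalCoord U F N) (hU : IsOpen U) (hz : z ∈ U) {k : ℝ} (hk : 0 < k)
    (hc : IsConformalForm (inducedForm F z) k) (v : ℂ) : fderiv ℝ N z v =
      (bil (fderiv ℝ F z 1) (fderiv ℝ N z v) / k) • fderiv ℝ F z 1 +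
      (bil (fderiv ℝ F z I) (fderiv ℝ N z v) / k) • fderiv ℝ F z I := by
  obtain ⟨c1, c2, c3⟩ := hc.values
  obtain ⟨b1, b2, b3⟩ := h.mem_bundle z hz
  change bil (F z) (F z) = -1 at b1
  change bil (F z) (N z) = 0 at b2
  change bil (N z) (N z) = -1 at b3
  have hF := fun v => (h.fderiv_bil_eq_zero hU hz v).1
  have hF' := fun v => (bil_comm _ _).trans (hF v)
  have hN := fun v => h.normal z hz v
  have hN' := fun v => (bil_comm _ _).trans (hN v)
  have b2' := (bil_comm _ _).trans b2
  have c3' := (bil_comm _ _).trans c3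
  -- `F, N, F₁, F_I` is an orthogonal basis of `ℝ⁴`, its own dual up to scale, and the derivative of
  -- `N` has no component along `F` or `N`.
  have key := eq_sum_of_bil ![F z, N z, fderiv ℝ F z 1, fderiv ℝ F z I]
    ![F z, N z, fderiv ℝ F z 1, fderiv ℝ F z I] ![-1, -1, k, k]
    (by intro i; fin_cases i <;> simp [hk.ne'])
    (by intro i; fin_cases i <;> simp [b1, b3, c1, c2])
    (by
      intro i j hij
      fin_cases i <;> fin_cases j <;>
        first | exact absurd rfl hij | simp [b2, b2', hF, hF', hN, hN', c3, c3'])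
    (fderiv ℝ N z v)
  obtain ⟨-, n1, n2⟩ := h.fderiv_bil_eq_zero hU hz v
  simp only [Fin.sum_univ_four, Matrix.cons_val_zero, Matrix.cons_val_one, Matrix.cons_val,
    bil_comm (fderiv ℝ N z v)] at key
  rw [bil_comm] at n1 n2
  rw [n1, n2] at key
  simpa using key

/-- Inner products of the derivatives of a maximal surface and of its normal. -/
lemma exists_shape (h : IsMaximalCoord U F N) (hU : IsOpen U) (hz : z ∈ U) {k : ℝ} (hk : 0 < k)
    (hc : IsConformalForm (inducedForm F z) k) : ∃ a b : ℝ,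
      bil (fderiv ℝ F z 1) (fderiv ℝ N z 1) = a ∧ bil (fderiv ℝ F z I) (fderiv ℝ N z I) = -a ∧
      bil (fderiv ℝ F z 1) (fderiv ℝ N z I) = b ∧ bil (fderiv ℝ F z I) (fderiv ℝ N z 1) = b ∧
      fderiv ℝ N z 1 = (a / k) • fderiv ℝ F z 1 + (b / k) • fderiv ℝ F z I ∧
      fderiv ℝ N z I = (b / k) • fderiv ℝ F z 1 + (-a / k) • fderiv ℝ F z I ∧
      bil (fderiv ℝ N z 1) (fderiv ℝ N z 1) = (a ^ 2 + b ^ 2) / k ∧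
      bil (fderiv ℝ N z I) (fderiv ℝ N z I) = (a ^ 2 + b ^ 2) / k ∧
      bil (fderiv ℝ N z 1) (fderiv ℝ N z I) = 0 := by
  have e1 := h.mixed_symm hU hz
  have e2 : bil (fderiv ℝ F z I) (fderiv ℝ N z I) = -bil (fderiv ℝ F z 1) (fderiv ℝ N z 1) := by
    linarith [h.trace_eq_zero hU hz]
  have w1 := h.weingarten hU hz hk hc 1
  have w2 := h.weingarten hU hz hk hc I
  rw [e1] at w1
  rw [e2] at w2
  refine ⟨_, _, rfl, e2, rfl, e1, w1, w2, ?_, ?_, ?_⟩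
  · nth_rw 1 [w1]
    rw [bil_add_left, bil_smul_left, bil_smul_left, e1]
    ring
  · nth_rw 1 [w2]
    rw [bil_add_left, bil_smul_left, bil_smul_left, e2]
    ring
  · nth_rw 1 [w1]
    rw [bil_add_left, bil_smul_left, bil_smul_left, e2]
    ring

/-- The Laplacians of a maximal surface and of its normal have no tangential part. -/
lemma bil_laplacian (h : IsMaximalCoord U F N) (hU : IsOpen U) (hz : z ∈ U) :
    bil (d2 F z 1 1 + d2 F z I I) (fderiv ℝ F z 1) = 0 ∧
    bil (d2 F z 1 1 + d2 F z I I) (fderiv ℝ F z I) = 0 ∧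
    bil (d2 N z 1 1 + d2 N z I I) (fderiv ℝ F z 1) = 0 ∧
    bil (d2 N z 1 1 + d2 N z I I) (fderiv ℝ F z I) = 0 := by
  obtain ⟨k, hk, hc⟩ := h.spacelike z hz
  obtain ⟨a, b, s1, s2, s3, s4, w1, w2, -⟩ := h.exists_shape hU hz hk hc
  have hp := h.isNormalPair hU
  have dF := differentiableAt_fderiv_apply (hp.smooth_F z hz)
  have dN := differentiableAt_fderiv_apply (hp.smooth_N z hz)
  have sF := d2_symm (hp.smooth_F z hz) 1 I
  have sN := d2_symm (hp.smooth_N z hz) 1 I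
  -- `p1` and `p2` differentiate conformality of `F`; `q1` and `q2` differentiate the vanishing
  -- trace and the symmetry of the second fundamental form. Weingarten's equation removes the
  -- derivatives of `N` of first order, leaving the tangential Laplacians.
  have p1 : ∀ v : ℂ, bil (d2 F z v 1) (fderiv ℝ F z 1) = bil (d2 F z v I) (fderiv ℝ F z I) := by
    intro v
    have e : (fun ζ => bil (fderiv ℝ F ζ 1) (fderiv ℝ F ζ 1)) =ᶠ[𝓝 z]
        fun ζ => bil (fderiv ℝ F ζ I) (fderiv ℝ F ζ I) :=
      Filter.mem_of_superset (hU.mem_nhds hz) fun ζ hζ => by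
        obtain ⟨k', -, hc'⟩ := h.spacelike ζ hζ
        exact hc'.values.1.trans hc'.values.2.1.symm
    have := DFunLike.congr_fun (e.fderiv_eq (𝕜 := ℝ)) v
    rw [fderiv_bil (dF 1) (dF 1), fderiv_bil (dF I) (dF I), bil_comm (fderiv ℝ F z 1),
      bil_comm (fderiv ℝ F z I)] at this
    change bil (d2 F z v 1) _ + bil (d2 F z v 1) _ = bil (d2 F z v I) _ + bil (d2 F z v I) _ at this
    linarith
  have p2 : ∀ v : ℂ, bil (d2 F z v 1) (fderiv ℝ F z I) + bil (d2 F z v I) (fderiv ℝ F z 1) = 0 := by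
    intro v
    rw [bil_comm (d2 F z v I)]
    exact bil_fderiv_of_eventually_const (dF 1) (dF I)
      (Filter.mem_of_superset (hU.mem_nhds hz) fun ζ hζ => by
        obtain ⟨k', -, hc'⟩ := h.spacelike ζ hζ
        exact hc'.values.2.2) v
  have q1 : ∀ v : ℂ, bil (d2 F z v 1) (fderiv ℝ N z 1) + bil (fderiv ℝ F z 1) (d2 N z v 1) +
      (bil (d2 F z v I) (fderiv ℝ N z I) + bil (fderiv ℝ F z I) (d2 N z v I)) = 0 := by
    intro v
    have e : (fun ζ => bil (fderiv ℝ F ζ 1) (fderiv ℝ N ζ 1)) =ᶠ[𝓝 z]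
        fun ζ => -bil (fderiv ℝ F ζ I) (fderiv ℝ N ζ I) :=
      Filter.mem_of_superset (hU.mem_nhds hz) fun ζ hζ =>
        eq_neg_of_add_eq_zero_left (h.trace_eq_zero hU hζ)
    have := DFunLike.congr_fun (e.fderiv_eq (𝕜 := ℝ)) v
    rw [fderiv_fun_neg, neg_apply, fderiv_bil (dF 1) (dN 1), fderiv_bil (dF I) (dN I)] at this
    exact add_eq_zero_iff_eq_neg.2 this
  have q2 : ∀ v : ℂ, bil (d2 F z v I) (fderiv ℝ N z 1) + bil (fderiv ℝ F z I) (d2 N z v 1) =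
      bil (d2 F z v 1) (fderiv ℝ N z I) + bil (fderiv ℝ F z 1) (d2 N z v I) := by
    intro v
    have e : (fun ζ => bil (fderiv ℝ F ζ I) (fderiv ℝ N ζ 1)) =ᶠ[𝓝 z]
        fun ζ => bil (fderiv ℝ F ζ 1) (fderiv ℝ N ζ I) :=
      Filter.mem_of_superset (hU.mem_nhds hz) fun ζ hζ => h.mixed_symm hU hζ
    have := DFunLike.congr_fun (e.fderiv_eq (𝕜 := ℝ)) v
    rw [fderiv_bil (dF I) (dN 1), fderiv_bil (dF 1) (dN I)] at this
    exact this
  have a1 := p1 1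
  have a2 := p1 I
  have a3 := p2 1
  have a4 := p2 I
  have b1 := q1 1
  have b2 := q1 I
  have b3 := q2 1
  have b4 := q2 I
  rw [← sF] at a2 a4 b2 b4
  rw [← sN] at b2 b4
  rw [w1, w2] at b1 b2 b3 b4
  simp only [bil_add_right, bil_smul_right] at b1 b2 b3 b4
  simp only [bil_add_left, bil_comm (d2 N z _ _)]
  refine ⟨by linarith, by linarith, ?_, ?_⟩
  · linear_combination b1 - b4 - (a / k) * a1 + (a / k) * a4 - (b / k) * a3 - (b / k) * a2
  · linear_combination b2 + b3 + (b / k) * a1 - (b / k) * a4 - (a / k) * a3 - (a / k) * a2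

/-- The imaginary part of `herm f_v f_w` is half of `⟨N_v, F_w⟩ - ⟨F_v, N_w⟩`, zero by symmetry of
the shape operator. That operator is also trace-free, so `N` induces a multiple of the metric of
`F`. Harmonicity follows since the derivatives of `N` are tangent to `F`. -/
lemma isHorizontalMinLag (h : IsMaximalCoord U F N) (hU : IsOpen U) :
    IsHorizontalMinLag U fun ζ => liftL (F ζ, N ζ) := by
  have hp := h.isNormalPair hU
  have dF := fun z hz => (hp.smooth_F z hz).differentiableAt (n := ∞) (by simp)
  have dN := fun z hz => (hp.smooth_N z hz).differentiableAt (n := ∞) (by simp)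
  have hd : ∀ z ∈ U, ∀ v, fderiv ℝ (fun ζ => liftL (F ζ, N ζ)) z v =
      liftL (fderiv ℝ F z v, fderiv ℝ N z v) := fun z hz v =>
    fderiv_liftL (dF z hz) (dN z hz) v
  have hd2 : ∀ z ∈ U, ∀ v w, d2 (fun ζ => liftL (F ζ, N ζ)) z v w =
      liftL (d2 F z v w, d2 N z v w) := by
    intro z hz v w
    have e : (fun ζ => fderiv ℝ (fun ζ => liftL (F ζ, N ζ)) ζ w) =ᶠ[𝓝 z]
        fun ζ => liftL (fderiv ℝ F ζ w, fderiv ℝ N ζ w) :=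
      Filter.mem_of_superset (hU.mem_nhds hz) fun ζ hζ => hd ζ hζ w
    rw [d2, e.fderiv_eq]
    exact fderiv_liftL (differentiableAt_fderiv_apply (hp.smooth_F z hz) w)
      (differentiableAt_fderiv_apply (hp.smooth_N z hz) w) v
  refine ⟨fun z hz => ?_, fun z hz => ?_, fun z hz => ?_, fun z hz v => ?_, fun z hz => ?_,
    fun z hz => ?_⟩
  · exact liftL.contDiff.contDiffAt.comp z ((hp.smooth_F z hz).prodMk (hp.smooth_N z hz))
  · obtain ⟨b1, b2, b3⟩ := h.mem_bundle z hz
    change bil (F z) (F z) = -1 at b1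
    change bil (F z) (N z) = 0 at b2
    change bil (N z) (N z) = -1 at b3
    rw [herm_liftL, b1, b2, b3, bil_comm, b2]
    norm_num
  · obtain ⟨b1, b2, b3⟩ := h.mem_bundle z hz
    change bil (F z) (F z) = -1 at b1
    change bil (F z) (N z) = 0 at b2
    change bil (N z) (N z) = -1 at b3
    rw [bil_liftL, b1, b2, b3, bil_comm, b2]
    norm_num
  · obtain ⟨e1, e2, e3⟩ := h.fderiv_bil_eq_zero hU hz v
    rw [hd z hz, herm_liftL, e1, e2, e3, h.normal z hz]
    norm_num
  · obtain ⟨k, hk, hc⟩ := h.spacelike z hz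
    obtain ⟨a, b, s1, s2, s3, s4, w1, w2, n1, n2, n3⟩ := h.exists_shape hU hz hk hc
    obtain ⟨c1, c2, c3⟩ := hc.values
    have c3' := (bil_comm _ _).trans c3
    have n3' := (bil_comm _ _).trans n3
    refine ⟨(k + (a ^ 2 + b ^ 2) / k) / 2, by positivity, fun v w => ?_⟩
    rw [hd z hz, hd z hz, herm_liftL, fderiv_eq_re_im (fderiv ℝ F z) v,
      fderiv_eq_re_im (fderiv ℝ N z) v, fderiv_eq_re_im (fderiv ℝ F z) w,
      fderiv_eq_re_im (fderiv ℝ N z) w]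
    simp only [bil_add_left, bil_add_right, bil_smul_left, bil_smul_right, c1, c2, c3, c3',
      n1, n2, n3, n3', bil_comm (fderiv ℝ N z _) (fderiv ℝ F z _), s1, s2, s3, s4]
    apply Complex.ext
    · simp
      ring
    · simp
      ring
  · obtain ⟨k, hk, hc⟩ := h.spacelike z hz
    obtain ⟨a, b, s1, s2, s3, s4, w1, w2, -⟩ := h.exists_shape hU hz hk hc
    obtain ⟨l1, l2, l3, l4⟩ := h.bil_laplacian hU hz
    intro v
    rw [hd2 z hz, hd2 z hz, hd z hz, ← map_add, Prod.mk_add_mk, herm_liftL,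
      fderiv_eq_re_im (fderiv ℝ F z) v, fderiv_eq_re_im (fderiv ℝ N z) v, w1, w2]
    simp only [bil_add_right, bil_smul_right, l1, l2, l3, l4]
    simp

/-- The coefficients `α`, `β` and the metric of the lift of a maximal surface. -/
lemma lift_coefficients (h : IsMaximalCoord U F N) (hU : IsOpen U) (hz : z ∈ U) :
    alpha (fun ζ => liftL (F ζ, N ζ)) z = -I * hopf F N z ∧
    ∀ u' : ℝ, IsConformalForm (inducedForm F z) (2 * Real.exp u') →
      IsConformalForm (lagMetric (fun ζ => liftL (F ζ, N ζ)) z)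
        (Real.exp u' + ‖hopf F N z‖ ^ 2 * Real.exp (-u')) ∧
      beta (fun ζ => liftL (F ζ, N ζ)) z =
        (((Real.exp u' - ‖hopf F N z‖ ^ 2 * Real.exp (-u')) / 2 : ℝ) : ℂ) := by
  have hp := h.isNormalPair hU
  have dF := (hp.smooth_F z hz).differentiableAt (n := ∞) (by simp)
  have dN := (hp.smooth_N z hz).differentiableAt (n := ∞) (by simp)
  have H := h.isHorizontalMinLag hU
  have main : ∀ k : ℝ, 0 < k → IsConformalForm (inducedForm F z) k →
      ∃ a b : ℝ, hopf F N z = ⟨-a / 2, b / 2⟩ ∧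
        alpha (fun ζ => liftL (F ζ, N ζ)) z = ⟨b / 2, a / 2⟩ ∧
        beta (fun ζ => liftL (F ζ, N ζ)) z = ((k - (a ^ 2 + b ^ 2) / k) / 4 : ℝ) ∧
        IsConformalForm (lagMetric (fun ζ => liftL (F ζ, N ζ)) z)
          ((k + (a ^ 2 + b ^ 2) / k) / 2) := by
    intro k hk hc
    obtain ⟨a, b, s1, s2, s3, s4, w1, w2, n1, n2, n3⟩ := h.exists_shape hU hz hk hc
    obtain ⟨c1, c2, c3⟩ := hc.values
    refine ⟨a, b, ?_, ?_, ?_, ?_⟩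
    · rw [hp.hopf_eq hU hz, s1, s2, s3, s4]
      apply Complex.ext <;> simp <;> ring
    · rw [alpha_eq_tform]
      simp only [tform, fderiv_liftL dF dN, bil_liftL, bil_comm (fderiv ℝ N z _) (fderiv ℝ F z _),
        s1, s2, s3, s4, n1, n2, n3, c1, c2, c3]
      apply Complex.ext <;> simp <;> ring
    · rw [beta_eq_tform]
      simp only [tform, fderiv_liftL dF dN, bil_liftL, bil_comm (fderiv ℝ N z _) (fderiv ℝ F z _),
        s1, s2, n1, n2, c1, c2]
      apply Complex.ext <;> simp <;> ring
    · obtain ⟨c, hc0, Hc⟩ := (H.isMinLagCoord hU).immersion z hz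
      have e := H.scale_eq_of_lagMetric hU hz Hc
      rw [fderiv_liftL dF dN, herm_liftL, bil_comm (fderiv ℝ N z 1) (fderiv ℝ F z 1), c1, n1,
        sub_self] at e
      have e' : c = (k + (a ^ 2 + b ^ 2) / k) / 2 := by
        apply ofReal_injective
        rw [← e]
        push_cast
        ring
      rwa [← e']
  refine ⟨?_, fun u' hu' => ?_⟩
  · obtain ⟨k, hk, hc⟩ := h.spacelike z hz
    obtain ⟨a, b, h1, h2, -⟩ := main k hk hc
    rw [h1, h2]
    apply Complex.ext <;> simp
    ring
  · obtain ⟨a, b, h1, -, h3, h4⟩ := main _ (by positivity) hu'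
    -- With `k = 2 * Real.exp u'` this turns `(a² + b²)/k` into `2 * ‖hopf F N z‖ ^ 2 * Real.exp
    -- (-u')`.
    have e : ‖hopf F N z‖ ^ 2 = (a ^ 2 + b ^ 2) / 4 := by
      rw [h1, ← normSq_eq_norm_sq, normSq_mk]
      ring
    rw [e, Real.exp_neg]
    have hne := Real.exp_ne_zero u'
    constructor
    · convert h4 using 1
      field_simp
      ring
    · rw [h3]
      congr 1
      field_simp
      ring

end IsMaximalCoord

/-! ### Maximal surfaces parametrized by a Riemann surface -/

section RiemannSurface

variable {M : Type*} [TopologicalSpace M] [ChartedSpace ℂ M] [IsManifold 𝓘(ℂ) ω M]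
  {F N : M → Fin 4 → ℝ}

lemma continuous_of_coords {F : M → Fin 4 → ℝ}
    (h : ∀ φ ∈ coords M, ContDiffOn ℝ ∞ (F ∘ φ.symm) (dom φ Set.univ)) : Continuous F := by
  rw [continuous_iff_continuousAt]
  intro p
  have hφ : chartAt ℂ p ∈ coords M := IsManifold.chart_mem_maximalAtlas p
  have hp := mem_chart_source ℂ p
  set φ := chartAt ℂ p
  have h1 := ((h φ hφ).contDiffAt ((isOpen_dom φ isOpen_univ).mem_nhds
    ⟨φ.map_source hp, trivial⟩)).continuousAt
  refine (h1.comp (φ.continuousAt hp)).congr ?_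
  filter_upwards [φ.open_source.mem_nhds hp] with q hq
  simp [hq]

lemma IsMaximalSurface.mem_T1minus (h : IsMaximalSurface Set.univ F N) (p : M) :
    (F p, N p) ∈ T1minus := by
  have hp := mem_chart_source ℂ p
  have := (h _ (IsManifold.chart_mem_maximalAtlas p)).mem_bundle _
    (show chartAt ℂ p p ∈ dom (chartAt ℂ p) Set.univ from ⟨(chartAt ℂ p).map_source hp, trivial⟩)
  simpa [hp] using this

/-- The normal of a connected maximal surface, or its opposite, is future-pointing. -/
theorem IsMaximalSurface.futurePointing_or [PreconnectedSpace M]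
    (h : IsMaximalSurface Set.univ F N) :
    (∀ p, FuturePointing (F p) (N p)) ∨ (∀ p, FuturePointing (F p) (-N p)) := by
  have cF := continuous_of_coords fun φ hφ => (h φ hφ).smooth_F
  have cN := continuous_of_coords fun φ hφ => (h φ hφ).smooth_N
  have c := fun i => (continuous_apply i).comp cF
  have c' := fun i => (continuous_apply i).comp cN
  have hw : Continuous fun p => F p 0 * N p 1 - F p 1 * N p 0 :=
    ((c 0).mul (c' 1)).sub ((c 1).mul (c' 0))
  have hne := fun p => orientation_ne_zero (h.mem_T1minus p)
  by_cases hex : ∃ p, 0 < F p 0 * N p 1 - F p 1 * N p 0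
  · left
    obtain ⟨p₀, hp₀⟩ := hex
    have := isPreconnected_univ.subset_left_of_subset_union (isOpen_lt continuous_const hw)
      (isOpen_lt hw continuous_const)
      (Set.disjoint_left.2 fun p (h1 : 0 < _) (h2 : _ < (0 : ℝ)) => lt_asymm h1 h2)
      (fun p _ => (lt_or_gt_of_ne (hne p)).symm) ⟨p₀, Set.mem_univ p₀, hp₀⟩
    exact fun p => this (Set.mem_univ p)
  · right
    push Not at hex
    intro p
    have := lt_of_le_of_ne (hex p) (hne p)
    simp only [FuturePointing, Pi.neg_apply]
    linarith

/-- The lift of a maximal surface with future-pointing normal is a horizontal lift of a minimal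
Lagrangian surface. -/
theorem IsMaximalSurface.exists_minimalLagrangian (h : IsMaximalSurface Set.univ F N)
    (hfut : ∀ p, FuturePointing (F p) (N p)) :
    ∃ (f : M → CP3) (𝔣 : M → Fin 4 → ℂ), (∀ p, IsClass (f p) (cvec (F p) (N p))) ∧
      (∀ p, 𝔣 p = ((1 / Real.sqrt 2 : ℝ) : ℂ) • cvec (F p) (N p)) ∧
      IsMinimalLagrangian f ∧ IsHorizontalLift Set.univ f 𝔣 ∧
      ∀ φ ∈ coords M, DifferentiableOn ℂ (alpha (𝔣 ∘ φ.symm)) φ.target ∧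
        ∀ z ∈ φ.target,
          alpha (𝔣 ∘ φ.symm) z = -I * hopf (F ∘ φ.symm) (N ∘ φ.symm) z ∧
          ∀ u' : ℝ, IsConformalForm (inducedForm (F ∘ φ.symm) z) (2 * Real.exp u') →
            IsConformalForm (lagMetric (𝔣 ∘ φ.symm) z)
              (Real.exp u' + ‖hopf (F ∘ φ.symm) (N ∘ φ.symm) z‖ ^ 2 * Real.exp (-u')) ∧
            beta (𝔣 ∘ φ.symm) z = (((Real.exp u' -
              ‖hopf (F ∘ φ.symm) (N ∘ φ.symm) z‖ ^ 2 * Real.exp (-u')) / 2 : ℝ) : ℂ) := by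
  have s2 : ((1 / √2 : ℝ) : ℂ) ≠ 0 := by
    have : (0 : ℝ) < 1 / √2 := by positivity
    exact_mod_cast this.ne'
  have hT := h.mem_T1minus
  have hherm : ∀ p, herm (liftL (F p, N p)) (liftL (F p, N p)) = -1 := by
    intro p
    obtain ⟨b1, b2, b3⟩ := hT p
    change bil (F p) (F p) = -1 at b1
    rw [herm_liftL, b1, b2, b3, bil_comm, b2]
    norm_num
  have hne : ∀ p, cvec (F p) (N p) ≠ 0 := by
    intro p h0
    have := hherm p
    rw [liftL_apply, h0, smul_zero, herm_zero_left] at this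
    norm_num at this
  let f : M → CP3 := fun p => Projectivization.mk ℂ _ (hne p)
  let 𝔣 : M → Fin 4 → ℂ := fun p => liftL (F p, N p)
  have hcl : ∀ p, IsClass (f p) (cvec (F p) (N p)) := fun p => ⟨hne p, rfl⟩
  have hlift : ∀ p, IsClass (f p) (𝔣 p) := fun p => by
    simp only [𝔣]
    rw [liftL_apply]
    exact (hcl p).smul s2
  have ht : ∀ φ : OpenPartialHomeomorph M ℂ, dom φ Set.univ = φ.target := fun φ => by simp [dom]
  have H : ∀ φ ∈ coords M, IsHorizontalMinLag φ.target (𝔣 ∘ φ.symm) := fun φ hφ => by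
    have := (h φ hφ).isHorizontalMinLag (isOpen_dom φ isOpen_univ)
    rw [ht] at this
    exact this
  have hmem : ∀ p, f p ∈ Q2star := by
    intro p
    obtain ⟨b1, b2, b3⟩ := hT p
    change bil (F p) (F p) = -1 at b1
    refine mem_Q2star (hlift p) ?_ ?_ ?_
    · simp only [𝔣]
      rw [bil_liftL, b1, b2, b3, bil_comm, b2]
      norm_num
    · simp only [𝔣]
      rw [hherm]
      norm_num
    · simp only [𝔣, liftL_apply, Pi.smul_apply, smul_eq_mul]
      have e1 : ∀ x y : ℂ, ((1 / √2 : ℝ) : ℂ) * x + I * (((1 / √2 : ℝ) : ℂ) * y) =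
          ((1 / √2 : ℝ) : ℂ) * (x + I * y) := fun x y => by ring
      have e2 : ∀ x y : ℂ, ((1 / √2 : ℝ) : ℂ) * x - I * (((1 / √2 : ℝ) : ℂ) * y) =
          ((1 / √2 : ℝ) : ℂ) * (x - I * y) := fun x y => by ring
      rw [e1, e2, norm_mul, norm_mul]
      refine mul_lt_mul_of_pos_left ?_ (norm_pos_iff.2 s2)
      refine lt_of_pow_lt_pow_left₀ 2 (norm_nonneg _) ?_
      -- The difference of the two squared norms is four times the expression `F₀N₁ - F₁N₀` whose
      -- positivity defines future-pointing.
      rw [← normSq_eq_norm_sq, ← normSq_eq_norm_sq, normSq_apply, normSq_apply]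
      have := hfut p
      simp only [FuturePointing] at this
      simp [cvec, toC]
      nlinarith
  refine ⟨f, 𝔣, hcl, fun p => liftL_apply _ _, ⟨hmem, fun φ hφ z hz => ?_⟩,
    ⟨fun p _ => hlift p, fun p _ => hherm p, fun φ hφ => ?_, fun φ hφ z hz => ?_⟩,
    fun φ hφ => ⟨fun z hz => ?_, fun z hz => ?_⟩⟩
  · exact ⟨φ.target, φ.open_target, hz, subset_rfl, 𝔣 ∘ φ.symm, fun w _ => hlift _,
      (H φ hφ).isMinLagCoord φ.open_target⟩
  · rw [ht]
    exact fun z hz => ((H φ hφ).smooth z hz).contDiffWithinAt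
  · rw [ht] at hz
    exact herm_dz_eq_zero ((H φ hφ).horizontal z hz)
  · exact ((H φ hφ).differentiableAt_alpha φ.open_target hz).differentiableWithinAt
  · exact (h φ hφ).lift_coefficients (isOpen_dom φ isOpen_univ) (by rwa [ht])

end RiemannSurface

end MaxLag

end

theorem theorem1p6 {M : Type*} [TopologicalSpace M] [ChartedSpace ℂ M] [IsManifold 𝓘(ℂ) ω M] :
    -- From spacelike maximal surfaces to minimal Lagrangian surfaces.
    (∀ F N : M → Fin 4 → ℝ, MaxLag.IsMaximalSurface Set.univ F N →
      (PreconnectedSpace M → (∀ p, MaxLag.FuturePointing (F p) (N p)) ∨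
        (∀ p, MaxLag.FuturePointing (F p) (-N p))) ∧
      ((∀ p, MaxLag.FuturePointing (F p) (N p)) →
        ∃ (f : M → MaxLag.CP3) (𝔣 : M → Fin 4 → ℂ),
          (∀ p, MaxLag.IsClass (f p) (MaxLag.cvec (F p) (N p))) ∧
          (∀ p, 𝔣 p = ((1 / Real.sqrt 2 : ℝ) : ℂ) • MaxLag.cvec (F p) (N p)) ∧
          MaxLag.IsMinimalLagrangian f ∧
          MaxLag.IsHorizontalLift Set.univ f 𝔣 ∧
          ∀ φ ∈ MaxLag.coords M,
            DifferentiableOn ℂ (MaxLag.alpha (𝔣 ∘ φ.symm)) φ.target ∧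
            ∀ z ∈ φ.target,
              MaxLag.alpha (𝔣 ∘ φ.symm) z =
                -Complex.I * MaxLag.hopf (F ∘ φ.symm) (N ∘ φ.symm) z ∧
              ∀ u' : ℝ, MaxLag.IsConformalForm (MaxLag.inducedForm (F ∘ φ.symm) z)
                  (2 * Real.exp u') →
                MaxLag.IsConformalForm (MaxLag.lagMetric (𝔣 ∘ φ.symm) z)
                  (Real.exp u' +
                    ‖MaxLag.hopf (F ∘ φ.symm) (N ∘ φ.symm) z‖ ^ 2 * Real.exp (-u')) ∧
                MaxLag.beta (𝔣 ∘ φ.symm) z =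
                  (((Real.exp u' -
                    ‖MaxLag.hopf (F ∘ φ.symm) (N ∘ φ.symm) z‖ ^ 2 * Real.exp (-u')) / 2 : ℝ) : ℂ))) ∧
    -- From minimal Lagrangian surfaces to spacelike maximal surfaces.
    (∀ f : M → MaxLag.CP3, MaxLag.IsMinimalLagrangian f →
      -- Every normalized horizontal lift gives a pair.
      (∀ (V : Set M) (𝔣 : M → Fin 4 → ℂ), IsOpen V → IsPreconnected V →
        MaxLag.IsHorizontalLift V f 𝔣 →
        (∀ φ ∈ MaxLag.coords M, ∀ z ∈ MaxLag.dom φ V,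
          (MaxLag.beta (𝔣 ∘ φ.symm) z).im = 0 ∧ 0 ≤ (MaxLag.beta (𝔣 ∘ φ.symm) z).re) →
        (∃ φ ∈ MaxLag.coords M, ∃ z ∈ MaxLag.dom φ V, MaxLag.beta (𝔣 ∘ φ.symm) z ≠ 0) →
        ∃ F N : M → Fin 4 → ℝ, MaxLag.IsCompanionPair V f 𝔣 F N ∧
          ∀ φ ∈ MaxLag.coords M,
            DifferentiableOn ℂ (MaxLag.alpha (𝔣 ∘ φ.symm)) (MaxLag.dom φ V) ∧
            ∀ z ∈ MaxLag.dom φ V, ∀ u : ℝ,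
              MaxLag.IsConformalForm (MaxLag.lagMetric (𝔣 ∘ φ.symm) z) (2 * Real.exp u) →
              MaxLag.IsConformalForm (MaxLag.inducedForm (F ∘ φ.symm) z)
                (2 * (Real.exp u +
                  Real.sqrt (Real.exp (2 * u) - ‖MaxLag.alpha (𝔣 ∘ φ.symm) z‖ ^ 2))) ∧
              MaxLag.IsConformalForm (MaxLag.inducedForm (N ∘ φ.symm) z)
                (2 * (Real.exp u -
                  Real.sqrt (Real.exp (2 * u) - ‖MaxLag.alpha (𝔣 ∘ φ.symm) z‖ ^ 2)))) ∧
      -- Near every point there is a pair; the root `b` of `e^{2u} - |α|²` is smooth, and it is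
      -- the positive one if it does not vanish at the given point.
      (∀ p : M, ∃ (V : Set M) (𝔣 : M → Fin 4 → ℂ), IsOpen V ∧ p ∈ V ∧
        MaxLag.IsHorizontalLift V f 𝔣 ∧
        ((∀ φ ∈ MaxLag.coords M, ∀ z ∈ MaxLag.dom φ V, 0 < (MaxLag.beta (𝔣 ∘ φ.symm) z).re) ∨
          (∀ φ ∈ MaxLag.coords M, p ∈ φ.source → MaxLag.beta (𝔣 ∘ φ.symm) (φ p) = 0)) ∧
        ∃ F N : M → Fin 4 → ℝ, MaxLag.IsCompanionPair V f 𝔣 F N ∧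
          ∀ φ ∈ MaxLag.coords M,
            DifferentiableOn ℂ (MaxLag.alpha (𝔣 ∘ φ.symm)) (MaxLag.dom φ V) ∧
            ∀ z ∈ MaxLag.dom φ V, ∃ b : ℝ, MaxLag.beta (𝔣 ∘ φ.symm) z = (b : ℂ) ∧
              ∀ u : ℝ,
              MaxLag.IsConformalForm (MaxLag.lagMetric (𝔣 ∘ φ.symm) z) (2 * Real.exp u) →
              b ^ 2 = Real.exp (2 * u) - ‖MaxLag.alpha (𝔣 ∘ φ.symm) z‖ ^ 2 ∧
              MaxLag.IsConformalForm (MaxLag.inducedForm (F ∘ φ.symm) z)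
                (2 * (Real.exp u + b)) ∧
              MaxLag.IsConformalForm (MaxLag.inducedForm (N ∘ φ.symm) z)
                (2 * (Real.exp u - b)))) := by
  refine ⟨fun F N h => ⟨fun _ => h.futurePointing_or, fun hfut => h.exists_minimalLagrangian hfut⟩,
    fun f hf => ⟨fun V 𝔣 hV hc h hβ hne => ?_, fun p => hf.exists_local_companion p⟩⟩
  exact hf.companion_of_normalized hV hc h hβ hne
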